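/- All graphs are finite and simple. Write $P_5$ for the path on five vertices and $\overline{P}_5$ for its complement; a graph is $(P_5,\overline{P}_5)$-free if it contains neither of them as an induced subgraph. A graph $G$ is $k$-critical if $\chi(G)=k$ and no proper induced subgraph of $G$ has chromatic number $k$. Let $\mathcal{C}_k$ be the family of $k$-critical $(P_5,\overline{P}_5)$-free graphs, taken up to isomorphism, and let $f(k)=|\mathcal{C}_k|$ (so $\mathcal{C}_0$ consists of the graph without vertices, and $f(0)=1$). Let $5\uparrow\uparrow k$ denote the tower of $k$ copies of $5$, that is, $5\uparrow\uparrow 0=1$ and $5\uparrow\uparrow(k+1)=5^{5\uparrow\uparrow k}$. Theorem. For every integer $k\ge 0$ the following hold. 1. $\mathcal{C}_k$ is finite. 2. If $k\ge 2$, then $$f(k)\le \sum_{i=1}^{k-1} f(i)\,f(k-i) + f(k-2)^5 .$$ 3. $f(k)\le 5\uparrow\uparrow k$. 4. $k$-colorability of $(P_5,\overline{P}_5)$-free graphs has a polynomial-time certifying algorithm on a unit-cost random access machine (operations: constants, reading and writing variables and entries of two-dimensional arrays, addition, truncated subtraction, tests for zero; the graph is given by its adjacency matrix). That is, for this fixed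 $k$: (a) there is a program that, on every $(P_5,\overline{P}_5)$-free graph $G$ with $n$ vertices, halts after a number of steps bounded by a polynomial in $n$ (depending only on $k$), decides correctly whether $G$ is $k$-colorable, and outputs a certificate: a $k$-coloring of $G$ if the answer is yes, and a list of distinct vertices of $G$ that induce a member of $\mathcal{C}_{k+1}$ if the answer is no; (b) there is a program that, given a $(P_5,\overline{P}_5)$-free graph $G$ with $n$ vertices, an answer (yes or no) and an arbitrary finite list of natural numbers, decides whether the list is a certificate for that answer as described in (a), in a number of steps that is bounded by a polynomial in $n$ and, if the answer is no, by a constant; the polynomial and the constant depend only on $k$. -/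

import Mathlib

namespace P5Graphs

/-! ### Critical graphs and the family `C_k` -/

/-- `G` contains neither the path on five vertices nor its complement as an induced subgraph. -/
def IsP5CoP5Free {V : Type*} (G : SimpleGraph V) : Prop :=
  ¬ (SimpleGraph.pathGraph 5).IsIndContained G ∧ ¬ (SimpleGraph.pathGraph 5)ᶜ.IsIndContained G

/-- `G` is `k`-critical: it is `k`-chromatic and none of its proper induced subgraphs is. -/
def IsCritical {V : Type*} (k : ℕ) (G : SimpleGraph V) : Prop :=
  G.chromaticNumber = k ∧ ∀ s : Set V, s ≠ Set.univ → (G.induce s).chromaticNumber ≠ k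

/-- `G` is a `k`-critical graph without induced `P₅` and without induced complement of `P₅`. -/
def IsMember {V : Type*} (k : ℕ) (G : SimpleGraph V) : Prop :=
  IsCritical k G ∧ IsP5CoP5Free G

/-- Finite graphs, with vertex set `{0, …, n - 1}`. -/
abbrev FinGraph : Type := Σ n : ℕ, SimpleGraph (Fin n)

/-- Isomorphism of finite graphs. -/
instance isoSetoid : Setoid FinGraph where
  r G H := Nonempty (G.2 ≃g H.2)
  iseqv :=
    { refl := fun _ => ⟨SimpleGraph.Iso.refl⟩
      symm := fun ⟨e⟩ => ⟨e.symm⟩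
      trans := fun ⟨e⟩ ⟨e'⟩ => ⟨e.trans e'⟩ }

/-- The family of `k`-critical `(P₅, co-P₅)`-free finite graphs, as a set of isomorphism classes. -/
def C (k : ℕ) : Set (Quotient isoSetoid) :=
  {c | ∃ G : FinGraph, IsMember k G.2 ∧ (Quotient.mk isoSetoid G) = c}

/-- The number of isomorphism classes in the family. -/
noncomputable def f (k : ℕ) : ℕ := (C k).ncard

/-! ### A unit-cost random access machine

Programs act on scalar variables and two-dimensional arrays, all holding natural numbers.
The arithmetic operations are addition and truncated subtraction only (no multiplication), so that
unit cost is polynomially equivalent to Turing machine time. -/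

structure Store where
  /-- scalar variables -/
  var : ℕ → ℕ
  /-- `arr a i j` is the entry in row `i` and column `j` of the array `a` -/
  arr : ℕ → ℕ → ℕ → ℕ

inductive Expr where
  | lit (c : ℕ)
  | var (x : ℕ)
  | get (a : ℕ) (i j : Expr)
  | add (e₁ e₂ : Expr)
  | sub (e₁ e₂ : Expr)

def Expr.eval (σ : Store) : Expr → ℕ
  | .lit c => c
  | .var x => σ.var x
  | .get a i j => σ.arr a (i.eval σ) (j.eval σ)
  | .add e₁ e₂ => e₁.eval σ + e₂.eval σ
  | .sub e₁ e₂ => e₁.eval σ - e₂.eval σ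

/-- The cost of evaluating an expression: one step for each constant, access and operation. -/
def Expr.cost : Expr → ℕ
  | .lit _ => 1
  | .var _ => 1
  | .get _ i j => i.cost + j.cost + 1
  | .add e₁ e₂ => e₁.cost + e₂.cost + 1
  | .sub e₁ e₂ => e₁.cost + e₂.cost + 1

inductive Prog where
  | skip
  | assign (x : ℕ) (e : Expr)
  | put (a : ℕ) (i j e : Expr)
  | seq (P Q : Prog)
  /-- run `P` if `e ≠ 0`, and `Q` otherwise -/
  | cond (e : Expr) (P Q : Prog)
  /-- run `P` as long as `e ≠ 0` -/
  | loop (e : Expr) (P : Prog)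

def Store.setVar (σ : Store) (x v : ℕ) : Store :=
  { σ with var := fun y => if y = x then v else σ.var y }

def Store.setArr (σ : Store) (a i j v : ℕ) : Store :=
  { σ with arr := fun b r s => if b = a ∧ r = i ∧ s = j then v else σ.arr b r s }

/-- `Exec P σ τ t`: started in `σ`, the program `P` halts in `τ` after exactly `t` steps. -/
inductive Exec : Prog → Store → Store → ℕ → Prop where
  | skip (σ : Store) : Exec .skip σ σ 1
  | assign (x : ℕ) (e : Expr) (σ : Store) :
      Exec (.assign x e) σ (σ.setVar x (e.eval σ)) (e.cost + 1)
  | put (a : ℕ) (i j e : Expr) (σ : Store) :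
      Exec (.put a i j e) σ (σ.setArr a (i.eval σ) (j.eval σ) (e.eval σ))
        (i.cost + j.cost + e.cost + 1)
  | seq {P Q : Prog} {σ τ ρ : Store} {s t : ℕ} :
      Exec P σ τ s → Exec Q τ ρ t → Exec (.seq P Q) σ ρ (s + t)
  | cond_true {e : Expr} {P Q : Prog} {σ τ : Store} {t : ℕ} :
      e.eval σ ≠ 0 → Exec P σ τ t → Exec (.cond e P Q) σ τ (e.cost + 1 + t)
  | cond_false {e : Expr} {P Q : Prog} {σ τ : Store} {t : ℕ} :
      e.eval σ = 0 → Exec Q σ τ t → Exec (.cond e P Q) σ τ (e.cost + 1 + t)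
  | loop_true {e : Expr} {P : Prog} {σ τ ρ : Store} {s t : ℕ} :
      e.eval σ ≠ 0 → Exec P σ τ s → Exec (.loop e P) τ ρ t →
        Exec (.loop e P) σ ρ (e.cost + 1 + s + t)
  | loop_false {e : Expr} {P : Prog} {σ : Store} :
      e.eval σ = 0 → Exec (.loop e P) σ σ (e.cost + 1)

/-! ### Certifying algorithms for `k`-colorability -/

open Classical in
/-- The adjacency matrix, padded with zeros. -/
noncomputable def adjEntry {n : ℕ} (G : SimpleGraph (Fin n)) (i j : ℕ) : ℕ :=
  if ∃ u v : Fin n, u.val = i ∧ v.val = j ∧ G.Adj u v then 1 else 0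

/-- The initial store for an input graph: variable `0` holds the number of vertices, array `0` the
adjacency matrix, and everything else is zero. -/
noncomputable def graphInput {n : ℕ} (G : SimpleGraph (Fin n)) : Store where
  var x := if x = 0 then n else 0
  arr a i j := if a = 0 then adjEntry G i j else 0

/-- The initial store for an input graph together with an answer (variable `1`, where `1` means
yes and `0` means no) and a certificate (its length in variable `2`, its entries in column `0` of
array `1`). -/
noncomputable def certifiedInput {n : ℕ} (G : SimpleGraph (Fin n)) (ans : Bool) (cert : List ℕ) :
    Store where
  var x := if x = 0 then n else if x = 1 then ans.toNat else if x = 2 then cert.length else 0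
  arr a i j :=
    if a = 0 then adjEntry G i j else if a = 1 ∧ j = 0 then cert.getD i 0 else 0

/-- The store holds the given answer and certificate, in the format just described. -/
def Store.Outputs (σ : Store) (ans : Bool) (cert : List ℕ) : Prop :=
  σ.var 1 = ans.toNat ∧ σ.var 2 = cert.length ∧ ∀ i < cert.length, σ.arr 1 i 0 = cert.getD i 0

/-- Correct certificates for `k`-colorability. For the answer yes: the list of the colors of the
vertices `0, …, n - 1` in a `k`-coloring of `G`. For the answer no: a list of distinct vertices of
`G` that induce a `(k + 1)`-critical `(P₅, co-P₅)`-free graph. -/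
def IsCertificate {n : ℕ} (G : SimpleGraph (Fin n)) (k : ℕ) : Bool → List ℕ → Prop
  | true, cert => ∃ c : G.Coloring (Fin k), cert = List.ofFn fun v => (c v : ℕ)
  | false, cert => ∃ l : List (Fin n), l.Nodup ∧ cert = l.map Fin.val ∧
      IsMember (k + 1) (G.induce {v | v ∈ l})

/-- In polynomial time, `P` decides `k`-colorability of `(P₅, co-P₅)`-free graphs and outputs
a certificate along with the answer. -/
def SolvesWithCertificate (k : ℕ) (P : Prog) : Prop :=
  ∃ p : Polynomial ℕ, ∀ (n : ℕ) (G : SimpleGraph (Fin n)), IsP5CoP5Free G →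
    ∃ (σ : Store) (t : ℕ) (ans : Bool) (cert : List ℕ),
      Exec P (graphInput G) σ t ∧ t ≤ p.eval n ∧ σ.Outputs ans cert ∧
      (ans = true ↔ G.Colorable k) ∧ IsCertificate G k ans cert

/-- `Q` checks arbitrary purported certificates (it accepts by setting variable `3` to `1` and
rejects by setting it to `0`): in polynomial time for the answer yes, and in constant time for the
answer no. -/
def ChecksCertificates (k : ℕ) (Q : Prog) : Prop :=
  ∃ (p : Polynomial ℕ) (c : ℕ), ∀ (n : ℕ) (G : SimpleGraph (Fin n)), IsP5CoP5Free G →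
    ∀ (ans : Bool) (cert : List ℕ), ∃ (σ : Store) (t : ℕ),
      Exec Q (certifiedInput G ans cert) σ t ∧ t ≤ p.eval n ∧ (ans = false → t ≤ c) ∧
      (IsCertificate G k ans cert → σ.var 3 = 1) ∧ (¬ IsCertificate G k ans cert → σ.var 3 = 0)

/-- `k`-colorability of `(P₅, co-P₅)`-free graphs has a certifying algorithm. -/
def HasCertifyingAlgorithm (k : ℕ) : Prop :=
  (∃ P : Prog, SolvesWithCertificate k P) ∧ ∃ Q : Prog, ChecksCertificates k Q

end P5Graphs

/-! The class is closed under substitution because $P_5$ and $\overline{P}_5$ are prime: a copy of a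
prime pattern in a substituted graph lies in one fiber or meets each fiber at most once. Around an
induced five-cycle, the absence of the path and of the house leaves three kinds of vertices: those
that see the whole cycle, those that see none of it, and those that see it as some cycle vertex
does, up to the adjacency to that vertex itself. Hence the five sets `part` form an expansion of
$C_5$, and their union, the `hull`, is homogeneous (`IsC5.adj_parts`, `IsC5.adj_outside`). Without
induced five-cycles the graphs are perfect: when the vertices are ordered by decreasing degree,
every clique that avoids the greedy stable set can be extended by a vertex of that set
(`IsKernel.exists_adj_clique`), so removing this set lowers the clique number. Thus a critical graph
without induced $C_5$ is complete. If the hull of a five-cycle is not the whole graph, replacing it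
by a clique with the same chromatic number gives a smaller critical graph of the class. By
induction, every critical graph with chromatic number at least two is a join or an expansion of
$C_5$ (`IsMember.exists_expansion`). Coloring an expansion amounts to assigning disjoint color sets
along the edges of the base graph, where the sizes are the chromatic numbers of the fibers. So the
fibers are critical; for chromatic number $k$, the weights of a join add up to $k$, and those of an
expansion of $C_5$ add up to $2k-1$, with at most $k-1$ on each edge. The fibers have smaller
chromatic number, whence finiteness. For the term $f(k-2)^5$ the weights are normalized by the
symmetries of $C_5$, and the tuples of fibers are counted with the inequality `f_add_le`
(`normalTuples_finite`). The tower bound follows from the recursion. By finiteness, a graph of the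
class that is not $k$-colorable contains a critical subgraph of bounded size, which exhaustive
search finds in polynomial time. If there is none, a coloring is found by merging stable sets into
single vertices, preserving the class and $k$-colorability: either the greedy stable set of a
homogeneous set without five-cycles, or two vertices of a five-cycle all of whose parts are cliques.
In the second case the search for critical subgraphs tells whether the merged graph is still
$k$-colorable (`IsMergeable.isReduction`). The process ends with a clique and isolated vertices. The
programs come from combinators for tests, numbers and store transformations; a certificate for the
answer no has bounded length, so a fixed table of tests checks it in constant time. -/

namespace P5Graphs

/-! ### Program combinators for the random access machine -/

/-- `τ` agrees with `σ` on all variables and arrays with index below `b`. -/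
def Agree (b : ℕ) (σ τ : Store) : Prop :=
  (∀ x < b, τ.var x = σ.var x) ∧ ∀ a < b, τ.arr a = σ.arr a

theorem Agree.refl (b : ℕ) (σ : Store) : Agree b σ σ := ⟨fun _ _ => rfl, fun _ _ => rfl⟩

theorem Agree.trans {b : ℕ} {σ τ ρ : Store} (h : Agree b σ τ) (h' : Agree b τ ρ) : Agree b σ ρ :=
  ⟨fun x hx => (h'.1 x hx).trans (h.1 x hx), fun x hx => (h'.2 x hx).trans (h.2 x hx)⟩

theorem Agree.mono {b c : ℕ} {σ τ : Store} (h : Agree b σ τ) (hc : c ≤ b) : Agree c σ τ :=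
  ⟨fun x hx => h.1 x (hx.trans_le hc), fun x hx => h.2 x (hx.trans_le hc)⟩

@[simp] theorem setVar_var_self (σ : Store) (x v : ℕ) : (σ.setVar x v).var x = v := by
  simp [Store.setVar]

theorem setVar_var (σ : Store) (x v y : ℕ) :
    (σ.setVar x v).var y = if y = x then v else σ.var y := rfl

theorem setVar_var_ne (σ : Store) {x v y : ℕ} (h : y ≠ x) : (σ.setVar x v).var y = σ.var y := by
  simp [Store.setVar, h]

@[simp] theorem setVar_arr (σ : Store) (x v : ℕ) : (σ.setVar x v).arr = σ.arr := rfl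

@[simp] theorem setArr_var (σ : Store) (a i j v : ℕ) : (σ.setArr a i j v).var = σ.var := rfl

theorem setArr_arr (σ : Store) (a i j v b r s : ℕ) :
    (σ.setArr a i j v).arr b r s = if b = a ∧ r = i ∧ s = j then v else σ.arr b r s := rfl

theorem Agree.setVar {b : ℕ} {σ τ : Store} (h : Agree b σ τ) (x v : ℕ) :
    Agree b (σ.setVar x v) (τ.setVar x v) :=
  ⟨fun y hy => by simp only [setVar_var, h.1 y hy], fun a ha => h.2 a ha⟩

theorem Agree.setVar_right {b : ℕ} {σ τ : Store} (h : Agree b σ τ) {x : ℕ} (hx : b ≤ x) (v : ℕ) :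
    Agree b σ (τ.setVar x v) :=
  ⟨fun y hy => by rw [setVar_var_ne _ (by omega), h.1 y hy], fun a ha => h.2 a ha⟩

theorem Agree.setArr {b : ℕ} {σ τ : Store} (h : Agree b σ τ) (a i j v : ℕ) :
    Agree b (σ.setArr a i j v) (τ.setArr a i j v) :=
  ⟨fun y hy => h.1 y hy, fun c hc => by
    funext r s
    rw [setArr_arr, setArr_arr, h.2 c hc]⟩

/-- The time bounds in use: all polynomials, or (for `q = false`) only constants. -/
def Adm (q : Bool) (p : Polynomial ℕ) : Prop := q = true ∨ ∃ c, p = Polynomial.C c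

theorem Adm.add {q : Bool} {p p' : Polynomial ℕ} (h : Adm q p) (h' : Adm q p') :
    Adm q (p + p') := by
  rcases h with h | ⟨c, rfl⟩
  · exact .inl h
  rcases h' with h' | ⟨c', rfl⟩
  · exact .inl h'
  exact .inr ⟨c + c', by simp⟩

theorem Adm.const (q : Bool) (c : ℕ) : Adm q (Polynomial.C c) := .inr ⟨c, rfl⟩

/-- Some program computes `f` into a scratch variable, without changing lower-numbered data. -/
def Evaluable (q : Bool) (f : Store → ℕ) : Prop :=
  ∃ b₀, 0 < b₀ ∧ (∀ σ τ, Agree b₀ σ τ → f τ = f σ) ∧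
    ∀ b, b₀ ≤ b → ∃ (P : Prog) (p : Polynomial ℕ), Adm q p ∧ ∀ σ, ∃ τ t,
      Exec P σ τ t ∧ t ≤ p.eval (σ.var 0) ∧ Agree b σ τ ∧ τ.var b = f σ

open Classical in
/-- Some program decides `φ`. -/
def Testable (q : Bool) (φ : Store → Prop) : Prop :=
  Evaluable q fun σ => if φ σ then 1 else 0

/-- Some program effects the transformation `F`, up to scratch data. -/
def Doable (q : Bool) (F : Store → Store) : Prop :=
  ∃ b₀, 0 < b₀ ∧ (∀ b, b₀ ≤ b → ∀ σ τ, Agree b σ τ → Agree b (F σ) (F τ)) ∧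
    (∀ σ, (F σ).var 0 = σ.var 0) ∧ (∀ σ x, b₀ ≤ x → (F σ).var x = σ.var x) ∧
    ∀ b, b₀ ≤ b → ∃ (P : Prog) (p : Polynomial ℕ), Adm q p ∧ ∀ σ, ∃ τ t,
      Exec P σ τ t ∧ t ≤ p.eval (σ.var 0) ∧ Agree b (F σ) τ

theorem Evaluable.congr {q : Bool} {f g : Store → ℕ} (h : Evaluable q f) (e : ∀ σ, g σ = f σ) :
    Evaluable q g := by
  rwa [show g = f from funext e]

theorem Testable.congr {q : Bool} {φ ψ : Store → Prop} (h : Testable q φ) (e : ∀ σ, ψ σ ↔ φ σ) :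
    Testable q ψ := by
  rwa [show ψ = φ from funext fun σ => propext (e σ)]

theorem Evaluable.lit (q : Bool) (c : ℕ) : Evaluable q fun _ => c :=
  ⟨1, one_pos, fun _ _ _ => rfl, fun b _ => ⟨.assign b (.lit c), .C 2, .const _ _, fun σ =>
    ⟨_, _, .assign _ _ _, by simp [Expr.cost], (Agree.refl b σ).setVar_right le_rfl _,
      by simp [Expr.eval]⟩⟩⟩

theorem Evaluable.var (q : Bool) (x : ℕ) : Evaluable q fun σ => σ.var x :=
  ⟨x + 1, by omega, fun σ τ h => h.1 x (by omega), fun b _ =>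
    ⟨.assign b (.var x), .C 2, .const _ _, fun σ =>
    ⟨_, _, .assign _ _ _, by simp [Expr.cost], (Agree.refl b σ).setVar_right le_rfl _,
      by simp [Expr.eval]⟩⟩⟩

/-- The threshold `b` acts as a stack pointer: the first operand goes to `b + 1`, and the second is
computed with threshold `b + 2`, so it cannot overwrite the first. Handing the array `a` to `U`
covers both subtraction and array access. -/
theorem Evaluable.binary {q : Bool} {f g : Store → ℕ} (hf : Evaluable q f) (hg : Evaluable q g)
    (e : ℕ → ℕ → Expr) (a : ℕ) (U : (ℕ → ℕ → ℕ) → ℕ → ℕ → ℕ)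
    (he : ∀ u v σ, (e u v).eval σ = U (σ.arr a) (σ.var u) (σ.var v)) :
    Evaluable q fun σ => U (σ.arr a) (f σ) (g σ) := by
  obtain ⟨b₁, h₁, i₁, r₁⟩ := hf
  obtain ⟨b₂, h₂, i₂, r₂⟩ := hg
  refine ⟨max (max b₁ b₂) (a + 1), by omega, fun σ τ h => ?_, fun b hb => ?_⟩
  · beta_reduce
    rw [i₁ σ τ (h.mono (by omega)), i₂ σ τ (h.mono (by omega)), h.2 a (by omega)]
  obtain ⟨P, p, hp, hP⟩ := r₁ (b + 1) (by omega)
  obtain ⟨Q, p', hp', hQ⟩ := r₂ (b + 2) (by omega)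
  refine ⟨.seq P (.seq Q (.assign b (e (b + 1) (b + 2)))),
    p + p' + .C ((e (b + 1) (b + 2)).cost + 1), (hp.add hp').add (.const _ _), fun σ => ?_⟩
  obtain ⟨τ, t, e₁, c₁, a₁, v₁⟩ := hP σ
  obtain ⟨ρ, s, e₂, c₂, a₂, v₂⟩ := hQ τ
  have a₃ : Agree b σ ρ := (a₁.mono (by omega)).trans (a₂.mono (by omega))
  refine ⟨_, _, .seq e₁ (.seq e₂ (.assign _ _ _)), ?_, a₃.setVar_right le_rfl _, ?_⟩
  · rw [a₁.1 0 (by omega)] at c₂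
    simp only [Polynomial.eval_add, Polynomial.eval_C]
    omega
  · rw [setVar_var_self, he, v₂, a₂.1 (b + 1) (by omega), v₁, a₃.2 a (by omega),
      i₂ σ τ (a₁.mono (by omega))]

theorem Evaluable.sub {q : Bool} {f g : Store → ℕ} (hf : Evaluable q f) (hg : Evaluable q g) :
    Evaluable q fun σ => f σ - g σ :=
  hf.binary hg (fun u v => .sub (.var u) (.var v)) 0 (fun _ m n => m - n) fun _ _ _ => rfl

theorem Evaluable.get {q : Bool} {f g : Store → ℕ} (a : ℕ) (hf : Evaluable q f)
    (hg : Evaluable q g) : Evaluable q fun σ => σ.arr a (f σ) (g σ) :=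
  hf.binary hg (fun u v => .get a (.var u) (.var v)) a (fun A m n => A m n) fun _ _ _ => rfl

theorem Testable.inv {q : Bool} {φ : Store → Prop} (h : Testable q φ) : ∃ b₀, 0 < b₀ ∧
    (∀ σ τ, Agree b₀ σ τ → (φ τ ↔ φ σ)) ∧
    ∀ b, b₀ ≤ b → ∃ (P : Prog) (p : Polynomial ℕ), Adm q p ∧ ∀ σ, ∃ τ t,
      Exec P σ τ t ∧ t ≤ p.eval (σ.var 0) ∧ Agree b σ τ ∧ (τ.var b ≠ 0 ↔ φ σ) := by
  obtain ⟨b₀, h₀, i, r⟩ := h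
  refine ⟨b₀, h₀, fun σ τ h => ?_, fun b hb => ?_⟩
  · have := i σ τ h
    by_cases h1 : φ σ <;> by_cases h2 : φ τ <;> simp_all
  · obtain ⟨P, p, hp, hP⟩ := r b hb
    refine ⟨P, p, hp, fun σ => ?_⟩
    obtain ⟨τ, t, h1, h2, h3, h4⟩ := hP σ
    refine ⟨τ, t, h1, h2, h3, ?_⟩
    rw [h4]
    by_cases hφ : φ σ <;> simp [hφ]

open Classical in
theorem Evaluable.ite {q : Bool} {φ : Store → Prop} {f g : Store → ℕ} (hφ : Testable q φ)
    (hf : Evaluable q f) (hg : Evaluable q g) :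
    Evaluable q fun σ => if φ σ then f σ else g σ := by
  obtain ⟨b₀, h₀, i₀, r₀⟩ := hφ.inv
  obtain ⟨b₁, h₁, i₁, r₁⟩ := hf
  obtain ⟨b₂, h₂, i₂, r₂⟩ := hg
  refine ⟨max (max b₁ b₂) b₀, by omega, fun σ τ h => ?_, fun b hb => ?_⟩
  · beta_reduce
    rw [i₁ σ τ (h.mono (by omega)), i₂ σ τ (h.mono (by omega))]
    simp only [i₀ σ τ (h.mono (by omega))]
  obtain ⟨P, p, hp, hP⟩ := r₁ b (by omega)
  obtain ⟨Q, p', hp', hQ⟩ := r₂ b (by omega)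
  obtain ⟨R, p'', hp'', hR⟩ := r₀ b (by omega)
  -- The test and both branches can share the register `b`, since the branch is selected before `b`
  -- is overwritten.
  refine ⟨.seq R (.cond (.var b) P Q), p + p' + p'' + .C 2,
    ((hp.add hp').add hp'').add (.const _ _), fun σ => ?_⟩
  obtain ⟨τ, t, e₁, c₁, a₁, v₁⟩ := hR σ
  simp only [Polynomial.eval_add, Polynomial.eval_C]
  by_cases h : φ σ
  · obtain ⟨ρ, s, e₂, c₂, a₂, v₂⟩ := hP τ
    refine ⟨_, _, .seq e₁ (.cond_true (by simpa [Expr.eval] using v₁.2 h) e₂), ?_, a₁.trans a₂, ?_⟩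
    · rw [a₁.1 0 (by omega)] at c₂
      simp only [Expr.cost]
      omega
    · rw [if_pos h, v₂, i₁ σ τ (a₁.mono (by omega))]
  · obtain ⟨ρ, s, e₂, c₂, a₂, v₂⟩ := hQ τ
    refine ⟨_, _, .seq e₁ (.cond_false (by simpa [Expr.eval] using fun h' => h (v₁.1 h')) e₂), ?_,
      a₁.trans a₂, ?_⟩
    · rw [a₁.1 0 (by omega)] at c₂
      simp only [Expr.cost]
      omega
    · rw [if_neg h, v₂, i₂ σ τ (a₁.mono (by omega))]

theorem Testable.ne_zero {q : Bool} {f : Store → ℕ} (hf : Evaluable q f) :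
    Testable q fun σ => f σ ≠ 0 :=
  ((Evaluable.lit q 1).sub ((Evaluable.lit q 1).sub hf)).congr fun σ => by
    split_ifs <;> omega

theorem Testable.ite {q : Bool} {φ ψ χ : Store → Prop} (hφ : Testable q φ) (hψ : Testable q ψ)
    (hχ : Testable q χ) : Testable q fun σ => (φ σ → ψ σ) ∧ (¬ φ σ → χ σ) :=
  (Evaluable.ite hφ hψ hχ).congr fun σ => by
    by_cases h : φ σ <;> by_cases h1 : ψ σ <;> by_cases h2 : χ σ <;> simp [h, h1, h2]

theorem Testable.const (q : Bool) (P : Prop) : Testable q fun _ => P :=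
  Evaluable.lit q _

theorem Testable.not {q : Bool} {φ : Store → Prop} (hφ : Testable q φ) :
    Testable q fun σ => ¬ φ σ :=
  (hφ.ite (.const q False) (.const q True)).congr fun σ => by tauto

theorem Testable.and {q : Bool} {φ ψ : Store → Prop} (hφ : Testable q φ) (hψ : Testable q ψ) :
    Testable q fun σ => φ σ ∧ ψ σ :=
  (hφ.ite hψ (.const q False)).congr fun σ => by tauto

theorem Testable.or {q : Bool} {φ ψ : Store → Prop} (hφ : Testable q φ) (hψ : Testable q ψ) :
    Testable q fun σ => φ σ ∨ ψ σ :=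
  (hφ.ite (.const q True) hψ).congr fun σ => by tauto

theorem Testable.imp {q : Bool} {φ ψ : Store → Prop} (hφ : Testable q φ) (hψ : Testable q ψ) :
    Testable q fun σ => φ σ → ψ σ :=
  (hφ.ite hψ (.const q True)).congr fun σ => by tauto

theorem Testable.lt {q : Bool} {f g : Store → ℕ} (hf : Evaluable q f) (hg : Evaluable q g) :
    Testable q fun σ => f σ < g σ :=
  (Testable.ne_zero (hg.sub hf)).congr fun σ => by omega

theorem Testable.eq {q : Bool} {f g : Store → ℕ} (hf : Evaluable q f) (hg : Evaluable q g) :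
    Testable q fun σ => f σ = g σ :=
  ((Testable.lt hf hg).or (Testable.lt hg hf)).not.congr fun σ => by omega

/-- Arbitrary Boolean combinations of finitely many tests. -/
theorem Testable.table {q : Bool} {ι : Type} [Finite ι] {φ : ι → Store → Prop}
    (h : ∀ i, Testable q (φ i)) (P : (ι → Prop) → Prop) : Testable q fun σ => P fun i => φ i σ := by
  revert φ P
  refine Finite.induction_empty_option
    (P := fun ι => ∀ {φ : ι → Store → Prop}, (∀ i, Testable q (φ i)) → ∀ (P : (ι → Prop) → Prop),
      Testable q fun σ => P fun i => φ i σ) ?_ ?_ ?_ ι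
  · intro α β e ih φ h P
    have := ih (φ := fun a => φ (e a)) (fun a => h (e a)) (fun x => P fun b => x (e.symm b))
    simpa using this
  · intro φ h P
    refine (Testable.const q (P fun i => i.elim)).congr fun σ => ?_
    rw [show (fun i => φ i σ) = fun i => i.elim from funext fun i => i.elim]
  · intro α _ ih φ h P
    -- The program is a decision tree that branches on the test `none`. At the leaves the truth
    -- value of `P` is hard-wired, so `P` itself need not be computable.
    refine ((h none).ite (ih (fun i => h (some i)) fun x => P fun o => o.elim True x)
      (ih (fun i => h (some i)) fun x => P fun o => o.elim False x)).congr fun σ => ?_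
    by_cases h0 : φ none σ
    · have : (fun i => φ i σ) = fun o : Option α => o.elim True fun i => φ (some i) σ := by
        funext o; cases o <;> simp [h0]
      simp [h0, this]
    · have : (fun i => φ i σ) = fun o : Option α => o.elim False fun i => φ (some i) σ := by
        funext o; cases o <;> simp [h0]
      simp [h0, this]

/-- The invariant `I i` holds before round `i`. The 8 extra steps per round are 4 for the guard and
4 for the increment of `x`; the final 4 pay for the failing guard. -/
theorem exec_for {x n T : ℕ} {P : Prog} {I : ℕ → Store → Prop} (hx : x ≠ 0)
    (hP : ∀ i < n, ∀ s : Store, s.var 0 = n → s.var x = i → I i s → ∃ s' t, Exec P s s' t ∧ t ≤ T ∧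
      s'.var 0 = n ∧ s'.var x = i ∧ I (i + 1) (s'.setVar x (i + 1)))
    (s : Store) (h0 : s.var 0 = n) (hs : s.var x = 0) (hI : I 0 s) :
    ∃ s' t, Exec (.loop (.sub (.var 0) (.var x)) (.seq P (.assign x (.add (.var x) (.lit 1))))) s s' t
      ∧ t ≤ n * (T + 8) + 4 ∧ s'.var 0 = n ∧ s'.var x = n ∧ I n s' := by
  have key : ∀ d i, i + d = n → ∀ s : Store, s.var 0 = n → s.var x = i → I i s →
      ∃ s' t, Exec (.loop (.sub (.var 0) (.var x)) (.seq P (.assign x (.add (.var x) (.lit 1))))) s s' t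
      ∧ t ≤ d * (T + 8) + 4 ∧ s'.var 0 = n ∧ s'.var x = n ∧ I n s' := by
    intro d
    induction d with
    | zero =>
      intro i hi s h0 hs hI
      obtain rfl : i = n := by omega
      exact ⟨s, _, .loop_false (by simp [Expr.eval, h0, hs]), by simp [Expr.cost], h0, hs, hI⟩
    | succ d ih =>
      intro i hi s h0 hs hI
      obtain ⟨s', t, e, ht, h0', hs', hI'⟩ := hP i (by omega) s h0 hs hI
      obtain ⟨s'', t', e', ht', r⟩ := ih (i + 1) (by omega) (s'.setVar x (i + 1))
        (by rw [setVar_var_ne _ hx.symm, h0']) (by simp) hI'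
      refine ⟨s'', _, .loop_true (by simp only [Expr.eval, h0, hs]; omega)
        (.seq e (.assign _ _ _)) (by simpa [Expr.eval, hs'] using e'), ?_, r⟩
      simp only [Expr.cost]
      rw [Nat.add_mul]
      omega
  exact key n 0 (by omega) s h0 hs hI

open Classical in
/-- The fold of `U` over the numbers `i < n` with property `ψ`, starting from `0`. -/
noncomputable def foldWhere (U : ℕ → ℕ → ℕ) (ψ : ℕ → Prop) : ℕ → ℕ
  | 0 => 0
  | i + 1 => if ψ i then U i (foldWhere U ψ i) else foldWhere U ψ i

theorem setVar_setVar (σ : Store) (x v w : ℕ) : (σ.setVar x v).setVar x w = σ.setVar x w := by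
  simp only [Store.setVar, Store.mk.injEq, and_true]
  funext y
  split_ifs <;> rfl

theorem setVar_self (σ : Store) (x : ℕ) : σ.setVar x (σ.var x) = σ := by
  cases σ
  simp only [Store.setVar, Store.mk.injEq, and_true]
  funext y
  split_ifs with h <;> simp [h]

/-- The variable `x`, which `φ` may read, is itself the loop counter. Its old value is saved in `b +
1` and restored at the end; `b + 2` accumulates, and `b + 3` receives the outcome of the test.
Counting, bounded quantifiers and search are instances. -/
theorem Evaluable.fold {φ : Store → Prop} (hφ : Testable true φ) {x : ℕ} (hx : x ≠ 0)
    (U : ℕ → ℕ → ℕ) (e : ℕ → ℕ → Expr) (he : ∀ u v σ, (e u v).eval σ = U (σ.var u) (σ.var v)) :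
    Evaluable true fun σ => foldWhere U (fun i => φ (σ.setVar x i)) (σ.var 0) := by
  obtain ⟨b₀, h₀, i₀, r₀⟩ := hφ.inv
  refine ⟨max b₀ (x + 1), by omega, fun σ τ h => ?_, fun b hb => ?_⟩
  · have : (fun i => φ (τ.setVar x i)) = fun i => φ (σ.setVar x i) := by
      funext i
      exact propext (i₀ _ _ ((h.mono (by omega)).setVar x i))
    beta_reduce
    rw [this, h.1 0 (by omega)]
  obtain ⟨P, p, hp, hP⟩ := r₀ (b + 3) (by omega)
  set E := e x (b + 2)
  refine ⟨.seq (.seq (.assign (b + 1) (.var x)) (.seq (.assign (b + 2) (.lit 0)) (.assign x (.lit 0))))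
      (.seq (.loop (.sub (.var 0) (.var x)) (.seq (.seq P (.cond (.var (b + 3))
        (.assign (b + 2) E) .skip)) (.assign x (.add (.var x) (.lit 1)))))
      (.seq (.assign x (.var (b + 1))) (.assign b (.var (b + 2))))),
    .X * (p + .C (E.cost + 3 + 8)) + .C 14, .inl rfl, fun σ => ?_⟩
  let s₀ := ((σ.setVar (b + 1) (σ.var x)).setVar (b + 2) 0).setVar x 0
  have hs₀ : s₀.var 0 = σ.var 0 := by simp [s₀, setVar_var, hx.symm]
  obtain ⟨s, t, ex, ht, e0, -, hA, h1, h2⟩ := exec_for (x := x) (n := σ.var 0)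
    (T := p.eval (σ.var 0) + (E.cost + 3))
    (P := .seq P (.cond (.var (b + 3)) (.assign (b + 2) E) .skip))
    (I := fun i s => Agree b (σ.setVar x i) s ∧ s.var (b + 1) = σ.var x ∧
      s.var (b + 2) = foldWhere U (fun i => φ (σ.setVar x i)) i) hx
    (by
        rintro i hi s h0 hsx ⟨hA, h1, h2⟩
        obtain ⟨τ, t, e₁, c₁, a₁, v₁⟩ := hP s
        have hφs : φ s ↔ φ (σ.setVar x i) := i₀ _ _ (hA.mono (by omega))
        rw [hφs] at v₁
        have hτ0 : τ.var 0 = σ.var 0 := by rw [a₁.1 0 (by omega), h0]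
        have hτx : τ.var x = i := by rw [a₁.1 x (by omega), hsx]
        have hAτ : Agree b (σ.setVar x i) τ := hA.trans (a₁.mono (by omega))
        have hA' : ∀ ρ, Agree b (σ.setVar x i) ρ →
            Agree b (σ.setVar x (i + 1)) (ρ.setVar x (i + 1)) := fun ρ h => by
          have := h.setVar x (i + 1)
          rwa [setVar_setVar] at this
        by_cases h : φ (σ.setVar x i)
        · refine ⟨_, _, .seq e₁ (.cond_true (by simpa [Expr.eval] using v₁.2 h) (.assign _ _ _)), ?_,
            ?_, ?_, hA' _ (hAτ.setVar_right (by omega) _), ?_, ?_⟩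
          · simp only [Expr.cost]; rw [h0] at c₁; omega
          · rw [setVar_var_ne _ (by omega), hτ0]
          · rw [setVar_var_ne _ (by omega), hτx]
          · rw [setVar_var_ne _ (by omega), setVar_var_ne _ (by omega), a₁.1 _ (by omega), h1]
          · rw [setVar_var_ne _ (by omega), setVar_var_self, he, hτx, a₁.1 _ (by omega), h2]
            simp [foldWhere, h]
        · refine ⟨_, _, .seq e₁ (.cond_false (by simpa [Expr.eval] using fun h' => h (v₁.1 h'))
            (.skip _)), ?_, hτ0, hτx, hA' _ hAτ, ?_, ?_⟩
          · simp only [Expr.cost]; rw [h0] at c₁; omega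
          · rw [setVar_var_ne _ (by omega), a₁.1 _ (by omega), h1]
          · rw [setVar_var_ne _ (by omega), a₁.1 _ (by omega), h2]
            simp [foldWhere, h])
    s₀ hs₀ (by simp [s₀])
    (by
        refine ⟨?_, ?_, ?_⟩
        · exact (((Agree.refl b σ).setVar_right (by omega) _).setVar_right (by omega) _).setVar x 0
        · simp only [s₀]
          rw [setVar_var_ne _ (by omega), setVar_var_ne _ (by omega), setVar_var_self]
        · simp only [s₀]
          rw [setVar_var_ne _ (by omega), setVar_var_self, foldWhere])
  · refine ⟨_, _, .seq (.seq (.assign _ _ _) (.seq (.assign _ _ _) (.assign _ _ _)))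
      (.seq (by simpa [s₀, Expr.eval] using ex) (.seq (.assign _ _ _) (.assign _ _ _))), ?_, ?_, ?_⟩
    · simp only [Expr.cost, Polynomial.eval_add, Polynomial.eval_C, Polynomial.eval_mul,
        Polynomial.eval_X]
      rw [add_assoc (p.eval _)] at ht
      omega
    · refine Agree.setVar_right ?_ le_rfl _
      have := hA.setVar x (σ.var x)
      rwa [setVar_setVar, setVar_self, ← h1] at this
    · simp only [setVar_var_self, Expr.eval]
      rw [setVar_var_ne _ (by omega), h2]

open Classical in
theorem foldWhere_count (ψ : ℕ → Prop) (n : ℕ) :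
    foldWhere (fun _ m => m + 1) ψ n = ((Finset.range n).filter ψ).card := by
  induction n with
  | zero => simp [foldWhere]
  | succ n ih =>
    rw [foldWhere, Finset.range_add_one, Finset.filter_insert]
    split_ifs <;> simp [ih]

open Classical in
theorem Evaluable.count {φ : Store → Prop} (hφ : Testable true φ) {x : ℕ} (hx : x ≠ 0) :
    Evaluable true fun σ => ((Finset.range (σ.var 0)).filter fun i => φ (σ.setVar x i)).card :=
  (Evaluable.fold hφ hx (fun _ m => m + 1) (fun _ v => .add (.var v) (.lit 1))
    fun _ _ _ => rfl).congr fun _ => (foldWhere_count _ _).symm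

theorem Testable.ex {φ : Store → Prop} (x : ℕ) (hx : x ≠ 0) (hφ : Testable true φ) :
    Testable true fun σ => ∃ i < σ.var 0, φ (σ.setVar x i) :=
  (Testable.ne_zero (Evaluable.count hφ hx)).congr fun σ => by
    rw [ne_eq, Finset.card_eq_zero, ← ne_eq, ← Finset.nonempty_iff_ne_empty]
    simp [Finset.Nonempty]

theorem Testable.all {φ : Store → Prop} (x : ℕ) (hx : x ≠ 0) (hφ : Testable true φ) :
    Testable true fun σ => ∀ i < σ.var 0, φ (σ.setVar x i) :=
  (Testable.ex x hx hφ.not).not.congr fun σ => by simp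

/-- Here each hit overwrites the previous one, so the fold searches for a witness. -/
theorem foldWhere_last {ψ : ℕ → Prop} {n : ℕ} (h : ∃ i < n, ψ i) :
    foldWhere (fun i _ => i) ψ n < n ∧ ψ (foldWhere (fun i _ => i) ψ n) := by
  induction n with
  | zero => simp at h
  | succ n ih =>
    rw [foldWhere]
    split_ifs with hn
    · exact ⟨by omega, hn⟩
    · obtain ⟨i, hi, h⟩ := h
      have : i ≠ n := by rintro rfl; exact hn h
      have := ih ⟨i, by omega, h⟩
      exact ⟨by omega, this.2⟩

theorem Doable.id (q : Bool) : Doable q fun σ => σ :=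
  ⟨1, one_pos, fun _ _ _ _ h => h, fun _ => rfl, fun _ _ _ => rfl, fun b _ =>
    ⟨.skip, .C 1, .const _ _, fun σ => ⟨σ, 1, .skip σ, by simp, .refl _ _⟩⟩⟩

theorem Doable.comp {q : Bool} {F G : Store → Store} (hG : Doable q G) (hF : Doable q F) :
    Doable q fun σ => G (F σ) := by
  obtain ⟨b₁, h₁, i₁, z₁, k₁, r₁⟩ := hF
  obtain ⟨b₂, h₂, i₂, z₂, k₂, r₂⟩ := hG
  refine ⟨max b₁ b₂, by omega, fun b hb σ τ h => i₂ b (by omega) _ _ (i₁ b (by omega) _ _ h),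
    fun σ => by rw [z₂, z₁], fun σ x hx => by rw [k₂ _ _ (by omega), k₁ _ _ (by omega)],
    fun b hb => ?_⟩
  obtain ⟨P, p, hp, hP⟩ := r₁ b (by omega)
  obtain ⟨Q, p', hp', hQ⟩ := r₂ b (by omega)
  refine ⟨.seq P Q, p + p', hp.add hp', fun σ => ?_⟩
  obtain ⟨τ, t, e₁, c₁, a₁⟩ := hP σ
  obtain ⟨ρ, s, e₂, c₂, a₂⟩ := hQ τ
  refine ⟨ρ, _, .seq e₁ e₂, ?_, (i₂ b (by omega) _ _ a₁).trans a₂⟩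
  rw [a₁.1 0 (by omega), z₁] at c₂
  simp only [Polynomial.eval_add]
  omega

open Classical in
theorem Doable.ite {q : Bool} {φ : Store → Prop} {F G : Store → Store} (hφ : Testable q φ)
    (hF : Doable q F) (hG : Doable q G) : Doable q fun σ => if φ σ then F σ else G σ := by
  obtain ⟨b₀, h₀, i₀, r₀⟩ := hφ.inv
  obtain ⟨b₁, h₁, i₁, z₁, k₁, r₁⟩ := hF
  obtain ⟨b₂, h₂, i₂, z₂, k₂, r₂⟩ := hG
  refine ⟨max (max b₁ b₂) b₀, by omega, fun b hb σ τ h => ?_,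
    fun σ => by dsimp only; split_ifs <;> simp [z₁, z₂],
    fun σ x hx => by dsimp only; split_ifs <;> simp [k₁ σ x (by omega), k₂ σ x (by omega)],
    fun b hb => ?_⟩
  · simp only [i₀ σ τ (h.mono (by omega))]
    split_ifs
    · exact i₁ b (by omega) _ _ h
    · exact i₂ b (by omega) _ _ h
  obtain ⟨P, p, hp, hP⟩ := r₁ b (by omega)
  obtain ⟨Q, p', hp', hQ⟩ := r₂ b (by omega)
  obtain ⟨R, p'', hp'', hR⟩ := r₀ b (by omega)
  refine ⟨.seq R (.cond (.var b) P Q), p + p' + p'' + .C 2,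
    ((hp.add hp').add hp'').add (.const _ _), fun σ => ?_⟩
  obtain ⟨τ, t, e₁, c₁, a₁, v₁⟩ := hR σ
  simp only [Polynomial.eval_add, Polynomial.eval_C]
  by_cases h : φ σ
  · obtain ⟨ρ, s, e₂, c₂, a₂⟩ := hP τ
    refine ⟨_, _, .seq e₁ (.cond_true (by simpa [Expr.eval] using v₁.2 h) e₂), ?_, ?_⟩
    · rw [a₁.1 0 (by omega)] at c₂
      simp only [Expr.cost]
      omega
    · rw [if_pos h]
      exact (i₁ b (by omega) _ _ a₁).trans a₂
  · obtain ⟨ρ, s, e₂, c₂, a₂⟩ := hQ τ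
    refine ⟨_, _, .seq e₁ (.cond_false (by simpa [Expr.eval] using fun h' => h (v₁.1 h')) e₂), ?_,
      ?_⟩
    · rw [a₁.1 0 (by omega)] at c₂
      simp only [Expr.cost]
      omega
    · rw [if_neg h]
      exact (i₂ b (by omega) _ _ a₁).trans a₂

theorem Doable.setVar {q : Bool} {f : Store → ℕ} (x : ℕ) (hx : x ≠ 0) (hf : Evaluable q f) :
    Doable q fun σ => σ.setVar x (f σ) := by
  obtain ⟨b₁, h₁, i₁, r₁⟩ := hf
  refine ⟨max b₁ (x + 1), by omega, fun b hb σ τ h => ?_,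
    fun σ => by rw [setVar_var_ne _ hx.symm], fun σ y hy => by rw [setVar_var_ne _ (by omega)],
    fun b hb => ?_⟩
  · beta_reduce
    rw [i₁ σ τ (h.mono (by omega))]
    exact h.setVar x _
  obtain ⟨P, p, hp, hP⟩ := r₁ b (by omega)
  refine ⟨.seq P (.assign x (.var b)), p + .C 2, hp.add (.const _ _), fun σ => ?_⟩
  obtain ⟨τ, t, e₁, c₁, a₁, v₁⟩ := hP σ
  refine ⟨_, _, .seq e₁ (.assign _ _ _), ?_, ?_⟩
  · simp only [Expr.cost, Polynomial.eval_add, Polynomial.eval_C]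
    omega
  · simp only [Expr.eval, v₁]
    exact a₁.setVar x _

theorem Doable.put {q : Bool} (a i x : ℕ) :
    Doable q fun σ => σ.setArr a i 0 (σ.var x) := by
  refine ⟨max (a + 1) (x + 1), by omega, fun b hb σ τ h => ?_, fun σ => rfl, fun σ y hy => rfl,
    fun b hb => ⟨.put a (.lit i) (.lit 0) (.var x), .C 4, .const _ _, fun σ =>
      ⟨_, _, .put _ _ _ _ _, by simp [Expr.cost], .refl _ _⟩⟩⟩
  beta_reduce
  rw [h.1 x (by omega)]
  exact h.setArr _ _ _ _

/-- The loop counter lives in `b`: the body is compiled with threshold `b + 1` and hence preserves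
it, and `F` itself neither reads nor changes variables that high. -/
theorem Doable.iterate {F : Store → Store} (hF : Doable true F) :
    Doable true fun σ => F^[σ.var 0] σ := by
  obtain ⟨b₁, h₁, i₁, z₁, k₁, r₁⟩ := hF
  have zi : ∀ n σ, (F^[n] σ).var 0 = σ.var 0 := fun n => by
    induction n with
    | zero => intro; rfl
    | succ n ih => intro σ; rw [Function.iterate_succ_apply', z₁, ih]
  have ki : ∀ n σ x, b₁ ≤ x → (F^[n] σ).var x = σ.var x := fun n => by
    induction n with
    | zero => intros; rfl
    | succ n ih => intro σ x hx; rw [Function.iterate_succ_apply', k₁ _ _ hx, ih _ _ hx]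
  refine ⟨b₁, h₁, fun b hb σ τ h => ?_, fun σ => zi _ _, fun σ x hx => ki _ _ _ hx, fun b hb => ?_⟩
  · beta_reduce
    rw [h.1 0 (by omega)]
    induction σ.var 0 with
    | zero => exact h
    | succ n ih =>
      rw [Function.iterate_succ_apply', Function.iterate_succ_apply']
      exact i₁ b hb _ _ ih
  obtain ⟨P, p, hp, hP⟩ := r₁ (b + 1) (by omega)
  refine ⟨.seq (.assign b (.lit 0)) (.loop (.sub (.var 0) (.var b))
    (.seq P (.assign b (.add (.var b) (.lit 1))))), .X * (p + .C 8) + .C 6, .inl rfl, fun σ => ?_⟩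
  obtain ⟨s, t, ex, ht, -, -, hA⟩ := exec_for (x := b) (n := σ.var 0) (T := p.eval (σ.var 0))
    (P := P) (I := fun i s => Agree b (F^[i] σ) s) (by omega)
    (by
        intro i hi s h0 hb' hA
        obtain ⟨τ, t, e₁, c₁, a₁⟩ := hP s
        refine ⟨τ, t, e₁, by rwa [h0] at c₁, ?_, ?_, ?_⟩
        · rw [a₁.1 0 (by omega), z₁, h0]
        · rw [a₁.1 b (by omega), k₁ _ _ hb, hb']
        · rw [Function.iterate_succ_apply']
          exact ((i₁ b hb _ _ hA).trans (a₁.mono (by omega))).setVar_right le_rfl _)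
    (σ.setVar b 0)
    (setVar_var_ne _ (by omega)) (by simp) ((Agree.refl b σ).setVar_right le_rfl _)
  · refine ⟨s, _, .seq (.assign _ _ _) (by simpa [Expr.eval] using ex), ?_, hA⟩
    simp only [Expr.cost, Polynomial.eval_add, Polynomial.eval_C, Polynomial.eval_mul,
        Polynomial.eval_X]
    omega

/-- Overwrite the entries `i, j < n` of the array `a` with given values. -/
def Store.fill (σ : Store) (a : ℕ) (g : ℕ → ℕ → ℕ) : Store :=
  { σ with arr := fun b i j =>
      if b = a ∧ i < σ.var 0 ∧ j < σ.var 0 then g i j else σ.arr b i j }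

theorem fill_var (σ : Store) (a : ℕ) (g : ℕ → ℕ → ℕ) : (σ.fill a g).var = σ.var := rfl

theorem fill_arr (σ : Store) (a : ℕ) (g : ℕ → ℕ → ℕ) (b i j : ℕ) : (σ.fill a g).arr b i j =
    if b = a ∧ i < σ.var 0 ∧ j < σ.var 0 then g i j else σ.arr b i j := rfl

/-- The pair `(i, j)` is the next cell in row-major order; `hrow` passes from the end of a row to
the next one, and `hset` says that the invariant ignores the two counters. -/
theorem exec_for_for {x y n T : ℕ} {P : Prog} {I : ℕ → ℕ → Store → Prop} (hx : x ≠ 0) (hy : y ≠ 0)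
    (hxy : x ≠ y)
    (hP : ∀ i < n, ∀ j < n, ∀ s : Store, s.var 0 = n → s.var x = i → s.var y = j → I i j s →
      ∃ s' t, Exec P s s' t ∧ t ≤ T ∧ s'.var 0 = n ∧ s'.var x = i ∧ s'.var y = j ∧ I i (j + 1) s')
    (hrow : ∀ i s, I i n s → I (i + 1) 0 s)
    (hset : ∀ i j s v, I i j s → I i j (s.setVar x v) ∧ I i j (s.setVar y v))
    (s : Store) (h0 : s.var 0 = n) (hI : I 0 0 s) :
    ∃ s' t, Exec (.seq (.assign x (.lit 0)) (.loop (.sub (.var 0) (.var x)) (.seq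
      (.seq (.assign y (.lit 0)) (.loop (.sub (.var 0) (.var y)) (.seq P
        (.assign y (.add (.var y) (.lit 1))))))
      (.assign x (.add (.var x) (.lit 1)))))) s s' t
      ∧ t ≤ n * (n * (T + 8) + 14) + 6 ∧ s'.var 0 = n ∧ I n 0 s' := by
  obtain ⟨s', t, ex, ht, h0', -, hI'⟩ := exec_for (x := x) (n := n) (T := n * (T + 8) + 6)
    (P := .seq (.assign y (.lit 0)) (.loop (.sub (.var 0) (.var y)) (.seq P
        (.assign y (.add (.var y) (.lit 1))))))
    (I := fun i s => I i 0 s) hx (fun i hi s h0 hs hI => by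
      obtain ⟨s', t, ex, ht, h0', -, hx', hI'⟩ := exec_for (x := y) (n := n) (T := T) (P := P)
        (I := fun j s => s.var x = i ∧ I i j s) hy (fun j hj s h0 hs ⟨hsx, hI⟩ => by
          obtain ⟨s', t, ex, ht, h0', hx', hy', hI'⟩ := hP i hi j hj s h0 hsx hs hI
          exact ⟨s', t, ex, ht, h0', hy', by rw [setVar_var_ne _ hxy, hx'], (hset _ _ _ _ hI').2⟩)
        (s.setVar y 0) (by rw [setVar_var_ne _ hy.symm, h0]) (by simp)
        ⟨by rw [setVar_var_ne _ hxy, hs], (hset _ _ _ _ hI).2⟩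
      refine ⟨s', _, .seq (.assign _ _ _) ex, ?_, h0', hx', (hset _ _ _ _ (hrow _ _ hI')).1⟩
      simp only [Expr.cost]
      omega)
    (s.setVar x 0) (by rw [setVar_var_ne _ hx.symm, h0]) (by simp) (hset _ _ _ _ hI).1
  refine ⟨s', _, .seq (.assign _ _ _) ex, ?_, h0', hI'⟩
  simp only [Expr.cost, Nat.add_assoc] at ht ⊢
  norm_num at ht ⊢
  omega

/-- All values refer to the original store, but `f` may read the array `a`. So a first pass collects
the values in the scratch array `b`, and a second pass copies them to `a`. -/
theorem Doable.fill {f : Store → ℕ} (hf : Evaluable true f) (a x y : ℕ) (hx : x ≠ 0) (hy : y ≠ 0)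
    (hxy : x ≠ y) :
    Doable true fun σ => σ.fill a fun i j => f ((σ.setVar x i).setVar y j) := by
  obtain ⟨b₀, h₀, i₀, r₀⟩ := hf
  refine ⟨max (max b₀ (a + 1)) (max (x + 1) (y + 1)), by omega, fun b hb σ τ h => ?_,
    fun σ => rfl, fun σ z hz => rfl, fun b hb => ?_⟩
  · refine ⟨h.1, fun c hc => ?_⟩
    funext i j
    simp only [fill_arr, h.2 c hc, h.1 0 (by omega)]
    rw [i₀ ((σ.setVar x i).setVar y j) _ (((h.mono (by omega)).setVar x i).setVar y j)]
  obtain ⟨P, p, hp, hP⟩ := r₀ (b + 3) (by omega)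
  refine ⟨.seq (.seq (.assign (b + 1) (.var x)) (.assign (b + 2) (.var y))) (.seq (.seq
    (.seq (.assign x (.lit 0)) (.loop (.sub (.var 0) (.var x)) (.seq
      (.seq (.assign y (.lit 0)) (.loop (.sub (.var 0) (.var y)) (.seq
        (.seq P (.put b (.var x) (.var y) (.var (b + 3))))
        (.assign y (.add (.var y) (.lit 1))))))
      (.assign x (.add (.var x) (.lit 1))))))
    (.seq (.assign x (.lit 0)) (.loop (.sub (.var 0) (.var x)) (.seq
      (.seq (.assign y (.lit 0)) (.loop (.sub (.var 0) (.var y)) (.seq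
        (.put a (.var x) (.var y) (.get b (.var x) (.var y)))
        (.assign y (.add (.var y) (.lit 1))))))
      (.assign x (.add (.var x) (.lit 1)))))))
    (.seq (.assign x (.var (b + 1))) (.assign y (.var (b + 2))))),
    .X * (.X * (p + .C (4 + 8)) + .C 14) + .X * (.X * (.C 14) + .C 14) + .C 20, .inl rfl,
    fun σ => ?_⟩
  set n := σ.var 0
  set g : ℕ → ℕ → ℕ := fun i j => f ((σ.setVar x i).setVar y j)
  let s₀ := (σ.setVar (b + 1) (σ.var x)).setVar (b + 2) (σ.var y)
  let K : Store → Prop := fun s => (∀ z < b, z ≠ x → z ≠ y → s.var z = σ.var z) ∧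
    s.var (b + 1) = σ.var x ∧ s.var (b + 2) = σ.var y
  have hK : ∀ s v, K s → K (s.setVar x v) ∧ K (s.setVar y v) := by
    rintro s v ⟨h1, h2, h3⟩
    refine ⟨⟨fun z hz hzx hzy => ?_, ?_, ?_⟩, ⟨fun z hz hzx hzy => ?_, ?_, ?_⟩⟩ <;>
      rw [setVar_var_ne _ (by first | assumption | omega)] <;> simp_all
  obtain ⟨s₁, t₁, ex₁, ht₁, h1₀, K₁, A₁, B₁⟩ := exec_for_for (x := x) (y := y) (n := n)
    (T := p.eval n + 4) (P := .seq P (.put b (.var x) (.var y) (.var (b + 3))))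
    (I := fun i j s => K s ∧ (∀ c < b, s.arr c = σ.arr c) ∧
      ∀ r < n, ∀ t < n, r < i ∨ r = i ∧ t < j → s.arr b r t = g r t) hx hy hxy
    (by
      rintro i hi j hj s h0 hsx hsy ⟨hKs, hA, hB⟩
      obtain ⟨τ, t, e₁, c₁, a₁, v₁⟩ := hP s
      refine ⟨_, _, .seq e₁ (.put _ _ _ _ _), ?_, ?_, ?_, ?_, ⟨?_, ?_, ?_⟩, ?_, ?_⟩
      · simp only [Expr.cost]; rw [h0] at c₁; omega
      · rw [setArr_var, a₁.1 0 (by omega), h0]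
      · rw [setArr_var, a₁.1 x (by omega), hsx]
      · rw [setArr_var, a₁.1 y (by omega), hsy]
      · intro z hz hzx hzy
        rw [setArr_var, a₁.1 z (by omega), hKs.1 z hz hzx hzy]
      · rw [setArr_var, a₁.1 _ (by omega), hKs.2.1]
      · rw [setArr_var, a₁.1 _ (by omega), hKs.2.2]
      · intro c hc
        rw [← hA c hc, ← a₁.2 c (by omega)]
        funext r t
        rw [setArr_arr, if_neg (by omega)]
      · intro r hr u hu h
        simp only [setArr_arr, Expr.eval, v₁, a₁.1 x (show x < b + 3 by omega),
          a₁.1 y (show y < b + 3 by omega), hsx, hsy, a₁.2 b (show b < b + 3 by omega), true_and]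
        split_ifs with hc
        · rw [hc.1, hc.2]
          refine i₀ _ _ ⟨fun z hz => ?_, fun c hc => hA c (by omega)⟩
          simp only [setVar_var]
          split_ifs with hzy hzx
          · rw [hzy, hsy]
          · rw [hzx, hsx]
          · exact hKs.1 z (by omega) hzx hzy
        · exact hB r hr u hu (by omega))
    (by
      rintro i s ⟨h1, h2, h3⟩
      exact ⟨h1, h2, fun r hr t ht h => h3 r hr t ht (by omega)⟩)
    (by
      rintro i j s v ⟨h1, h2, h3⟩
      exact ⟨⟨(hK s v h1).1, h2, h3⟩, ⟨(hK s v h1).2, h2, h3⟩⟩)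
    s₀ (by simp only [s₀]; rw [setVar_var_ne _ (by omega), setVar_var_ne _ (by omega)])
    ⟨⟨fun z hz _ _ => by
        simp only [s₀]; rw [setVar_var_ne _ (by omega), setVar_var_ne _ (by omega)],
      by simp only [s₀]; rw [setVar_var_ne _ (by omega), setVar_var_self],
      by simp only [s₀]; rw [setVar_var_self]⟩, fun c hc => rfl, fun r _ t _ h => by omega⟩
  obtain ⟨s₂, t₂, ex₂, ht₂, h2₀, K₂, A₂, B₂⟩ := exec_for_for (x := x) (y := y) (n := n)
    (T := 6) (P := .put a (.var x) (.var y) (.get b (.var x) (.var y)))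
    (I := fun i j s => K s ∧ (∀ r < n, ∀ t < n, s.arr b r t = g r t) ∧
      ∀ c < b, ∀ r t, s.arr c r t =
        if c = a ∧ (r < n ∧ t < n) ∧ (r < i ∨ r = i ∧ t < j) then g r t else σ.arr c r t) hx hy hxy
    (by
      rintro i hi j hj s h0 hsx hsy ⟨hKs, hA, hB⟩
      refine ⟨_, _, .put _ _ _ _ _, by simp [Expr.cost], h0, hsx, hsy, hKs, ?_, ?_⟩
      · intro r hr t ht
        rw [setArr_arr, if_neg (by omega), hA r hr t ht]
      · intro c hc r t
        simp only [setArr_arr, Expr.eval, hsx, hsy, hA i hi j hj]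
        split_ifs with h1 h2 h2
        · rw [h1.2.1, h1.2.2]
        · omega
        · rw [hB c hc, if_pos (by omega)]
        · rw [hB c hc, if_neg (by omega)])
    (by
      rintro i s ⟨h1, h2, h3⟩
      refine ⟨h1, h2, fun c hc r t => ?_⟩
      rw [h3 c hc]
      congr 1
      refine propext (and_congr_right fun _ => and_congr_right fun _ => ?_)
      omega)
    (by
      rintro i j s v ⟨h1, h2, h3⟩
      exact ⟨⟨(hK s v h1).1, h2, h3⟩, ⟨(hK s v h1).2, h2, h3⟩⟩)
    s₁ h1₀ ⟨K₁, fun r hr t ht => B₁ r hr t ht (by omega), fun c hc r t => by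
      rw [A₁ c hc, if_neg (by omega)]⟩
  have ey : (σ.setVar (b + 1) (σ.var x)).var y = σ.var y := setVar_var_ne _ (by omega)
  refine ⟨_, _, .seq (τ := s₀) (.seq (.assign _ _ _) (by
      have := Exec.assign (b + 2) (.var y) (σ.setVar (b + 1) (σ.var x))
      rw [show (Expr.var y).eval (σ.setVar (b + 1) (σ.var x)) = σ.var y from ey] at this
      exact this))
    (.seq (.seq ex₁ ex₂) (.seq (.assign _ _ _) (.assign _ _ _))), ?_, ?_, ?_⟩
  · simp only [Expr.cost, Polynomial.eval_add, Polynomial.eval_C, Polynomial.eval_mul,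
      Polynomial.eval_X]
    simp only [Nat.add_assoc] at ht₁ ht₂ ⊢
    norm_num at ht₁ ht₂ ⊢
    omega
  · intro z hz
    simp only [Expr.eval, setVar_var _ y, setVar_var _ x, fill_var]
    split_ifs with h1 h2 h2
    · omega
    · rw [h1, K₂.2.2]
    · rw [h2, K₂.2.1]
    · exact K₂.1 z hz h2 h1
  · intro c hc
    funext r t
    simp only [setVar_arr, fill_arr, B₂ c hc]
    congr 1
    refine propext (and_congr_right fun _ => ?_)
    omega

end P5Graphs

/-! ### Prime patterns, substitution and criticality -/

namespace P5Graphs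

open SimpleGraph

variable {V V' : Type*}

/-! ### Patterns on five vertices -/

/-- The path `0 - 1 - 2 - 3 - 4`. -/
def p5 : SimpleGraph (Fin 5) where
  Adj i j := i.val + 1 = j.val ∨ j.val + 1 = i.val
  symm := ⟨fun _ _ h => h.symm⟩
  loopless := ⟨fun i h => by omega⟩

/-- The cycle `0 - 1 - 2 - 3 - 4 - 0`. -/
def c5 : SimpleGraph (Fin 5) where
  Adj i j := j = i + 1 ∨ i = j + 1
  symm := ⟨fun _ _ h => h.symm⟩
  loopless := ⟨fun i h => by revert i; decide⟩

instance : DecidableRel p5.Adj := fun _ _ => inferInstanceAs (Decidable (_ ∨ _))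
instance : DecidableRel c5.Adj := fun _ _ => inferInstanceAs (Decidable (_ ∨ _))

theorem pathGraph_eq_p5 : pathGraph 5 = p5 := by
  ext i j
  rw [pathGraph_adj]
  rfl

/-- No twins, no isolated and no universal vertices, and only trivial modules. -/
def IsPattern (X : SimpleGraph (Fin 5)) : Prop :=
  (∀ i j, (∀ l, X.Adj i l ↔ X.Adj j l) → i = j) ∧
  (∀ i, (∃ j, X.Adj i j) ∧ ∃ j, j ≠ i ∧ ¬ X.Adj i j) ∧
  ∀ S : Fin 5 → Bool, (∀ i j l, S i = true → S j = true → S l = false → (X.Adj l i ↔ X.Adj l j)) →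
    ∀ i j, S i = true → S j = true → i ≠ j → ∀ l, S l = true

theorem isPattern_p5 : IsPattern p5 := by
  unfold IsPattern; decide +kernel

theorem isPattern_p5_compl : IsPattern p5ᶜ := by
  unfold IsPattern
  simp only [compl_adj]
  refine ⟨?_, ?_, ?_⟩ <;> decide +kernel

theorem isPattern_c5 : IsPattern c5 := by
  unfold IsPattern; decide +kernel

/-- Two indices with the same image would be twins in `X`, so `g` is automatically injective. -/
theorem IsPattern.isIndContained {X : SimpleGraph (Fin 5)} (hX : IsPattern X) {G : SimpleGraph V}
    (g : Fin 5 → V) (h : ∀ i j, G.Adj (g i) (g j) ↔ X.Adj i j) : X.IsIndContained G :=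
  ⟨⟨⟨g, fun i j hij => hX.1 i j fun l => by rw [← h, ← h, hij]⟩, fun {i j} => h i j⟩⟩

theorem IsP5CoP5Free.of_embedding {G : SimpleGraph V} {H : SimpleGraph V'} (hG : IsP5CoP5Free G)
    (e : H ↪g G) : IsP5CoP5Free H :=
  ⟨fun h => hG.1 (h.trans ⟨e⟩), fun h => hG.2 (h.trans ⟨e⟩)⟩

theorem IsP5CoP5Free.induce {G : SimpleGraph V} (hG : IsP5CoP5Free G) (s : Set V) :
    IsP5CoP5Free (G.induce s) :=
  hG.of_embedding (Embedding.induce s)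

theorem isP5CoP5Free_iff {G : SimpleGraph V} : IsP5CoP5Free G ↔
    ∀ X : SimpleGraph (Fin 5), X = p5 ∨ X = p5ᶜ → ¬ X.IsIndContained G := by
  simp [IsP5CoP5Free, pathGraph_eq_p5]

theorem IsP5CoP5Free.false_of_path {G : SimpleGraph V} (hG : IsP5CoP5Free G) (a b c d e : V)
    (h : (G.Adj a b ∧ G.Adj b c ∧ G.Adj c d ∧ G.Adj d e) ∧ ¬ G.Adj a c ∧ ¬ G.Adj a d ∧ ¬ G.Adj a e ∧
      ¬ G.Adj b d ∧ ¬ G.Adj b e ∧ ¬ G.Adj c e) : False := by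
  obtain ⟨⟨h1, h2, h3, h4⟩, n1, n2, n3, n4, n5, n6⟩ := h
  refine isP5CoP5Free_iff.1 hG p5 (.inl rfl)
    (isPattern_p5.isIndContained ![a, b, c, d, e] fun i j => ?_)
  fin_cases i <;> fin_cases j <;>
    simp [p5, h1, h2, h3, h4, n1, n2, n3, n4, n5, n6, h1.symm, h2.symm, h3.symm, h4.symm,
      mt G.adj_symm n1, mt G.adj_symm n2, mt G.adj_symm n3, mt G.adj_symm n4, mt G.adj_symm n5,
      mt G.adj_symm n6]

/-- The house with roof `c`: the complement of the path `a - b - c - d - e`. -/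
theorem IsP5CoP5Free.false_of_house {G : SimpleGraph V} (hG : IsP5CoP5Free G) (a b c d e : V)
    (h : (¬ G.Adj a b ∧ ¬ G.Adj b c ∧ ¬ G.Adj c d ∧ ¬ G.Adj d e) ∧ G.Adj a c ∧ G.Adj a d ∧
      G.Adj a e ∧ G.Adj b d ∧ G.Adj b e ∧ G.Adj c e) : False := by
  obtain ⟨⟨h1, h2, h3, h4⟩, n1, n2, n3, n4, n5, n6⟩ := h
  refine isP5CoP5Free_iff.1 hG p5ᶜ (.inr rfl)
    (isPattern_p5_compl.isIndContained ![a, b, c, d, e] fun i j => ?_)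
  fin_cases i <;> fin_cases j <;>
    simp [p5, h1, h2, h3, h4, n1, n2, n3, n4, n5, n6, n1.symm, n2.symm, n3.symm, n4.symm, n5.symm,
      n6.symm, mt G.adj_symm h1, mt G.adj_symm h2, mt G.adj_symm h3, mt G.adj_symm h4]

/-- If `H` arises from an induced subgraph of `G` by substituting `H[N]` for the vertex `m`, then
every copy of a pattern in `H` lies in `N` or yields a copy in `G`. -/
theorem IsPattern.of_substitution {X : SimpleGraph (Fin 5)} (hX : IsPattern X) {G : SimpleGraph V}
    {H : SimpleGraph V'} (N : Set V') (φ : V' → V) (m : V) (hm : ∀ y ∈ N, φ y = m)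
    (h : ∀ x y, x ≠ y → ¬ (x ∈ N ∧ y ∈ N) → (H.Adj x y ↔ G.Adj (φ x) (φ y)))
    (hind : X.IsIndContained H) : X.IsIndContained (H.induce N) ∨ X.IsIndContained G := by
  classical
  obtain ⟨g⟩ := hind
  by_cases hS : ∃ i j, i ≠ j ∧ g i ∈ N ∧ g j ∈ N
  · left
    obtain ⟨i, j, hij, hi, hj⟩ := hS
    -- The indices mapped into `N` form a module of `X` with at least two elements; as `X` is prime,
    -- it contains every index.
    have := hX.2.2 (fun i => decide (g i ∈ N)) (fun i j l hi hj hl => by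
      simp only [decide_eq_true_eq, decide_eq_false_iff_not] at hi hj hl
      rw [← g.map_adj_iff, ← g.map_adj_iff, h _ _ (by rintro e; exact hl (e ▸ hi)) (by tauto),
        h _ _ (by rintro e; exact hl (e ▸ hj)) (by tauto), hm _ hi, hm _ hj])
      i j (by simpa) (by simpa) hij
    simp only [decide_eq_true_eq] at this
    exact hX.isIndContained (fun i => ⟨g i, this i⟩) fun i j => by simp
  · right
    push Not at hS
    refine hX.isIndContained (fun i => φ (g i)) fun i j => ?_
    by_cases hij : i = j
    · simp [hij]
    rw [← h _ _ (g.injective.ne hij) fun hN => hS i j hij hN.1 hN.2, g.map_adj_iff]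

theorem IsP5CoP5Free.of_substitution {G : SimpleGraph V} (hG : IsP5CoP5Free G)
    {H : SimpleGraph V'} (N : Set V') (φ : V' → V) (m : V) (hm : ∀ y ∈ N, φ y = m)
    (h : ∀ x y, x ≠ y → ¬ (x ∈ N ∧ y ∈ N) → (H.Adj x y ↔ G.Adj (φ x) (φ y)))
    (hN : IsP5CoP5Free (H.induce N)) : IsP5CoP5Free H := by
  rw [isP5CoP5Free_iff] at hG hN ⊢
  intro X hX hind
  have : IsPattern X := by rcases hX with rfl | rfl; exacts [isPattern_p5, isPattern_p5_compl]
  rcases this.of_substitution N φ m hm h hind with h | h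
  exacts [hN X hX h, hG X hX h]

/-! ### Coloring and criticality -/

theorem colorable_of_embedding {G : SimpleGraph V} {H : SimpleGraph V'} {n : ℕ} (h : G.Colorable n)
    (e : H ↪g G) : H.Colorable n := h.of_hom e.toHom

theorem colorable_induce_mono {G : SimpleGraph V} {s t : Set V} (hst : s ⊆ t) {n : ℕ}
    (h : (G.induce t).Colorable n) : (G.induce s).Colorable n :=
  colorable_of_embedding h (induceHomOfLE _ hst)

theorem colorable_succ_of_delete {G : SimpleGraph V} {n : ℕ} (v : V)
    (h : (G.induce {v}ᶜ).Colorable n) : G.Colorable (n + 1) := by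
  classical
  obtain ⟨c⟩ := h
  refine ⟨Coloring.mk (fun x => if hx : x = v then Fin.last n else (c ⟨x, hx⟩).castSucc) ?_⟩
  intro x y hxy
  by_cases hx : x = v <;> by_cases hy : y = v
  · subst hx; subst hy; exact absurd hxy (G.loopless.irrefl _)
  · simp [hx, hy, Fin.ext_iff]; omega
  · simp [hx, hy, Fin.ext_iff]; omega
  · simp only [hx, hy, dite_false, ne_eq, Fin.castSucc_inj]
    exact c.valid (v := ⟨x, hx⟩) (w := ⟨y, hy⟩) hxy

/-- Colorability is inherited by subgraphs, so single-vertex deletions are the only ones that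
matter. Putting a deleted vertex back costs at most one color, which gives the upper bound `n + 1`.
-/
theorem isCritical_succ_iff {G : SimpleGraph V} {n : ℕ} : IsCritical (n + 1) G ↔
    ¬ G.Colorable n ∧ ∀ v, (G.induce {v}ᶜ).Colorable n := by
  have key : ∀ {W : Type _} (H : SimpleGraph W), H.chromaticNumber = ((n + 1 : ℕ) : ℕ∞) ↔
      H.Colorable (n + 1) ∧ ¬ H.Colorable n := fun H => by
    rw [← chromaticNumber_le_iff_colorable, ← chromaticNumber_le_iff_colorable]
    constructor
    · intro h
      rw [h]
      exact ⟨le_rfl, by norm_cast; omega⟩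
    · rintro ⟨h1, h2⟩
      refine le_antisymm h1 ?_
      rw [not_le] at h2
      exact_mod_cast Order.add_one_le_of_lt h2
  constructor
  · rintro ⟨h1, h2⟩
    rw [key] at h1
    refine ⟨h1.2, fun v => ?_⟩
    have := h2 {v}ᶜ (fun h => by simpa using Set.ext_iff.1 h v)
    rw [ne_eq, key] at this
    by_contra hc
    exact this ⟨colorable_of_embedding h1.1 (Embedding.induce _), hc⟩
  · rintro ⟨h1, h2⟩
    refine ⟨(key G).2 ⟨?_, h1⟩, fun s hs => ?_⟩
    · by_cases hV : Nonempty V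
      · exact colorable_succ_of_delete hV.some (h2 _)
      · have := not_nonempty_iff.1 hV
        exact absurd (.of_isEmpty n) h1
    · obtain ⟨v, hv⟩ := (Set.ne_univ_iff_exists_notMem s).1 hs
      rw [ne_eq, key]
      rintro ⟨-, h⟩
      exact h (colorable_induce_mono (fun x hx => by rintro rfl; exact hv hx) (h2 v))

/-- Replacing a homogeneous set `M` of `G` by a set `N` that needs no more colors. -/
theorem colorable_swap {G : SimpleGraph V} {H : SimpleGraph V'} {k : ℕ} (hG : G.Colorable k)
    (M : Set V) (N : Set V') (φ : V' → V)
    (h1 : ∀ x ∉ N, ∀ y ∉ N, H.Adj x y → G.Adj (φ x) (φ y))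
    (h2 : ∀ x ∉ N, ∀ y ∈ N, H.Adj x y → ∀ m ∈ M, G.Adj (φ x) m)
    (h3 : ∀ r, (G.induce M).Colorable r → (H.induce N).Colorable r) : H.Colorable k := by
  classical
  obtain ⟨c⟩ := hG
  -- The colors that occur on `M` suffice to recolor `N`. Vertices outside `N` with a neighbor in
  -- `N` avoid these colors because they correspond to vertices complete to `M`.
  let T : Finset (Fin k) := Finset.univ.filter fun i => ∃ m ∈ M, c m = i
  have hM : (G.induce M).Coloring T := Coloring.mk
    (fun m => ⟨c m, by simp only [T, Finset.mem_filter, Finset.mem_univ, true_and]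
                       exact ⟨m, m.2, rfl⟩⟩)
    fun {u v} h => by
      simp only [ne_eq, Subtype.mk.injEq]
      exact c.valid (v := u) (w := v) h
  obtain ⟨d⟩ := h3 _ hM.colorable
  let e : Fin (Fintype.card T) ≃ T := (Fintype.equivFin T).symm
  refine ⟨Coloring.mk (fun x => if hx : x ∈ N then (e (d ⟨x, hx⟩) : Fin k) else c (φ x)) ?_⟩
  have hT : ∀ x ∉ N, ∀ y ∈ N, H.Adj x y → ∀ i : T, c (φ x) ≠ i := by
    intro x hx y hy hxy i hi
    obtain ⟨m, hm, hmi⟩ := (Finset.mem_filter.1 i.2).2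
    exact c.valid (h2 x hx y hy hxy m hm) (hi.trans hmi.symm)
  intro x y hxy
  by_cases hx : x ∈ N <;> by_cases hy : y ∈ N <;> simp only [hx, hy, dite_true, dite_false]
  · intro h
    exact d.valid (v := ⟨x, hx⟩) (w := ⟨y, hy⟩) hxy (e.injective (Subtype.ext h))
  · exact fun h => hT y hy x hx hxy.symm _ h.symm
  · exact hT x hx y hy hxy _
  · exact c.valid (h1 x hx y hy hxy)

theorem induce_induce_iso (G : SimpleGraph V) (s : Set V) (t : Set s) :
    Nonempty ((G.induce s).induce t ≃g G.induce (Subtype.val '' t)) :=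
  ⟨⟨Equiv.ofBijective (fun x => ⟨x.1.1, x.1, x.2, rfl⟩)
    ⟨fun _ _ h => Subtype.ext (Subtype.ext (congrArg Subtype.val h :)),
      fun ⟨_, x, hx, hv⟩ => ⟨⟨x, hx⟩, Subtype.ext hv⟩⟩, fun {_ _} => Iff.rfl⟩⟩

theorem exists_isCritical [Finite V] {G : SimpleGraph V} {n : ℕ} (h : ¬ G.Colorable n) :
    ∃ s : Set V, IsCritical (n + 1) (G.induce s) := by
  obtain ⟨s, hs, hmin⟩ := Set.Finite.exists_minimal (Set.toFinite {s : Set V | ¬ (G.induce s).Colorable n})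
    ⟨Set.univ, fun h' => h (colorable_of_embedding h' (induceUnivIso G).symm.toEmbedding)⟩
  refine ⟨s, isCritical_succ_iff.2 ⟨hs, fun v => ?_⟩⟩
  by_contra hc
  obtain ⟨e⟩ := induce_induce_iso G s {v}ᶜ
  have := hmin (y := Subtype.val '' ({v}ᶜ : Set s))
    (fun h' => hc (colorable_of_embedding h' e.toEmbedding)) (by rintro _ ⟨x, -, rfl⟩; exact x.2) v.2
  obtain ⟨x, hx, hxv⟩ := this
  exact hx (Subtype.ext hxv)

theorem IsCritical.of_iso {G : SimpleGraph V} {H : SimpleGraph V'} {k : ℕ} (hG : IsCritical k G)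
    (e : G ≃g H) : IsCritical k H := by
  refine ⟨(chromaticNumber_congr e).symm.trans hG.1, fun s hs => ?_⟩
  have e' : G.induce (e ⁻¹' s) ≃g H.induce s :=
    ⟨⟨fun x => ⟨e x.1, x.2⟩, fun y => ⟨e.symm y.1, by simp⟩, fun x => by simp,
      fun y => by simp⟩, fun {a b} => e.map_adj_iff (v := a.1) (w := b.1)⟩
  rw [← chromaticNumber_congr e']
  refine hG.2 _ fun h => hs ?_
  ext y
  simpa using Set.ext_iff.1 h (e.symm y)

theorem IsMember.of_iso {G : SimpleGraph V} {H : SimpleGraph V'} {k : ℕ} (hG : IsMember k G)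
    (e : G ≃g H) : IsMember k H :=
  ⟨hG.1.of_iso e, hG.2.of_embedding e.symm.toEmbedding⟩

theorem not_colorable_top {n q : ℕ} (h : (⊤ : SimpleGraph (Fin q)).Colorable n) : q ≤ n := by
  obtain ⟨c⟩ := h
  have : Function.Injective c := fun i j hij => by
    by_contra hne
    exact c.valid (v := i) (w := j) (by simpa using hne) hij
  simpa using Fintype.card_le_of_injective _ this

end P5Graphs

/-! ### The surroundings of a five-cycle, and perfection without five-cycles -/

namespace P5Graphs

open SimpleGraph

variable {V : Type*} {G : SimpleGraph V}

/-! ### Induced five-cycles -/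

/-- The map `c` is an induced five-cycle of `G`. -/
def IsC5 (G : SimpleGraph V) (c : Fin 5 → V) : Prop := ∀ i j, G.Adj (c i) (c j) ↔ c5.Adj i j

/-- The vertices that are adjacent to the neighbors of `c i` on the cycle, and to no other vertex
of the cycle except possibly `c i`. -/
def part (G : SimpleGraph V) (c : Fin 5 → V) (i : Fin 5) : Set V :=
  {v | G.Adj v (c (i + 1)) ∧ G.Adj v (c (i + 4)) ∧ ¬ G.Adj v (c (i + 2)) ∧ ¬ G.Adj v (c (i + 3))}

/-- The union of the parts. -/
def hull (G : SimpleGraph V) (c : Fin 5 → V) : Set V := {v | ∃ i, v ∈ part G c i}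

theorem part_subset_hull (c : Fin 5 → V) (i : Fin 5) : part G c i ⊆ hull G c := fun _ h => ⟨i, h⟩

/-- The possible adjacencies of a vertex to a five-cycle. -/
def Allowed (b : Fin 5 → Bool) : Prop :=
  (∀ i, b i = true) ∨ (∀ i, b i = false) ∨
    ∃ i, b (i + 1) = true ∧ b (i + 4) = true ∧ b (i + 2) = false ∧ b (i + 3) = false

instance : DecidablePred Allowed := fun _ => inferInstanceAs (Decidable (_ ∨ _))

/-- The first hypothesis excludes the path that enters the cycle at `i` and goes on to `i + 4`, `i +
3`, `i + 2`. The second excludes the house formed by the vertex and the four cycle vertices `i` to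
`i + 3`. -/
theorem allowed_of_no_path_no_house : ∀ b : Fin 5 → Bool,
    (∀ i, ¬ (b i = true ∧ b (i + 2) = false ∧ b (i + 3) = false ∧ b (i + 4) = false)) →
    (∀ i, ¬ (b i = true ∧ b (i + 1) = true ∧ b (i + 3) = true ∧ b (i + 2) = false)) →
    Allowed b := by decide +kernel

/-- Used for the cycle in which the vertex `i` is exchanged for a vertex of its part: only the bit
at `i` can change, and the new bits must again be allowed. -/
theorem allowed_update : ∀ (b : Fin 5 → Bool) (j i : Fin 5) (x : Bool),
    b (j + 1) = true ∧ b (j + 4) = true ∧ b (j + 2) = false ∧ b (j + 3) = false → j ≠ i →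
    Allowed (fun l => if l = i then x else b l) → (x = true ↔ c5.Adj j i) := by decide +kernel

theorem allowed_update_outside : ∀ (b : Fin 5 → Bool) (i : Fin 5) (x : Bool), Allowed b →
    (∀ j, ¬ (b (j + 1) = true ∧ b (j + 4) = true ∧ b (j + 2) = false ∧ b (j + 3) = false)) →
    Allowed (fun l => if l = i then x else b l) → x = b 0 := by decide +kernel

theorem part_index_unique : ∀ (b : Fin 5 → Bool) (i j : Fin 5),
    b (i + 1) = true ∧ b (i + 4) = true ∧ b (i + 2) = false ∧ b (i + 3) = false →
    b (j + 1) = true ∧ b (j + 4) = true ∧ b (j + 2) = false ∧ b (j + 3) = false → i = j := by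
  decide +kernel

open Classical in
/-- The adjacencies of `v` to the cycle `c`. -/
noncomputable def bits (G : SimpleGraph V) (c : Fin 5 → V) (v : V) (i : Fin 5) : Bool :=
  decide (G.Adj v (c i))

theorem mem_part_iff {c : Fin 5 → V} {i : Fin 5} {v : V} : v ∈ part G c i ↔
    bits G c v (i + 1) = true ∧ bits G c v (i + 4) = true ∧ bits G c v (i + 2) = false ∧
      bits G c v (i + 3) = false := by
  simp [bits, part]

theorem IsC5.allowed (hG : IsP5CoP5Free G) {c : Fin 5 → V} (hc : IsC5 G c) (v : V) :
    Allowed (bits G c v) := by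
  have h1 : ∀ i : Fin 5, c5.Adj i (i + 4) ∧ c5.Adj (i + 4) (i + 3) ∧ c5.Adj (i + 3) (i + 2) ∧
    ¬ c5.Adj i (i + 3) ∧ ¬ c5.Adj i (i + 2) ∧ ¬ c5.Adj (i + 4) (i + 2) := by decide
  have h2 : ∀ i : Fin 5, ¬ c5.Adj (i + 2) i ∧ ¬ c5.Adj i (i + 3) ∧ ¬ c5.Adj (i + 3) (i + 1) ∧
    c5.Adj (i + 2) (i + 3) ∧ c5.Adj (i + 2) (i + 1) ∧ c5.Adj i (i + 1) := by decide
  apply allowed_of_no_path_no_house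
  · intro i
    simp only [bits, decide_eq_true_eq, decide_eq_false_iff_not]
    rintro ⟨a1, a2, a3, a4⟩
    obtain ⟨b1, b2, b3, b4, b5, b6⟩ := h1 i
    rw [← hc] at b1 b2 b3 b4 b5 b6
    exact hG.false_of_path v (c i) (c (i + 4)) (c (i + 3)) (c (i + 2)) ⟨⟨a1, b1, b2, b3⟩,
      a4, a3, a2, b4, b5, b6⟩
  · intro i
    simp only [bits, decide_eq_true_eq, decide_eq_false_iff_not]
    rintro ⟨a1, a2, a3, a4⟩
    obtain ⟨b1, b2, b3, b4, b5, b6⟩ := h2 i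
    rw [← hc] at b1 b2 b3 b4 b5 b6
    exact hG.false_of_house v (c (i + 2)) (c i) (c (i + 3)) (c (i + 1)) ⟨⟨a4, b1, b2, b3⟩,
      a1, a3, a2, b4, b5, b6⟩

theorem fin5_cases : ∀ i l : Fin 5, l = i ∨ l = i + 1 ∨ l = i + 2 ∨ l = i + 3 ∨ l = i + 4 := by
  decide

theorem adj_of_mem_part {c : Fin 5 → V} {i l : Fin 5} {u : V} (hu : u ∈ part G c i) (h : i ≠ l) :
    G.Adj u (c l) ↔ c5.Adj i l := by
  have h1 : ∀ i : Fin 5, c5.Adj i (i + 1) ∧ ¬ c5.Adj i (i + 2) ∧ ¬ c5.Adj i (i + 3) ∧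
    c5.Adj i (i + 4) := by decide
  obtain ⟨b1, b2, b3, b4⟩ := h1 i
  obtain ⟨a1, a4, a2, a3⟩ := hu
  rcases fin5_cases i l with rfl | rfl | rfl | rfl | rfl <;> simp_all

theorem IsC5.mem_part {c : Fin 5 → V} (hc : IsC5 G c) (i : Fin 5) : c i ∈ part G c i := by
  have h1 : ∀ i : Fin 5, c5.Adj i (i + 1) ∧ c5.Adj i (i + 4) ∧ ¬ c5.Adj i (i + 2) ∧
    ¬ c5.Adj i (i + 3) := by decide
  simpa only [part, Set.mem_ofPred_eq, hc _ _] using h1 i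

theorem IsC5.update {c : Fin 5 → V} (hc : IsC5 G c) {i : Fin 5} {u : V} (hu : u ∈ part G c i) :
    IsC5 G (fun l => if l = i then u else c l) := by
  intro j l
  by_cases hj : j = i <;> by_cases hl : l = i
  · subst hj; subst hl; simp
  · subst hj
    simp only [if_true, hl, if_false]
    exact adj_of_mem_part hu fun h => hl h.symm
  · subst hl
    simp only [if_true, hj, if_false]
    rw [G.adj_comm, c5.adj_comm]
    exact adj_of_mem_part hu fun h => hj h.symm
  · simp [hj, hl, hc j l]

theorem bits_update (c : Fin 5 → V) (i : Fin 5) (u v : V) : bits G (fun l => if l = i then u else c l) v =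
    fun l => if l = i then bits G (fun _ => u) v i else bits G c v l := by
  funext l
  by_cases h : l = i <;> simp [bits, h]

/-- Replacing `c i` by `u` gives another induced five-cycle. The adjacencies of `v` to it must be
allowed, which leaves only one option for the pair `u`, `v`. -/
theorem IsC5.adj_parts (hG : IsP5CoP5Free G) {c : Fin 5 → V} (hc : IsC5 G c) {i j : Fin 5}
    {u v : V} (hu : u ∈ part G c i) (hv : v ∈ part G c j) (hij : i ≠ j) :
    G.Adj u v ↔ c5.Adj i j := by
  have := (hc.update hu).allowed hG v
  rw [bits_update] at this
  have := allowed_update (bits G c v) j i _ (mem_part_iff.1 hv) hij.symm this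
  rw [c5.adj_comm, ← this, G.adj_comm]
  simp [bits]

/-- Outside the hull, `v` sees all or none of the cycle. After `u` is exchanged into the cycle, no
single deviating bit is allowed. -/
theorem IsC5.adj_outside (hG : IsP5CoP5Free G) {c : Fin 5 → V} (hc : IsC5 G c) {u v : V}
    (hv : v ∉ hull G c) (hu : u ∈ hull G c) : G.Adj v u ↔ G.Adj v (c 0) := by
  obtain ⟨i, hi⟩ := hu
  have := (hc.update hi).allowed hG v
  rw [bits_update] at this
  have := allowed_update_outside _ i _ (hc.allowed hG v)
    (fun j hj => hv ⟨j, mem_part_iff.2 hj⟩) this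
  simpa [bits] using this

theorem part_disjoint {c : Fin 5 → V} {i j : Fin 5} {v : V} (hi : v ∈ part G c i)
    (hj : v ∈ part G c j) : i = j :=
  part_index_unique _ i j (mem_part_iff.1 hi) (mem_part_iff.1 hj)

theorem IsC5.part_module (hG : IsP5CoP5Free G) {c : Fin 5 → V} (hc : IsC5 G c) {i : Fin 5}
    {u u' v : V} (hu : u ∈ part G c i) (hu' : u' ∈ part G c i) (hv : v ∉ part G c i) :
    G.Adj v u ↔ G.Adj v u' := by
  by_cases h : v ∈ hull G c
  · obtain ⟨j, hj⟩ := h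
    have hij : j ≠ i := by rintro rfl; exact hv hj
    rw [hc.adj_parts hG hj hu hij, hc.adj_parts hG hj hu' hij]
  · rw [hc.adj_outside hG h ⟨i, hu⟩, hc.adj_outside hG h ⟨i, hu'⟩]

theorem IsC5.of_mem_parts (hG : IsP5CoP5Free G) {c d : Fin 5 → V} (hc : IsC5 G c)
    (hd : ∀ i, d i ∈ part G c i) : IsC5 G d := by
  intro i j
  by_cases hij : i = j
  · subst hij; simp
  · exact hc.adj_parts hG (hd i) (hd j) hij

theorem IsC5.part_eq_of_mem_parts (hG : IsP5CoP5Free G) {c d : Fin 5 → V} (hc : IsC5 G c)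
    (hd : ∀ i, d i ∈ part G c i) (i : Fin 5) : part G d i = part G c i := by
  -- One inclusion is enough: it shows that the vertices of `c` lie in the parts of `d`, so the
  -- cycles can be interchanged.
  have key : ∀ {c d : Fin 5 → V}, IsC5 G c → (∀ i, d i ∈ part G c i) →
      ∀ i, part G c i ⊆ part G d i := by
    intro c d hc hd i v hv
    have h1 : ∀ i : Fin 5, c5.Adj i (i + 1) ∧ c5.Adj i (i + 4) ∧ ¬ c5.Adj i (i + 2) ∧
      ¬ c5.Adj i (i + 3) ∧ i ≠ i + 1 ∧ i ≠ i + 4 ∧ i ≠ i + 2 ∧ i ≠ i + 3 := by decide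
    obtain ⟨a1, a2, a3, a4, b1, b2, b3, b4⟩ := h1 i
    exact ⟨(hc.adj_parts hG hv (hd _) b1).2 a1, (hc.adj_parts hG hv (hd _) b2).2 a2,
      fun h => a3 ((hc.adj_parts hG hv (hd _) b3).1 h),
      fun h => a4 ((hc.adj_parts hG hv (hd _) b4).1 h)⟩
  exact (key (hc.of_mem_parts hG hd) (fun j => key hc hd j (hc.mem_part j)) i).antisymm (key hc hd i)

/-! ### Perfection in the absence of five-cycles -/

/-- The set `W` contains no induced five-cycle of `G`. -/
def NoC5 (G : SimpleGraph V) (W : Set V) : Prop := ∀ c, IsC5 G c → ∃ i, c i ∉ W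

/-- All cliques of `G` within `W` have at most `n` vertices. -/
def CliquesLE (G : SimpleGraph V) (W : Set V) (n : ℕ) : Prop :=
  ∀ Q : Finset V, ↑Q ⊆ W → G.IsClique (Q : Set V) → Q.card ≤ n

theorem NoC5.mono {W W' : Set V} (h : NoC5 G W) (hs : W' ⊆ W) : NoC5 G W' := fun c hc =>
  (h c hc).imp fun _ hi hW => hi (hs hW)

theorem colorable_succ_of_stable {W S : Set V} {n : ℕ} (hS : ∀ u ∈ S, ∀ v ∈ S, ¬ G.Adj u v)
    (h : (G.induce (W \ S)).Colorable n) : (G.induce W).Colorable (n + 1) := by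
  classical
  obtain ⟨c⟩ := h
  refine ⟨Coloring.mk (fun x => if hx : x.1 ∈ S then Fin.last n else
    (c ⟨x.1, x.2, hx⟩).castSucc) ?_⟩
  intro x y hxy
  by_cases hx : x.1 ∈ S <;> by_cases hy : y.1 ∈ S
  · exact absurd hxy (hS _ hx _ hy)
  · simp only [hx, hy, dite_true, dite_false]
    exact (Fin.castSucc_ne_last _).symm
  · simp only [hx, hy, dite_true, dite_false]
    exact Fin.castSucc_ne_last _
  · simp only [hx, hy, dite_false, ne_eq, Fin.castSucc_inj]
    exact c.valid (v := ⟨x.1, x.2, hx⟩) (w := ⟨y.1, y.2, hy⟩) hxy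

/-- The other three possibilities for the adjacency of `e` to `c` and `d` yield a house, an induced
five-cycle in `W`, or an induced path on five vertices. -/
theorem NoC5.adj_of_path (hG : IsP5CoP5Free G) {W : Set V} (hW : NoC5 G W) {a b c d e : V}
    (ha : a ∈ W) (hb : b ∈ W) (hc : c ∈ W) (hd : d ∈ W) (he : e ∈ W) (hab : G.Adj a b)
    (hbc : G.Adj b c) (hcd : G.Adj c d) (hac : ¬ G.Adj a c) (hbd : ¬ G.Adj b d) (had : ¬ G.Adj a d)
    (hae : G.Adj a e) (hbe : ¬ G.Adj b e) : G.Adj c e ∧ ¬ G.Adj d e := by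
  by_cases hce : G.Adj c e <;> by_cases hde : G.Adj d e
  · exact (hG.false_of_house c a d b e ⟨⟨fun h => hac h.symm, had, fun h => hbd h.symm, hbe⟩,
      hcd, hbc.symm, hce, hab, hae, hde⟩).elim
  · exact ⟨hce, hde⟩
  · exfalso
    obtain ⟨i, hi⟩ := hW ![a, b, c, d, e] (fun i j => by
      fin_cases i <;> fin_cases j <;>
        simp [c5, hab, hbc, hcd, hac, hbd, had, hae, hbe, hce, hde, hab.symm, hbc.symm, hcd.symm,
          hae.symm, hde.symm, mt G.adj_symm hac, mt G.adj_symm hbd, mt G.adj_symm had,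
          mt G.adj_symm hbe, mt G.adj_symm hce])
    fin_cases i <;> simp_all
  · exact (hG.false_of_path e a b c d ⟨⟨hae.symm, hab, hbc, hcd⟩, fun h => hbe h.symm,
      fun h => hce h.symm, fun h => hde h.symm, hac, had, hbd⟩).elim

variable [Fintype V]

open Classical in
/-- The number of neighbors of `v` in `W`. -/
noncomputable def degIn (G : SimpleGraph V) (W : Set V) (v : V) : ℕ :=
  (Finset.univ.filter fun u => u ∈ W ∧ G.Adj v u).card

open Classical in
theorem card_sdiff_le_of_degIn_le {W : Set V} {a b : V} (h : degIn G W b ≤ degIn G W a) :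
    (Finset.univ.filter fun u => u ∈ W ∧ G.Adj b u ∧ ¬ G.Adj a u).card ≤
      (Finset.univ.filter fun u => u ∈ W ∧ G.Adj a u ∧ ¬ G.Adj b u).card := by
  unfold degIn at h
  rw [← Finset.card_filter_add_card_filter_not (s := Finset.univ.filter fun u => u ∈ W ∧ G.Adj b u)
      (fun u => G.Adj a u), ← Finset.card_filter_add_card_filter_not
      (s := Finset.univ.filter fun u => u ∈ W ∧ G.Adj a u) (fun u => G.Adj b u)] at h
  simp only [Finset.filter_filter, and_assoc] at h
  have e : (Finset.univ.filter fun u => u ∈ W ∧ G.Adj b u ∧ G.Adj a u) =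
      Finset.univ.filter fun u => u ∈ W ∧ G.Adj a u ∧ G.Adj b u := by
    ext u; simp; tauto
  rw [e] at h
  omega

/-- By `NoC5.adj_of_path`, $N(a)\setminus N(b)\subsetneq N(c)\setminus N(d)$ within `W`, where `d`
shows strictness; symmetrically $N(d)\setminus N(c)\subsetneq N(b)\setminus N(a)$. The degree
conditions close this to a cycle of inequalities between cardinalities, two of them strict. -/
theorem NoC5.no_obstruction (hG : IsP5CoP5Free G) {W : Set V} (hW : NoC5 G W) {a b c d : V}
    (ha : a ∈ W) (hb : b ∈ W) (hc : c ∈ W) (hd : d ∈ W) (hab : G.Adj a b)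
    (hbc : G.Adj b c) (hcd : G.Adj c d) (hac : ¬ G.Adj a c) (hbd : ¬ G.Adj b d) (had : ¬ G.Adj a d)
    (h1 : degIn G W b ≤ degIn G W a) (h2 : degIn G W c ≤ degIn G W d) : False := by
  classical
  have c1 := card_sdiff_le_of_degIn_le h1
  have c2 := card_sdiff_le_of_degIn_le h2
  have l1 : (Finset.univ.filter fun u => u ∈ W ∧ G.Adj a u ∧ ¬ G.Adj b u).card <
      (Finset.univ.filter fun u => u ∈ W ∧ G.Adj c u ∧ ¬ G.Adj d u).card := by
    refine Finset.card_lt_card (Finset.ssubset_iff_of_subset ?_ |>.2 ⟨d, ?_, ?_⟩)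
    · intro e he
      simp only [Finset.mem_filter, Finset.mem_univ, true_and] at he ⊢
      exact ⟨he.1, hW.adj_of_path hG ha hb hc hd he.1 hab hbc hcd hac hbd had he.2.1 he.2.2⟩
    · simp [hd, hcd]
    · simp [had]
  have l2 : (Finset.univ.filter fun u => u ∈ W ∧ G.Adj d u ∧ ¬ G.Adj c u).card <
      (Finset.univ.filter fun u => u ∈ W ∧ G.Adj b u ∧ ¬ G.Adj a u).card := by
    refine Finset.card_lt_card (Finset.ssubset_iff_of_subset ?_ |>.2 ⟨a, ?_, ?_⟩)
    · intro e he
      simp only [Finset.mem_filter, Finset.mem_univ, true_and] at he ⊢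
      exact ⟨he.1, hW.adj_of_path hG hd hc hb ha he.1 hcd.symm hbc.symm hab.symm
        (fun h => hbd h.symm) (fun h => hac h.symm) (fun h => had h.symm) he.2.1 he.2.2⟩
    · simp [ha, hab.symm]
    · simp [mt G.adj_symm had]
  omega

variable [LinearOrder V]

/-- The vertices are ordered by decreasing degree. -/
def Prec (G : SimpleGraph V) (W : Set V) (u v : V) : Prop :=
  degIn G W v < degIn G W u ∨ degIn G W u = degIn G W v ∧ u < v

theorem Prec.le {W : Set V} {u v : V} (h : Prec G W u v) : degIn G W v ≤ degIn G W u := by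
  rcases h with h | h <;> omega

theorem Prec.trans {W : Set V} {u v w : V} (h : Prec G W u v) (h' : Prec G W v w) :
    Prec G W u w := by
  rcases h with h | h <;> rcases h' with h' | h'
  · exact .inl (by omega)
  · exact .inl (by omega)
  · exact .inl (by omega)
  · exact .inr ⟨by omega, h.2.trans h'.2⟩

theorem Prec.irrefl {W : Set V} {u : V} (h : Prec G W u u) : False := by
  rcases h with h | h
  · omega
  · exact lt_irrefl _ h.2

theorem prec_total {W : Set V} {u v : V} (h : u ≠ v) : Prec G W u v ∨ Prec G W v u := by
  unfold Prec
  rcases lt_trichotomy (degIn G W u) (degIn G W v) with h1 | h1 | h1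
  · exact .inr (.inl h1)
  · rcases lt_or_gt_of_ne h with h2 | h2
    · exact .inl (.inr ⟨h1, h2⟩)
    · exact .inr (.inr ⟨h1.symm, h2⟩)
  · exact .inl (.inl h1)

/-- One step of the iteration that computes the kernel. -/
def kernelStep (G : SimpleGraph V) (W S : Set V) : Set V :=
  {v | v ∈ W ∧ ∀ u ∈ S, G.Adj u v → ¬ Prec G W u v}

/-- The greedy stable set of `W`. -/
def IsKernel (G : SimpleGraph V) (W S : Set V) : Prop := kernelStep G W S = S

/-- After `t` rounds the status of every vertex with fewer than `t` predecessors is final. The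
initial set is arbitrary, so a program may start from whatever its array contains. -/
theorem isKernel_iterate (W S : Set V) :
    IsKernel G W ((kernelStep G W)^[Fintype.card V] S) := by
  classical
  let rank : V → ℕ := fun v => (Finset.univ.filter fun u => Prec G W u v).card
  have hrank : ∀ u v, Prec G W u v → rank u < rank v := fun u v h =>
    Finset.card_lt_card (Finset.ssubset_iff_of_subset (fun w hw => by
      simp only [Finset.mem_filter, Finset.mem_univ, true_and] at hw ⊢
      exact hw.trans h) |>.2 ⟨u, by simp [h], by simpa using fun h' => Prec.irrefl h'⟩)
  have key : ∀ t, ∀ v, rank v < t →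
      (v ∈ (kernelStep G W)^[t + 1] S ↔ v ∈ (kernelStep G W)^[t] S) := by
    intro t
    induction t with
    | zero => intro v hv; omega
    | succ t ih =>
      intro v hv
      rw [Function.iterate_succ_apply', Function.iterate_succ_apply' (n := t)]
      refine and_congr_right fun _ => forall_congr' fun u => ?_
      by_cases hu : Prec G W u v
      · have := ih u (by have := hrank u v hu; omega)
        rw [Function.iterate_succ_apply'] at this
        rw [this]
      · simp [hu]
  ext v
  rw [← Function.iterate_succ_apply' (kernelStep G W)]
  refine key _ v ?_
  refine (Finset.card_lt_card (Finset.ssubset_univ_iff.2 fun h => ?_)).trans_le Finset.card_univ.le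
  have := Finset.mem_univ v
  rw [← h] at this
  exact Prec.irrefl (Finset.mem_filter.1 this).2

theorem IsKernel.mem_iff {W S : Set V} (h : IsKernel G W S) {v : V} :
    v ∈ S ↔ v ∈ W ∧ ∀ u ∈ S, G.Adj u v → ¬ Prec G W u v := by
  conv_lhs => rw [← h]
  rfl

theorem IsKernel.subset {W S : Set V} (h : IsKernel G W S) : S ⊆ W := fun _ hv => (h.mem_iff.1 hv).1

theorem IsKernel.stable {W S : Set V} (h : IsKernel G W S) {u v : V} (hu : u ∈ S) (hv : v ∈ S) :
    ¬ G.Adj u v := fun huv => by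
  rcases prec_total (G := G) (W := W) huv.ne with h1 | h1
  · exact (h.mem_iff.1 hv).2 u hu huv h1
  · exact (h.mem_iff.1 hu).2 v hv huv.symm h1

theorem IsKernel.exists_adj {W S : Set V} (h : IsKernel G W S) {v : V} (hv : v ∈ W) (hS : v ∉ S) :
    ∃ u ∈ S, G.Adj u v ∧ Prec G W u v := by
  by_contra hc
  push Not at hc
  exact hS (h.mem_iff.2 ⟨hv, hc⟩)

theorem exists_prec_max {W : Set V} (Q : Finset V) (hQ : Q.Nonempty) :
    ∃ v ∈ Q, ∀ w ∈ Q, w = v ∨ Prec G W w v := by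
  classical
  induction hQ using Finset.Nonempty.cons_induction with
  | singleton a => exact ⟨a, by simp, by simp⟩
  | cons a s ha hs ih =>
    obtain ⟨v, hv, hmax⟩ := ih
    rcases prec_total (G := G) (W := W) (u := a) (v := v) (by rintro rfl; exact ha hv) with h | h
    · refine ⟨v, by simp [hv], fun w hw => ?_⟩
      rcases Finset.mem_cons.1 hw with rfl | hw
      · exact .inr h
      · exact hmax w hw
    · refine ⟨a, by simp, fun w hw => ?_⟩
      rcases Finset.mem_cons.1 hw with rfl | hw
      · exact .inl rfl
      · rcases hmax w hw with rfl | h'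
        · exact .inr h
        · exact .inr (h'.trans h)

/-- A clique of `W` that avoids the kernel can be extended by a vertex of the kernel. -/
theorem IsKernel.exists_adj_clique (hG : IsP5CoP5Free G) {W S : Set V} (hW : NoC5 G W)
    (hS : IsKernel G W S) : ∀ (Q : Finset V), Q.Nonempty → (∀ w ∈ Q, w ∈ W ∧ w ∉ S) →
      G.IsClique (Q : Set V) → ∃ s ∈ S, (∀ w ∈ Q, G.Adj s w) ∧ ∃ w ∈ Q, Prec G W s w := by
  classical
  intro Q
  induction Q using Finset.strongInduction with
  | H Q ih =>
    intro hne hQ hcl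
    -- Let `b` be the last vertex of `Q`. By induction some `d` in the kernel is complete to `Q`
    -- without `b` and precedes some `c` there; likewise some `a` is complete to `Q` without `c`. If
    -- neither extends `Q`, then `a`, `b`, `c`, `d` is an induced path.
    obtain ⟨b, hb, hmax⟩ := exists_prec_max (G := G) (W := W) Q hne
    have sub : ∀ x ∈ Q, (Q.erase x).Nonempty → ∃ s ∈ S, (∀ w ∈ Q.erase x, G.Adj s w) ∧
        ∃ w ∈ Q.erase x, Prec G W s w := fun x hx h =>
      ih _ (Finset.erase_ssubset hx) h (fun w hw => hQ w (Finset.mem_of_mem_erase hw))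
        (hcl.subset (by simp))
    by_cases hone : (Q.erase b).Nonempty
    · obtain ⟨d, hd, hdQ, c, hc, hdc⟩ := sub b hb hone
      have hcb := Finset.ne_of_mem_erase hc
      have hcQ := Finset.mem_of_mem_erase hc
      by_cases hdb : G.Adj d b
      · refine ⟨d, hd, fun w hw => ?_, c, hcQ, hdc⟩
        by_cases hwb : w = b
        · rwa [hwb]
        · exact hdQ w (Finset.mem_erase.2 ⟨hwb, hw⟩)
      obtain ⟨a, ha, haQ, w, hw, haw⟩ := sub c hcQ ⟨b, Finset.mem_erase.2 ⟨hcb.symm, hb⟩⟩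
      by_cases hac : G.Adj a c
      · refine ⟨a, ha, fun w hw => ?_, w, Finset.mem_of_mem_erase hw, haw⟩
        by_cases hwb : w = c
        · rwa [hwb]
        · exact haQ w (Finset.mem_erase.2 ⟨hwb, hw⟩)
      exfalso
      -- Since `a` precedes some vertex of `Q` and `b` is last, `a` precedes `b`. Both ends of the
      -- path thus have degrees as large as their neighbors, which `NoC5.no_obstruction` forbids.
      have hab : Prec G W a b := by
        rcases hmax w (Finset.mem_of_mem_erase hw) with rfl | h
        · exact haw
        · exact haw.trans h
      exact hW.no_obstruction hG (hS.subset ha) (hQ b hb).1 (hQ c hcQ).1 (hS.subset hd)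
        (haQ b (Finset.mem_erase.2 ⟨hcb.symm, hb⟩)) (hcl hb hcQ hcb.symm) (hdQ c hc).symm hac
        (fun h => hdb h.symm) (hS.stable ha hd) hab.le hdc.le
    · obtain ⟨s, hs, hsb, hp⟩ := hS.exists_adj (hQ b hb).1 (hQ b hb).2
      refine ⟨s, hs, fun w hw => ?_, b, hb, hp⟩
      by_cases hwb : w = b
      · rwa [hwb]
      · exact absurd ⟨w, Finset.mem_erase.2 ⟨hwb, hw⟩⟩ hone

theorem IsKernel.cliquesLE (hG : IsP5CoP5Free G) {W S : Set V} (hW : NoC5 G W)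
    (hS : IsKernel G W S) {n : ℕ} (h : CliquesLE G W (n + 1)) : CliquesLE G (W \ S) n := by
  classical
  intro Q hQ hcl
  rcases Q.eq_empty_or_nonempty with rfl | hne
  · simp
  obtain ⟨s, hs, hadj, -⟩ := hS.exists_adj_clique hG hW Q hne (fun w hw => hQ hw) hcl
  have hsQ : s ∉ Q := fun hsQ => (hQ hsQ).2 hs
  have := h (insert s Q) (by
    rw [Finset.coe_insert]
    exact Set.insert_subset (hS.subset hs) (hQ.trans Set.sdiff_subset)) (by
    rw [Finset.coe_insert]
    exact hcl.insert fun w hw _ => hadj w hw)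
  rw [Finset.card_insert_of_notMem hsQ] at this
  omega

/-- Each kernel is taken as a color class and lowers the clique bound by one. -/
theorem NoC5.colorable (hG : IsP5CoP5Free G) {n : ℕ} : ∀ {W : Set V}, NoC5 G W →
    CliquesLE G W n → (G.induce W).Colorable n := by
  induction n with
  | zero =>
    intro W _ h
    have : IsEmpty W := ⟨fun x => by simpa using h {x.1} (by simp) (by simp)⟩
    exact .of_isEmpty _
  | succ n ih =>
    intro W hW h
    have hS := isKernel_iterate (G := G) W ∅
    exact colorable_succ_of_stable (fun u hu v hv => hS.stable hu hv)
      (ih (hW.mono Set.sdiff_subset) (hS.cliquesLE hG hW h))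

end P5Graphs

/-! ### Expansions, weighted colorings and the structure of critical graphs -/

namespace P5Graphs

open SimpleGraph

/-! ### Expansions -/

/-- The graph `G` arises from `B` by substituting the fibers of `p` for the vertices. -/
def IsExpansion {V I : Type*} (B : SimpleGraph I) (G : SimpleGraph V) (p : V → I) : Prop :=
  ∀ u v, p u ≠ p v → (G.Adj u v ↔ B.Adj (p u) (p v))

/-- The chromatic number of the subgraph induced by `s`. -/
noncomputable def chiOn {V : Type*} (G : SimpleGraph V) (s : Set V) : ℕ :=
  sInf {n | (G.induce s).Colorable n}

theorem chiOn_le_iff {V : Type*} [Finite V] {G : SimpleGraph V} {s : Set V} {n : ℕ} :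
    chiOn G s ≤ n ↔ (G.induce s).Colorable n := by
  constructor
  · intro h
    have : {n | (G.induce s).Colorable n}.Nonempty := by
      have := Fintype.ofFinite s
      exact ⟨_, colorable_of_fintype _⟩
    exact Colorable.mono h (Nat.sInf_mem this)
  · exact fun h => Nat.sInf_le h

theorem chiOn_mono {V : Type*} [Finite V] {G : SimpleGraph V} {s t : Set V} (h : s ⊆ t) :
    chiOn G s ≤ chiOn G t :=
  chiOn_le_iff.2 (colorable_induce_mono h (chiOn_le_iff.1 le_rfl))

theorem colorable_iff_chiOn_univ {V : Type*} [Finite V] {G : SimpleGraph V} {n : ℕ} :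
    G.Colorable n ↔ chiOn G Set.univ ≤ n := by
  rw [chiOn_le_iff]
  exact ⟨fun h => colorable_of_embedding h (Embedding.induce _),
    fun h => colorable_of_embedding h (induceUnivIso G).symm.toEmbedding⟩

theorem chiOn_le_succ {V : Type*} [Finite V] {G : SimpleGraph V} (s : Set V) (v : V) :
    chiOn G s ≤ chiOn G (s \ {v}) + 1 :=
  chiOn_le_iff.2 (colorable_succ_of_stable (S := {v}) (by simp) (chiOn_le_iff.1 le_rfl))

theorem chiOn_pos {V : Type*} [Finite V] {G : SimpleGraph V} {s : Set V} (h : s.Nonempty) :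
    0 < chiOn G s := by
  by_contra hc
  have := colorable_zero_iff.1 (chiOn_le_iff.1 (Nat.le_zero.2 (Nat.eq_zero_of_not_pos hc)))
  exact this.elim ⟨_, h.some_mem⟩

theorem isCritical_induce_succ_iff {V : Type*} [Finite V] {G : SimpleGraph V} {s : Set V} {n : ℕ} :
    IsCritical (n + 1) (G.induce s) ↔ n < chiOn G s ∧ ∀ v ∈ s, chiOn G (s \ {v}) ≤ n := by
  have e : ∀ v : s, (((G.induce s).induce {v}ᶜ).Colorable n ↔ chiOn G (s \ {v.1}) ≤ n) := by
    intro v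
    obtain ⟨e⟩ := induce_induce_iso G s {v}ᶜ
    rw [chiOn_le_iff, show s \ {v.1} = Subtype.val '' ({v}ᶜ : Set s) by
      ext x
      simp only [Set.mem_sdiff, Set.mem_singleton_iff, Set.mem_image, Set.mem_compl_iff,
        Subtype.exists]
      constructor
      · rintro ⟨h1, h2⟩
        exact ⟨x, h1, by simpa [Subtype.ext_iff] using h2, rfl⟩
      · rintro ⟨y, h1, h2, rfl⟩
        exact ⟨h1, by simpa [Subtype.ext_iff] using h2⟩]
    exact colorable_congr e
  rw [isCritical_succ_iff, ← not_le, chiOn_le_iff]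
  exact and_congr_right fun _ => ⟨fun h v hv => (e ⟨v, hv⟩).1 (h ⟨v, hv⟩), fun h v =>
    (e v).2 (h v.1 v.2)⟩

theorem isCritical_iff_univ {V : Type*} {G : SimpleGraph V} {n : ℕ} :
    IsCritical n G ↔ IsCritical n (G.induce Set.univ) :=
  ⟨fun h => h.of_iso (induceUnivIso G).symm, fun h => h.of_iso (induceUnivIso G)⟩

/-- There are color sets of sizes `w i` that are disjoint along the edges of `B`. -/
def HasColorSets {I : Type*} (B : SimpleGraph I) (q : ℕ) (w : I → ℕ) : Prop :=
  ∃ S : I → Finset (Fin q), (∀ i, (S i).card = w i) ∧ ∀ i j, B.Adj i j → Disjoint (S i) (S j)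

theorem HasColorSets.mono {I : Type*} {B : SimpleGraph I} {q : ℕ} {w w' : I → ℕ}
    (h : HasColorSets B q w) (hw : ∀ i, w' i ≤ w i) : HasColorSets B q w' := by
  obtain ⟨S, hS, hd⟩ := h
  choose T hT hc using fun i => Finset.exists_subset_card_eq (s := S i) (n := w' i)
    (by rw [hS]; exact hw i)
  exact ⟨T, hc, fun i j hij => Finset.disjoint_of_subset_left (hT i)
    (Finset.disjoint_of_subset_right (hT j) (hd i j hij))⟩

/-- From a coloring, take the colors that occur on each fiber. Conversely, color each fiber
optimally with its own color set; edges between fibers are then harmless. -/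
theorem IsExpansion.chiOn_le_iff {V I : Type*} [Finite V] {B : SimpleGraph I} {G : SimpleGraph V}
    {p : V → I} (hp : IsExpansion B G p) (s : Set V) (q : ℕ) :
    chiOn G s ≤ q ↔ HasColorSets B q fun i => chiOn G (s ∩ {v | p v = i}) := by
  classical
  rw [P5Graphs.chiOn_le_iff]
  constructor
  · rintro ⟨c⟩
    let S : I → Finset (Fin q) := fun i => Finset.univ.filter fun t => ∃ v : s, p v = i ∧ c v = t
    refine HasColorSets.mono (w := fun i => (S i).card) ⟨S, fun i => rfl, fun i j hij => ?_⟩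
      fun i => ?_
    · rw [Finset.disjoint_left]
      rintro t ht ht'
      obtain ⟨u, hu, hut⟩ := (Finset.mem_filter.1 ht).2
      obtain ⟨v, hv, hvt⟩ := (Finset.mem_filter.1 ht').2
      refine c.valid (v := u) (w := v) ?_ (hut.trans hvt.symm)
      exact (hp u v (by rw [hu, hv]; exact hij.ne)).2 (by rwa [hu, hv])
    · rw [P5Graphs.chiOn_le_iff]
      have d : (G.induce (s ∩ {v | p v = i})).Coloring (S i) := Coloring.mk
        (fun x => ⟨c ⟨x.1, x.2.1⟩, Finset.mem_filter.2 ⟨Finset.mem_univ _, ⟨x.1, x.2.1⟩, x.2.2, rfl⟩⟩)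
        fun {u v} h => by
          simp only [ne_eq, Subtype.mk.injEq]
          exact c.valid (v := ⟨u.1, u.2.1⟩) (w := ⟨v.1, v.2.1⟩) h
      simpa using d.colorable
  · rintro ⟨S, hS, hd⟩
    have hc : ∀ i, Nonempty ((G.induce (s ∩ {v | p v = i})).Coloring (S i)) := fun i => by
      obtain ⟨c⟩ := P5Graphs.chiOn_le_iff.1 (le_refl (chiOn G (s ∩ {v | p v = i})))
      exact ⟨recolorOfEmbedding _ (finCongr (hS i).symm |>.trans (S i).equivFin.symm).toEmbedding c⟩
    have c := fun i => (hc i).some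
    refine ⟨Coloring.mk (fun x => (c (p x.1) ⟨x.1, x.2, rfl⟩ : Fin q)) ?_⟩
    intro u v huv
    by_cases h : p u.1 = p v.1
    · have : ∀ i (hi : p u.1 = i) (hj : p v.1 = i), (c i ⟨u.1, u.2, hi⟩ : Fin q) ≠ c i ⟨v.1, v.2, hj⟩ :=
        fun i hi hj he => (c i).valid (v := ⟨u.1, u.2, hi⟩) (w := ⟨v.1, v.2, hj⟩) huv (Subtype.ext he)
      have e : ∀ i (hi : p u.1 = i), (c (p u.1) ⟨u.1, u.2, rfl⟩ : Fin q) = c i ⟨u.1, u.2, hi⟩ := by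
        rintro i rfl; rfl
      rw [e _ h]
      exact this _ h rfl
    · intro he
      have := hd _ _ ((hp u v h).1 huv)
      rw [Finset.disjoint_left] at this
      exact this (c (p u.1) ⟨u.1, u.2, rfl⟩).2 (he ▸ (c (p v.1) ⟨v.1, v.2, rfl⟩).2)

/-- If deleting `v` did not lower the chromatic number of its fiber, no weight would change, and the
whole graph would need as few colors as the graph without `v`. -/
theorem IsExpansion.fiber_critical {V I : Type*} [Finite V] {B : SimpleGraph I} {G : SimpleGraph V}
    {p : V → I} (hp : IsExpansion B G p) (hs : Function.Surjective p) {k : ℕ}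
    (hG : IsCritical (k + 1) G) (i : I) :
    0 < chiOn G {v | p v = i} ∧ IsCritical (chiOn G {v | p v = i}) (G.induce {v | p v = i}) := by
  rw [isCritical_iff_univ, isCritical_induce_succ_iff] at hG
  have h0 : 0 < chiOn G {v | p v = i} := chiOn_pos (hs i)
  refine ⟨h0, ?_⟩
  obtain ⟨m, hm⟩ := Nat.exists_eq_add_one_of_ne_zero h0.ne'
  rw [hm, isCritical_induce_succ_iff]
  refine ⟨by omega, fun v hv => ?_⟩
  by_contra hc
  refine hG.1.not_ge ((hp.chiOn_le_iff _ _).2 ?_)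
  refine ((hp.chiOn_le_iff _ _).1 (hG.2 v trivial)).mono fun j => ?_
  by_cases hj : j = i
  · subst hj
    rw [show (Set.univ \ {v}) ∩ {x | p x = j} = {x | p x = j} \ {v} by ext; simp; tauto,
      Set.univ_inter]
    omega
  · refine chiOn_mono fun x hx => ⟨⟨trivial, ?_⟩, hx.2⟩
    rintro rfl
    exact hj (hx.2.symm.trans hv)

/-- Converse to `IsExpansion.fiber_critical`: deleting a vertex lowers the weight of its fiber and
raises no other, so it suffices that `w` is minimal among the weights that need more than `k`
colors. -/
theorem IsExpansion.isCritical {V I : Type*} [Finite V] {B : SimpleGraph I} {G : SimpleGraph V}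
    {p : V → I} (hp : IsExpansion B G p) {k : ℕ} {w : I → ℕ}
    (hw : ∀ i, 0 < w i ∧ IsCritical (w i) (G.induce {v | p v = i})) (h : ¬ HasColorSets B k w)
    (h' : ∀ i, ∀ w' : I → ℕ, w' i < w i → (∀ j, w' j ≤ w j) → HasColorSets B k w') :
    IsCritical (k + 1) G := by
  have hc : ∀ i, chiOn G {v | p v = i} = w i ∧
      ∀ v, p v = i → chiOn G ({v | p v = i} \ {v}) < w i := fun i => by
    obtain ⟨m, hm⟩ := Nat.exists_eq_add_one_of_ne_zero (hw i).1.ne'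
    have := (hw i).2
    rw [hm, isCritical_induce_succ_iff] at this
    rw [hm]
    have hne : {v | p v = i}.Nonempty := by
      by_contra hne
      rw [Set.not_nonempty_iff_eq_empty] at hne
      have h1 := this.1
      rw [hne] at h1
      have : chiOn G ∅ ≤ 0 := P5Graphs.chiOn_le_iff.2 (.of_isEmpty _)
      omega
    have h2 := chiOn_le_succ (G := G) {v | p v = i} hne.some
    have h3 := this.2 _ hne.some_mem
    exact ⟨by omega, fun v hv => by have := this.2 v hv; omega⟩
  rw [isCritical_iff_univ, isCritical_induce_succ_iff]
  constructor
  · rw [← not_le, hp.chiOn_le_iff]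
    simpa [hc] using h
  · intro v _
    rw [hp.chiOn_le_iff]
    refine h' (p v) _ ?_ fun j => ?_
    · rw [show (Set.univ \ {v}) ∩ {x | p x = p v} = {x | p x = p v} \ {v} by ext; simp; tauto]
      exact (hc (p v)).2 v rfl
    · rw [← (hc j).1]
      exact chiOn_mono Set.inter_subset_right

theorem hasColorSets_top_iff {q : ℕ} {w : Fin 2 → ℕ} :
    HasColorSets ⊤ q w ↔ w 0 + w 1 ≤ q := by
  constructor
  · rintro ⟨S, hS, hd⟩
    rw [← hS, ← hS, ← Finset.card_union_of_disjoint (hd 0 1 (by simp))]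
    simpa using Finset.card_le_univ (S 0 ∪ S 1)
  · intro h
    obtain ⟨A, -, hA⟩ := Finset.exists_subset_card_eq (s := (Finset.univ : Finset (Fin q)))
      (n := w 0) (by simp; omega)
    obtain ⟨B, hB, hB'⟩ := Finset.exists_subset_card_eq (s := Aᶜ)
      (n := w 1) (by rw [Finset.card_compl, hA]; simp; omega)
    have hAB : Disjoint A B := Finset.disjoint_left.2 fun x hx hx' => by
      simpa [hx] using hB hx'
    refine ⟨![A, B], ?_, ?_⟩
    · intro i; fin_cases i <;> simp [hA, hB']
    · intro i j hij; fin_cases i <;> fin_cases j <;> simp_all [hAB.symm]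

/-- Each color occurs on a stable set of $C_5$, hence at most twice, so the sum condition is
necessary. For sufficiency, `A` and `B` are initial intervals and `E` is a final interval, so that
`E` meets `B` in at most $\max(0, w_0+w_1+w_4-q)$ colors. -/
theorem hasColorSets_c5_iff {q : ℕ} {w : Fin 5 → ℕ} :
    HasColorSets c5 q w ↔ (∀ i, w i + w (i + 1) ≤ q) ∧ ∑ i, w i ≤ 2 * q := by
  constructor
  · rintro ⟨S, hS, hd⟩
    refine ⟨fun i => ?_, ?_⟩
    · rw [← hS, ← hS, ← Finset.card_union_of_disjoint (hd i (i + 1) (by simp [c5]))]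
      simpa using Finset.card_le_univ (S i ∪ S (i + 1))
    · have h1 : ∑ i, w i = ∑ t : Fin q, (Finset.univ.filter fun i => t ∈ S i).card := by
        simp_rw [← hS, Finset.card_filter]
        rw [Finset.sum_comm]
        refine Finset.sum_congr rfl fun i _ => ?_
        rw [← Finset.card_filter]
        simp
      have h2 : ∀ b : Finset (Fin 5), (∀ i j, c5.Adj i j → i ∈ b → j ∉ b) → b.card ≤ 2 := by
        decide +kernel
      rw [h1]
      calc _ ≤ ∑ t : Fin q, 2 := Finset.sum_le_sum fun t _ => h2 _ fun i j hij hi hj => by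
              simp only [Finset.mem_filter, Finset.mem_univ, true_and] at hi hj
              exact Finset.disjoint_left.1 (hd i j hij) hi hj
        _ = 2 * q := by simp [mul_comm]
  · rintro ⟨h, hs⟩
    have h0 := h 0
    have h1 := h 1
    have h2 := h 2
    have h3 := h 3
    have h4 := h 4
    simp only [Fin.sum_univ_five] at hs
    norm_num at h0 h1 h2 h3 h4
    simp only [show (4 + 1 : Fin 5) = 0 from rfl, show (3 + 1 : Fin 5) = 4 from rfl,
      show (2 + 1 : Fin 5) = 3 from rfl, show (1 + 1 : Fin 5) = 2 from rfl] at h0 h1 h2 h3 h4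
    have card_int : ∀ a b : ℕ, a ≤ b → b ≤ q →
        (Finset.univ.filter fun t : Fin q => a ≤ t.val ∧ t.val < b).card = b - a := by
      intro a b hab hb
      rw [← Nat.card_Ico, ← Finset.card_map Fin.valEmbedding]
      congr 1
      ext t
      simp only [Finset.mem_map, Finset.mem_filter, Finset.mem_univ, true_and, Fin.valEmbedding_apply,
        Finset.mem_Ico]
      constructor
      · rintro ⟨x, hx, rfl⟩; exact hx
      · rintro ht; exact ⟨⟨t, by omega⟩, ht, rfl⟩
    set A := Finset.univ.filter fun t : Fin q => 0 ≤ t.val ∧ t.val < w 0 with hA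
    set B := Finset.univ.filter fun t : Fin q => w 0 ≤ t.val ∧ t.val < w 0 + w 1 with hB
    set E := Finset.univ.filter fun t : Fin q => q - w 4 ≤ t.val ∧ t.val < q with hE
    have cA : A.card = w 0 := by rw [hA, card_int _ _ (by omega) (by omega)]; omega
    have cB : B.card = w 1 := by rw [hB, card_int _ _ (by omega) (by omega)]; omega
    have cE : E.card = w 4 := by rw [hE, card_int _ _ (by omega) (by omega)]; omega
    have dAB : Disjoint A B := Finset.disjoint_left.2 fun x hx hx' => by
      simp only [hA, hB, Finset.mem_filter, Finset.mem_univ, true_and] at hx hx'; omega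
    have dAE : Disjoint A E := Finset.disjoint_left.2 fun x hx hx' => by
      simp only [hA, hE, Finset.mem_filter, Finset.mem_univ, true_and] at hx hx'; omega
    have cBE : (E ∩ B).card ≤ w 0 + w 1 + w 4 - q := by
      refine (Finset.card_le_card ?_).trans (card_int (q - w 4) (max (q - w 4) (w 0 + w 1))
        (by omega) (by omega)).le |>.trans (by omega)
      intro x hx
      simp only [hB, hE, Finset.mem_inter, Finset.mem_filter, Finset.mem_univ, true_and] at hx ⊢
      omega
    have cEB : (E \ B).card = w 4 - (E ∩ B).card := by
      rw [Finset.card_sdiff, cE, Finset.inter_comm]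
    have le1 : (E ∩ B).card ≤ w 4 := by rw [← cE]; exact Finset.card_le_card Finset.inter_subset_left
    suffices ∃ C D : Finset (Fin q), C.card = w 2 ∧ D.card = w 3 ∧ Disjoint B C ∧ Disjoint C D ∧
        Disjoint D E by
      obtain ⟨C, D, cC, cD, d1, d2, d3⟩ := this
      refine ⟨![A, B, C, D, E], fun i => ?_, fun i j hij => ?_⟩
      · fin_cases i <;> simp [cA, cB, cC, cD, cE]
      · revert hij
        fin_cases i <;> fin_cases j <;>
          simp [c5, dAB, dAB.symm, dAE, dAE.symm, d1, d1.symm, d2, d2.symm, d3, d3.symm]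
    -- The set `C` takes its colors from `E \ B` as long as possible, because `D` cannot use these
    -- anyway. Only the remainder `R` reduces the choice for `D`, and the sum condition makes up for
    -- it.
    by_cases hw : w 2 ≤ (E \ B).card
    · obtain ⟨C, hC, cC⟩ := Finset.exists_subset_card_eq hw
      obtain ⟨D, hD, cD⟩ := Finset.exists_subset_card_eq (s := Eᶜ) (n := w 3)
        (by rw [Finset.card_compl, cE]; simp; omega)
      refine ⟨C, D, cC, cD, ?_, ?_, ?_⟩ <;> refine Finset.disjoint_left.2 fun x hx hx' => ?_
      · exact (Finset.mem_sdiff.1 (hC hx')).2 hx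
      · exact Finset.mem_compl.1 (hD hx') (Finset.mem_sdiff.1 (hC hx)).1
      · exact Finset.mem_compl.1 (hD hx) hx'
    · have cU : (B ∪ E)ᶜ.card = q - (w 1 + w 4 - (E ∩ B).card) := by
        have := Finset.card_union_add_card_inter B E
        rw [Finset.inter_comm] at this
        rw [Finset.card_compl, Fintype.card_fin]
        omega
      obtain ⟨R, hR, cR⟩ := Finset.exists_subset_card_eq (s := (B ∪ E)ᶜ)
        (n := w 2 - (E \ B).card) (by omega)
      have dR : Disjoint (E \ B) R := Finset.disjoint_left.2 fun x hx hx' => by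
        have := hR hx'
        simp only [Finset.mem_compl, Finset.mem_union, not_or] at this
        exact this.2 (Finset.mem_sdiff.1 hx).1
      have cER : (Eᶜ \ R).card = q - w 4 - R.card := by
        rw [Finset.card_sdiff_of_subset, Finset.card_compl, cE, Fintype.card_fin]
        intro x hx
        have := hR hx
        simp only [Finset.mem_compl, Finset.mem_union, not_or] at this ⊢
        exact this.2
      obtain ⟨D, hD, cD⟩ := Finset.exists_subset_card_eq (s := Eᶜ \ R) (n := w 3) (by omega)
      refine ⟨(E \ B) ∪ R, D, by rw [Finset.card_union_of_disjoint dR]; omega, cD, ?_, ?_, ?_⟩ <;>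
        refine Finset.disjoint_left.2 fun x hx hx' => ?_
      · rcases Finset.mem_union.1 hx' with h | h
        · exact (Finset.mem_sdiff.1 h).2 hx
        · have := hR h
          simp only [Finset.mem_compl, Finset.mem_union, not_or] at this
          exact this.1 hx
      · have := hD hx'
        simp only [Finset.mem_sdiff, Finset.mem_compl] at this
        rcases Finset.mem_union.1 hx with h | h
        · exact this.1 (Finset.mem_sdiff.1 h).1
        · exact this.2 h
      · have := hD hx
        simp only [Finset.mem_sdiff, Finset.mem_compl] at this
        exact this.1 hx'

/-! ### The structure of critical graphs -/

theorem isP5CoP5Free_of_forall_adj {V : Type*} {G : SimpleGraph V} (h : ∀ u v, u ≠ v → G.Adj u v) :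
    IsP5CoP5Free G := by
  rw [isP5CoP5Free_iff]
  rintro X hX ⟨g⟩
  have : IsPattern X := by rcases hX with rfl | rfl; exacts [isPattern_p5, isPattern_p5_compl]
  obtain ⟨j, hj, hadj⟩ := (this.2.1 0).2
  exact hadj (g.map_adj_iff.1 (h _ _ (g.injective.ne hj.symm)))

/-- The graph obtained from `G` by replacing the set `M` with a clique of size `q`, whose vertices
are adjacent to the neighbors of `m` outside `M`. -/
def replaceByClique {V : Type} (G : SimpleGraph V) (M : Set V) (m : V) (q : ℕ) :
    SimpleGraph ({v // v ∉ M} ⊕ Fin q) where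
  Adj x y := x ≠ y ∧ ((x.isRight = true ∧ y.isRight = true) ∨
    G.Adj (x.elim Subtype.val fun _ => m) (y.elim Subtype.val fun _ => m))
  symm := ⟨fun _ _ h => ⟨h.1.symm, h.2.imp (fun h => h.symm) (fun h => h.symm)⟩⟩
  loopless := ⟨fun _ h => h.1 rfl⟩

section ReplaceByClique

variable {V : Type} {G : SimpleGraph V} {M : Set V} {m : V} {q : ℕ}

@[simp] theorem replaceByClique_adj_inl_inl {u v : {v // v ∉ M}} :
    (replaceByClique G M m q).Adj (.inl u) (.inl v) ↔ G.Adj u v := by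
  simp only [replaceByClique, Sum.isRight_inl, Bool.false_eq_true, false_and, false_or, Sum.elim_inl]
  exact ⟨fun h => h.2, fun h => ⟨fun e => G.ne_of_adj h (congrArg Subtype.val (Sum.inl_injective e)), h⟩⟩

@[simp] theorem replaceByClique_adj_inl_inr {u : {v // v ∉ M}} {i : Fin q} :
    (replaceByClique G M m q).Adj (.inl u) (.inr i) ↔ G.Adj u m := by
  simp [replaceByClique]

@[simp] theorem replaceByClique_adj_inr_inr {i j : Fin q} :
    (replaceByClique G M m q).Adj (.inr i) (.inr j) ↔ i ≠ j := by
  simp [replaceByClique]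

theorem replaceByClique_free (hG : IsP5CoP5Free G) : IsP5CoP5Free (replaceByClique G M m q) := by
  refine hG.of_substitution {x | x.isRight = true} (Sum.elim Subtype.val fun _ => m) m ?_ ?_ ?_
  · rintro (y | y) hy
    · simp at hy
    · rfl
  · intro x y hxy hN
    simp only [Set.mem_ofPred_eq] at hN
    simp [replaceByClique, hxy, hN]
  · refine isP5CoP5Free_of_forall_adj fun u v huv => ?_
    exact ⟨fun h => huv (Subtype.ext h), .inl ⟨u.2, v.2⟩⟩

/-- The set `M` and the clique need equally many colors, so they can be exchanged by
`colorable_swap`. Deleting a clique vertex is compared with deleting `m`, which lowers the chromatic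
number of `M` by at most one. -/
theorem replaceByClique_isCritical [Finite V] {k : ℕ} (hG : IsCritical (k + 1) G) (hm : m ∈ M)
    (hM : ∀ u ∈ M, ∀ v ∉ M, G.Adj v u ↔ G.Adj v m) (h0 : ∃ v, v ∉ M) :
    IsCritical (k + 1) (replaceByClique G M m (chiOn G M)) := by
  classical
  obtain ⟨v₀, hv₀⟩ := h0
  rw [isCritical_succ_iff] at hG ⊢
  constructor
  · intro h
    refine hG.1 (colorable_swap h {x | x.isRight = true} M
      (fun v => if hv : v ∈ M then .inl ⟨v₀, hv₀⟩ else .inl ⟨v, hv⟩) ?_ ?_ ?_)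
    · intro x hx y hy hxy
      simpa [hx, hy] using hxy
    · rintro x hx y hy hxy (z | z) hz
      · simp at hz
      · simpa [hx] using (hM y hy x hx).1 hxy
    · intro r hr
      rw [← P5Graphs.chiOn_le_iff]
      refine not_colorable_top (colorable_of_embedding hr
        ⟨⟨fun i => ⟨.inr i, rfl⟩, fun i j hij =>
          Sum.inr_injective (congrArg Subtype.val hij :)⟩, fun {i j} => replaceByClique_adj_inr_inr⟩)
  · intro x
    let v : V := x.elim Subtype.val fun _ => m
    obtain ⟨d, hd⟩ : ∃ d, d ≠ v := by
      by_cases h : v ∈ M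
      · exact ⟨v₀, by rintro rfl; exact hv₀ h⟩
      · exact ⟨m, by rintro h'; exact h (h' ▸ hm)⟩
    let ψ : ({x}ᶜ : Set ({v // v ∉ M} ⊕ Fin (chiOn G M))) → ({v}ᶜ : Set V) := fun y =>
      y.1.elim (fun w => if hw : w.1 = v then ⟨d, hd⟩ else ⟨w.1, hw⟩) fun _ => ⟨d, hd⟩
    have hψ : ∀ w (hw : Sum.inl w ∈ ({x}ᶜ : Set ({v // v ∉ M} ⊕ Fin (chiOn G M)))),
        (ψ ⟨.inl w, hw⟩).1 = w.1 := by
      intro w hw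
      have : w.1 ≠ v := by
        intro h
        rcases x with x | x
        · exact hw (by simp only [Set.mem_singleton_iff, Sum.inl.injEq]; exact Subtype.ext h)
        · exact w.2 (h ▸ hm)
      simp [ψ, this]
    refine colorable_swap (hG.2 v) {u | u.1 ∈ M} {y | y.1.isRight = true} ψ ?_ ?_ ?_
    · rintro ⟨y | y, hy⟩ h1 ⟨z | z, hz⟩ h2 hyz
      · simpa [hψ] using hyz
      all_goals simp at h1 h2
    · rintro ⟨y | y, hy⟩ h1 ⟨z | z, hz⟩ h2 hyz u hu
      · simp at h2
      · rw [comap_adj, Function.Embedding.subtype_apply, Function.Embedding.subtype_apply, hψ,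
          hM u.1 hu y.1 y.2]
        simpa using hyz
      all_goals simp at h1
    · intro r hr
      obtain ⟨e⟩ := induce_induce_iso G {v}ᶜ {u | u.1 ∈ M}
      rw [colorable_congr e, ← P5Graphs.chiOn_le_iff] at hr
      rcases x with x | x
      · have hle : chiOn G M ≤ r := (chiOn_mono fun u hu => by
          simp only [Set.mem_image, Set.mem_ofPred_eq]
          exact ⟨⟨u, fun h => x.2 ((show u = x.1 from h) ▸ hu)⟩, hu, rfl⟩).trans hr
        refine Colorable.mono hle ⟨Coloring.mk (fun y => y.1.1.elim (fun _ => y.1.1.getRight y.2) id) ?_⟩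
        rintro ⟨⟨y | y, hy⟩, h1⟩ ⟨⟨z | z, hz⟩, h2⟩ hyz
        · simp at h1
        · simp at h1
        · simp at h2
        · simpa using hyz
      · have hle : chiOn G M ≤ r + 1 := (chiOn_le_succ M m).trans (by
          refine Nat.add_le_add_right ((chiOn_mono ?_).trans hr) 1
          intro u hu
          simp only [Set.mem_image, Set.mem_ofPred_eq]
          exact ⟨⟨u, hu.2⟩, hu.1, rfl⟩)
        have c : (((replaceByClique G M m (chiOn G M)).induce {Sum.inr x}ᶜ).induce
            {y | y.1.isRight = true}).Coloring {i // i ≠ x} := by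
          refine Coloring.mk (fun y => ⟨y.1.1.getRight y.2, fun h => y.1.2 ?_⟩) ?_
          · simp [← h]
          · rintro ⟨⟨y | y, hy⟩, h1⟩ ⟨⟨z | z, hz⟩, h2⟩ hyz
            · simp at h1
            · simp at h1
            · simp at h2
            · simpa using hyz
        refine Colorable.mono ?_ c.colorable
        rw [Fintype.card_subtype_compl]
        simp
        omega

/-- An expansion structure of the reduced graph can be carried over. -/
theorem isExpansion_of_replaceByClique {I : Type*} {B : SimpleGraph I}
    {p : {v // v ∉ M} ⊕ Fin q → I} (hp : IsExpansion B (replaceByClique G M m q) p)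
    (hM : ∀ u ∈ M, ∀ v ∉ M, G.Adj v u ↔ G.Adj v m) (j : Fin q) {p' : V → I}
    (h1 : ∀ v (hv : v ∉ M), p' v = p (.inl ⟨v, hv⟩)) (h2 : ∀ v ∈ M, p' v = p (.inr j)) :
    IsExpansion B G p' := by
  have key : ∀ u ∈ M, ∀ v ∉ M, p' v ≠ p' u → (G.Adj v u ↔ B.Adj (p' v) (p' u)) := by
    intro u hu v hv h
    rw [h1 v hv, h2 u hu] at *
    rw [hM u hu v hv, ← hp _ _ h, replaceByClique_adj_inl_inr]
  intro u v h
  by_cases hu : u ∈ M <;> by_cases hv : v ∈ M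
  · exact absurd ((h2 u hu).trans (h2 v hv).symm) h
  · rw [G.adj_comm, B.adj_comm]
    exact key u hu v hv h.symm
  · exact key v hv u hu h
  · rw [h1 u hu, h1 v hv] at *
    rw [← hp _ _ h, replaceByClique_adj_inl_inl]

end ReplaceByClique

theorem exists_fin2_expansion_of_forall_adj {V : Type} {G : SimpleGraph V}
    (h : ∀ u v, u ≠ v → G.Adj u v) {a b : V} (hab : a ≠ b) :
    ∃ p : V → Fin 2, Function.Surjective p ∧ IsExpansion ⊤ G p := by
  classical
  refine ⟨fun v => if v = a then 0 else 1, ?_, fun u v huv => ?_⟩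
  · intro i
    fin_cases i
    · exact ⟨a, by simp⟩
    · exact ⟨b, by simp [hab.symm]⟩
  · have : u ≠ v := by rintro rfl; exact huv rfl
    simpa [top_adj, huv] using h u v this

/-- By perfection there is a clique with more than `k` vertices. A vertex outside it could be
deleted without making the graph `k`-colorable, so the clique is everything. -/
theorem forall_adj_of_noC5 {V : Type} [Fintype V] {G : SimpleGraph V} {k : ℕ}
    (hG : IsMember (k + 1) G) (hC : NoC5 G Set.univ) : ∀ u v, u ≠ v → G.Adj u v := by
  classical
  let _ : LinearOrder V := LinearOrder.lift' (Fintype.equivFin V) (Fintype.equivFin V).injective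
  have hcr := isCritical_succ_iff.1 hG.1
  have hcl : ¬ CliquesLE G Set.univ k := fun h => hcr.1 (by
    rw [colorable_iff_chiOn_univ, P5Graphs.chiOn_le_iff]
    exact hC.colorable hG.2 h)
  unfold CliquesLE at hcl
  push Not at hcl
  obtain ⟨Q, -, hQ, hcard⟩ := hcl
  have hQu : ∀ v, v ∈ Q := by
    intro v
    by_contra hv
    obtain ⟨c⟩ := hcr.2 v
    have hne : ∀ w : Q, w.1 ∈ ({v}ᶜ : Set V) := fun w hw => hv (hw ▸ w.2)
    have : Function.Injective fun w : Q => c ⟨w.1, hne w⟩ := fun w w' hw => by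
      by_contra hc
      exact c.valid (v := ⟨w.1, hne w⟩) (w := ⟨w'.1, hne w'⟩)
        (hQ w.2 w'.2 fun h => hc (Subtype.ext h)) hw
    have := Fintype.card_le_of_injective _ this
    simp at this
    omega
  exact fun u v h => hQ (hQu u) (hQu v) h

/-- A critical graph with chromatic number at least two is a join or an expansion of `C₅`. -/
theorem IsMember.exists_expansion {k : ℕ} (hk : 1 ≤ k) : ∀ (N : ℕ) (V : Type) [Fintype V]
    (G : SimpleGraph V), Fintype.card V = N → IsMember (k + 1) G →
    (∃ p : V → Fin 2, Function.Surjective p ∧ IsExpansion ⊤ G p) ∨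
      ∃ p : V → Fin 5, Function.Surjective p ∧ IsExpansion c5 G p := by
  classical
  intro N
  induction N using Nat.strong_induction_on with
  | _ N ih =>
  intro V _ G hN hG
  by_cases hC : NoC5 G Set.univ
  · left
    have hV : ∃ a b : V, a ≠ b := by
      by_contra h
      push Not at h
      have : Subsingleton V := ⟨h⟩
      refine (isCritical_succ_iff.1 hG.1).1 (Colorable.mono hk ?_)
      exact ⟨Coloring.mk (fun _ => 0) fun {u v} huv => absurd (h u v) huv.ne⟩
    obtain ⟨a, b, hab⟩ := hV
    exact exists_fin2_expansion_of_forall_adj (forall_adj_of_noC5 hG hC) hab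
  unfold NoC5 at hC
  push Not at hC
  obtain ⟨c, hc, -⟩ := hC
  -- If the hull is everything, the parts give the expansion. Otherwise it is replaced by a clique,
  -- and the decomposition of the smaller graph is carried back.
  set M := hull G c with hMdef
  by_cases hM : ∀ v, v ∈ M
  · right
    choose p hp using hM
    refine ⟨p, fun i => ⟨c i, part_disjoint (hp _) (hc.mem_part i)⟩, fun u v huv => ?_⟩
    exact hc.adj_parts hG.2 (hp u) (hp v) huv
  push Not at hM
  have hmem : ∀ i, c i ∈ M := fun i => ⟨i, hc.mem_part i⟩
  have hmod : ∀ u ∈ M, ∀ v ∉ M, G.Adj v u ↔ G.Adj v (c 0) := fun u hu v hv =>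
    hc.adj_outside hG.2 hv hu
  set q := chiOn G M with hq
  -- The nonadjacent vertices `c 0` and `c 2` can share a color, so the clique is smaller than the
  -- hull.
  have hcard : q < Fintype.card M := by
    have hne : c 0 ≠ c 2 := fun h => by
      have h1 := (hc 0 1).2 (by decide)
      have h3 := mt (hc 0 3).1 (by decide)
      have h4 := (hc 2 3).2 (by decide)
      exact h3 (h ▸ h4)
    have hle : chiOn G M ≤ (M \ {c 0, c 2}).ncard + 1 := by
      refine P5Graphs.chiOn_le_iff.2 (colorable_succ_of_stable (S := {c 0, c 2}) ?_ ?_)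
      · have h1 := mt (hc 0 2).1 (by decide)
        have h2 := mt (hc 2 0).1 (by decide)
        rintro u (rfl | rfl) v (rfl | rfl) <;> simp_all
      · have := colorable_of_fintype (G.induce (M \ {c 0, c 2}))
        rwa [← Nat.card_eq_fintype_card, Nat.card_coe_set_eq] at this
    have := Set.ncard_sdiff (s := {c 0, c 2}) (t := M)
      (by rintro u (rfl | rfl) <;> exact hmem _) (Set.toFinite _)
    rw [Set.ncard_pair hne] at this
    have h2 : ({c 0, c 2} : Set V).ncard ≤ M.ncard :=
      Set.ncard_le_ncard (by rintro u (rfl | rfl) <;> exact hmem _) (Set.toFinite _)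
    rw [Set.ncard_pair hne] at h2
    rw [← Nat.card_eq_fintype_card, Nat.card_coe_set_eq]
    omega
  have hG' : IsMember (k + 1) (replaceByClique G M (c 0) q) :=
    ⟨replaceByClique_isCritical hG.1 (hmem 0) hmod hM, replaceByClique_free hG.2⟩
  obtain ⟨j₀⟩ : Nonempty (Fin q) := ⟨⟨0, chiOn_pos ⟨_, hmem 0⟩⟩⟩
  have lift : ∀ {I : Type} (p : {v // v ∉ M} ⊕ Fin q → I) (j : Fin q), ∃ p' : V → I,
      (∀ v (hv : v ∉ M), p' v = p (.inl ⟨v, hv⟩)) ∧ ∀ v ∈ M, p' v = p (.inr j) := fun p j =>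
    ⟨fun v => if hv : v ∈ M then p (.inr j) else p (.inl ⟨v, hv⟩), fun v hv => by simp [hv],
      fun v hv => by simp [hv]⟩
  rcases ih _ (by
    rw [← hN, Fintype.card_sum, Fintype.card_fin, Fintype.card_subtype_compl]
    have := Fintype.card_subtype_le (· ∈ M)
    have h2 : Fintype.card {x // x ∈ M} = Fintype.card M := rfl
    omega) _ (replaceByClique G M (c 0) q) rfl hG' with ⟨p, hs, hp⟩ | ⟨p, hs, hp⟩
  · left
    obtain ⟨v₀, hv₀⟩ := hM
    -- In a join the clique may be spread over both sides. The hull is sent to the side of one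
    -- clique vertex `j`, chosen such that neither side becomes empty.
    obtain ⟨j, hj⟩ : ∃ j : Fin q, ∀ i, p (.inr j) = i ∨ ∃ w, p (.inl w) = i := by
      obtain ⟨x, hx⟩ := hs (p (.inl ⟨v₀, hv₀⟩) + 1)
      have h2 : ∀ a b : Fin 2, a = b ∨ a = b + 1 := by decide
      rcases x with x | x
      · refine ⟨j₀, fun i => .inr ?_⟩
        rcases h2 i (p (.inl ⟨v₀, hv₀⟩)) with h | h
        · exact ⟨_, h.symm⟩
        · exact ⟨_, hx.trans h.symm⟩
      · refine ⟨x, fun i => ?_⟩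
        rcases h2 i (p (.inl ⟨v₀, hv₀⟩)) with h | h
        · exact .inr ⟨_, h.symm⟩
        · exact .inl (hx.trans h.symm)
    obtain ⟨p', h1, h2⟩ := lift p j
    refine ⟨p', fun i => ?_, isExpansion_of_replaceByClique hp hmod j h1 h2⟩
    rcases hj i with h | ⟨w, h⟩
    · exact ⟨c 0, (h2 _ (hmem 0)).trans h⟩
    · exact ⟨w.1, (h1 _ w.2).trans h⟩
  · right
    -- In an expansion of $C_5$ the clique lies in one fiber: two adjacent fibers are distinguished
    -- by a third one, whereas the clique vertices have the same neighbors outside the clique.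
    have hconst : ∀ j j', p (.inr j) = p (.inr j') := by
      intro j j'
      by_contra hne
      have h5 : ∀ a b : Fin 5, c5.Adj a b → ∃ l, l ≠ a ∧ l ≠ b ∧ c5.Adj l b ∧ ¬ c5.Adj l a := by
        decide
      have hjj : j ≠ j' := by rintro rfl; exact hne rfl
      obtain ⟨l, hla, hlb, h6, h7⟩ := h5 _ _ ((hp _ _ hne).1 (by simpa using hjj))
      obtain ⟨y, rfl⟩ := hs l
      rw [← hp _ _ hlb] at h6
      rw [← hp _ _ hla] at h7
      rcases y with y | y
      · simp_all
      · rw [replaceByClique_adj_inr_inr] at h7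
        push Not at h7
        exact hla (by rw [h7])
    obtain ⟨p', h1, h2⟩ := lift p j₀
    refine ⟨p', fun i => ?_, isExpansion_of_replaceByClique hp hmod j₀ h1 h2⟩
    obtain ⟨y, rfl⟩ := hs i
    rcases y with y | y
    · exact ⟨y.1, h1 _ y.2⟩
    · exact ⟨c 0, (h2 _ (hmem 0)).trans (hconst _ _)⟩

end P5Graphs

/-! ### Isomorphism classes and finiteness -/

namespace P5Graphs

open SimpleGraph

/-! ### Isomorphism classes -/

/-- The isomorphism class of a finite graph. -/
noncomputable def cls {V : Type} [Finite V] (G : SimpleGraph V) : Quotient isoSetoid :=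
  Quotient.mk isoSetoid ⟨Nat.card V, G.comap (Finite.equivFin V).symm⟩

theorem cls_mk (G : FinGraph) : cls G.2 = Quotient.mk isoSetoid G :=
  Quotient.sound (s := isoSetoid) ⟨Iso.comap (Finite.equivFin (Fin G.1)).symm G.2⟩

theorem cls_eq_iff {V W : Type} [Finite V] [Finite W] {G : SimpleGraph V} {H : SimpleGraph W} :
    cls G = cls H ↔ Nonempty (G ≃g H) := by
  let eG := Iso.comap (Finite.equivFin V).symm G
  let eH := Iso.comap (Finite.equivFin W).symm H
  unfold cls
  rw [Quotient.eq (r := isoSetoid)]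
  exact ⟨fun ⟨e⟩ => ⟨eG.symm.trans (e.trans eH)⟩, fun ⟨e⟩ => ⟨eG.trans (e.trans eH.symm)⟩⟩

theorem cls_mem_C {V : Type} [Finite V] {G : SimpleGraph V} {k : ℕ} (h : IsMember k G) :
    cls G ∈ C k :=
  ⟨_, h.of_iso (Iso.comap (Finite.equivFin V).symm G).symm, rfl⟩

theorem exists_of_mem_C {k : ℕ} {c : Quotient isoSetoid} (h : c ∈ C k) :
    ∃ G : FinGraph, IsMember k G.2 ∧ cls G.2 = c := by
  obtain ⟨G, hG, rfl⟩ := h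
  exact ⟨G, hG, cls_mk G⟩

theorem IsExpansion.iso {V W I : Type} {B : SimpleGraph I} {G : SimpleGraph V} {H : SimpleGraph W}
    {p : V → I} {r : W → I} (hp : IsExpansion B G p) (hr : IsExpansion B H r)
    (e : ∀ i, Nonempty (G.induce {v | p v = i} ≃g H.induce {v | r v = i})) : Nonempty (G ≃g H) := by
  have e := fun i => (e i).some
  have h1 : ∀ i (x : {v | p v = i}), r (e i x).1 = i := fun i x => (e i x).2
  have h2 : ∀ i (x : {v | r v = i}), p ((e i).symm x).1 = i := fun i x => ((e i).symm x).2
  -- Fibers over propositionally equal indices are different types; `c1` and `c2` move between them.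
  have c1 : ∀ i j (h : i = j) x (hi : p x = i) (hj : p x = j), (e i ⟨x, hi⟩).1 = (e j ⟨x, hj⟩).1 := by
    rintro i _ rfl x _ _; rfl
  have c2 : ∀ i j (h : i = j) x (hi : r x = i) (hj : r x = j),
      ((e i).symm ⟨x, hi⟩).1 = ((e j).symm ⟨x, hj⟩).1 := by
    rintro i _ rfl x _ _; rfl
  refine ⟨⟨⟨fun v => (e (p v) ⟨v, rfl⟩).1, fun w => ((e (r w)).symm ⟨w, rfl⟩).1, fun v => ?_,
    fun w => ?_⟩, fun {u v} => ?_⟩⟩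
  · dsimp only
    rw [c2 _ (p v) (h1 (p v) ⟨v, rfl⟩) _ rfl (h1 _ _)]
    simp
  · dsimp only
    rw [c1 _ (r w) (h2 (r w) ⟨w, rfl⟩) _ rfl (h2 _ _)]
    simp
  · simp only [Equiv.coe_fn_mk]
    by_cases h : p u = p v
    · rw [c1 (p u) (p v) h u rfl h]
      exact (e (p v)).map_adj_iff (v := ⟨u, h⟩) (w := ⟨v, rfl⟩)
    · rw [hr _ _ (by rw [h1, h1]; exact h), h1, h1, hp _ _ h]

/-- The classes of the expansions of `B` whose tuple of fibers belongs to `D`. -/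
def expansionClasses {I : Type} (B : SimpleGraph I) (D : Set (I → Quotient isoSetoid)) :
    Set (Quotient isoSetoid) :=
  {c | ∃ (G : FinGraph) (p : Fin G.1 → I), cls G.2 = c ∧ IsExpansion B G.2 p ∧
    (fun i => cls (G.2.induce {v | p v = i})) ∈ D}

/-- An expansion is determined up to isomorphism by the classes of its fibers, so choosing a tuple
for each class is injective. -/
theorem expansionClasses_finite {I : Type} (B : SimpleGraph I) {D : Set (I → Quotient isoSetoid)}
    (hD : D.Finite) :
    (expansionClasses B D).Finite ∧ (expansionClasses B D).ncard ≤ D.ncard := by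
  classical
  have h : ∀ c : Quotient isoSetoid, ∃ t : I → Quotient isoSetoid, c ∈ expansionClasses B D →
      t ∈ D ∧ ∃ (G : FinGraph) (p : Fin G.1 → I), cls G.2 = c ∧ IsExpansion B G.2 p ∧
        t = fun i => cls (G.2.induce {v | p v = i}) := by
    intro c
    by_cases hc : c ∈ expansionClasses B D
    · obtain ⟨G, p, h1, h2, h3⟩ := hc
      exact ⟨_, fun _ => ⟨h3, G, p, h1, h2, rfl⟩⟩
    · exact ⟨fun _ => c, fun h => absurd h hc⟩
  choose t ht using h
  have hmaps : Set.MapsTo t (expansionClasses B D) D := fun c hc => (ht c hc).1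
  have hinj : Set.InjOn t (expansionClasses B D) := by
    intro c hc c' hc' hcc
    obtain ⟨G, p, h1, h2, h3⟩ := (ht c hc).2
    obtain ⟨G', p', h1', h2', h3'⟩ := (ht c' hc').2
    rw [← h1, ← h1', cls_eq_iff]
    refine h2.iso h2' fun i => cls_eq_iff.1 ?_
    rw [h3, h3'] at hcc
    exact congrFun hcc i
  exact ⟨Set.Finite.of_injOn hmaps hinj hD, Set.ncard_le_ncard_of_injOn t hmaps hinj hD⟩

/-- The tuples of classes with prescribed chromatic numbers. -/
def box {I : Type} (w : I → ℕ) : Set (I → Quotient isoSetoid) := {t | ∀ i, t i ∈ C (w i)}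

theorem tuples_finite {I : Type} [Fintype I] [DecidableEq I] {A : I → Set (Quotient isoSetoid)}
    (hA : ∀ i, (A i).Finite) :
    {t : I → Quotient isoSetoid | ∀ i, t i ∈ A i}.Finite ∧
      {t : I → Quotient isoSetoid | ∀ i, t i ∈ A i}.ncard ≤ ∏ i, (A i).ncard := by
  have e : {t : I → Quotient isoSetoid | ∀ i, t i ∈ A i} =
      ↑(Fintype.piFinset fun i => (hA i).toFinset) := by
    ext t; simp
  rw [e]
  refine ⟨Finset.finite_toSet _, ?_⟩
  rw [Set.ncard_coe_finset, Fintype.card_piFinset]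
  exact le_of_eq (Finset.prod_congr rfl fun i _ => (Set.ncard_eq_toFinset_card _ _).symm)

theorem C_zero : (C 0).Finite ∧ (C 0).ncard ≤ 1 := by
  have : (C 0).Subsingleton := by
    intro c hc c' hc'
    obtain ⟨G, hG, rfl⟩ := exists_of_mem_C hc
    obtain ⟨H, hH, rfl⟩ := exists_of_mem_C hc'
    have h1 : IsEmpty (Fin G.1) := chromaticNumber_eq_zero_iff.1 hG.1.1
    have h2 : IsEmpty (Fin H.1) := chromaticNumber_eq_zero_iff.1 hH.1.1
    exact cls_eq_iff.2 ⟨⟨Equiv.equivOfIsEmpty _ _, fun {a} => h1.elim a⟩⟩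
  have hfin := this.finite.to_subtype
  exact ⟨this.finite, Set.ncard_le_one_iff_subsingleton.2 this⟩

theorem C_one : (C 1).Finite ∧ (C 1).ncard ≤ 1 := by
  have key : ∀ G : FinGraph, IsMember 1 G.2 → ∃ v : Fin G.1, ∀ u, u = v := by
    intro G hG
    obtain ⟨h1, h2⟩ := (isCritical_succ_iff (n := 0)).1 hG.1
    rw [colorable_zero_iff, not_isEmpty_iff] at h1
    obtain ⟨v⟩ := h1
    refine ⟨v, fun u => ?_⟩
    by_contra h
    exact (colorable_zero_iff.1 (h2 v)).elim ⟨u, h⟩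
  have : (C 1).Subsingleton := by
    intro c hc c' hc'
    obtain ⟨G, hG, rfl⟩ := exists_of_mem_C hc
    obtain ⟨H, hH, rfl⟩ := exists_of_mem_C hc'
    obtain ⟨v, hv⟩ := key G hG
    obtain ⟨w, hw⟩ := key H hH
    refine cls_eq_iff.2 ⟨⟨⟨fun _ => w, fun _ => v, fun u => (hv u).symm, fun u => (hw u).symm⟩,
      fun {a b} => ?_⟩⟩
    rw [hv a, hv b]
    simp
  have hfin := this.finite.to_subtype
  exact ⟨this.finite, Set.ncard_le_one_iff_subsingleton.2 this⟩

/-! ### Weights of critical expansions -/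

/-- The weights `w` are those after deletion of a vertex in the fiber over `i`: that entry drops by
at most one, and the others stay the same. -/
theorem IsExpansion.hasColorSets_of_isCritical {V I : Type} [Finite V] {B : SimpleGraph I}
    {G : SimpleGraph V} {p : V → I} (hp : IsExpansion B G p) (hs : Function.Surjective p) {k : ℕ}
    (hG : IsCritical (k + 1) G) :
    ¬ HasColorSets B k (fun i => chiOn G {v | p v = i}) ∧
      ∀ i, ∃ w : I → ℕ, HasColorSets B k w ∧ chiOn G {v | p v = i} ≤ w i + 1 ∧
        ∀ j, j ≠ i → w j = chiOn G {v | p v = j} := by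
  rw [isCritical_iff_univ, isCritical_induce_succ_iff] at hG
  constructor
  · have := hG.1
    rw [← not_le, hp.chiOn_le_iff] at this
    simpa using this
  · intro i
    obtain ⟨v, rfl⟩ := hs i
    refine ⟨_, (hp.chiOn_le_iff _ _).1 (hG.2 v trivial), ?_, fun j hj => ?_⟩
    · rw [show (Set.univ \ {v}) ∩ {x | p x = p v} = {x | p x = p v} \ {v} by ext; simp; tauto]
      exact chiOn_le_succ _ _
    · congr 1
      ext x
      simp only [Set.mem_inter_iff, Set.mem_sdiff, Set.mem_univ, true_and, Set.mem_singleton_iff,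
        Set.mem_ofPred_eq, and_iff_right_iff_imp]
      rintro rfl rfl
      exact hj rfl

theorem IsExpansion.weights_top {V : Type} [Finite V] {G : SimpleGraph V} {p : V → Fin 2}
    (hp : IsExpansion ⊤ G p) (hs : Function.Surjective p) {k : ℕ} (hG : IsCritical (k + 1) G) :
    chiOn G {v | p v = 0} + chiOn G {v | p v = 1} = k + 1 := by
  obtain ⟨h1, h2⟩ := hp.hasColorSets_of_isCritical hs hG
  rw [hasColorSets_top_iff] at h1
  obtain ⟨w, hw, h3, h4⟩ := h2 0
  rw [hasColorSets_top_iff] at hw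
  have := h4 1 (by decide)
  omega

/-- Deleting a vertex off an edge leaves the weight of the edge unchanged, so every edge satisfies
the bound for `k` colors. Hence the total is what obstructs `k` colors; as one deletion removes the
obstruction, the total exceeds `2 * k` by exactly one. -/
theorem IsExpansion.weights_c5 {V : Type} [Finite V] {G : SimpleGraph V} {p : V → Fin 5}
    (hp : IsExpansion c5 G p) (hs : Function.Surjective p) {k : ℕ} (hG : IsCritical (k + 1) G) :
    (∀ i, chiOn G {v | p v = i} + chiOn G {v | p v = i + 1} ≤ k) ∧
      ∑ i, chiOn G {v | p v = i} = 2 * k + 1 := by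
  obtain ⟨h1, h2⟩ := hp.hasColorSets_of_isCritical hs hG
  rw [hasColorSets_c5_iff] at h1
  have h3 : ∀ i, chiOn G {v | p v = i} + chiOn G {v | p v = i + 1} ≤ k := by
    intro i
    obtain ⟨w, hw, -, h4⟩ := h2 (i + 2)
    rw [hasColorSets_c5_iff] at hw
    have hne : ∀ i : Fin 5, i ≠ i + 2 ∧ i + 1 ≠ i + 2 := by decide
    rw [← h4 i (hne i).1, ← h4 (i + 1) (hne i).2]
    exact hw.1 i
  refine ⟨h3, le_antisymm ?_ ?_⟩
  · obtain ⟨w, hw, h5, h4⟩ := h2 0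
    rw [hasColorSets_c5_iff] at hw
    have := hw.2
    simp only [Fin.sum_univ_five] at this ⊢
    rw [h4 1 (by decide), h4 2 (by decide), h4 3 (by decide), h4 4 (by decide)] at this
    omega
  · by_contra hc
    exact h1 ⟨h3, by omega⟩

/-- The set `D` has to contain only one tuple for each expansion of $C_5$, for an arrangement of the
fibers that may be chosen; the count later uses this freedom. -/
theorem C_subset {k : ℕ} (hk : 1 ≤ k) {D : Set (Fin 5 → Quotient isoSetoid)}
    (hD : ∀ (G : FinGraph) (p : Fin G.1 → Fin 5), IsExpansion c5 G.2 p → Function.Surjective p →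
      IsMember (k + 1) G.2 → ∃ p' : Fin G.1 → Fin 5, IsExpansion c5 G.2 p' ∧
        (fun i => cls (G.2.induce {v | p' v = i})) ∈ D) :
    C (k + 1) ⊆ (⋃ i ∈ Finset.Icc 1 k, expansionClasses ⊤ (box ![i, k + 1 - i])) ∪
      expansionClasses c5 D := by
  intro c hc
  obtain ⟨G, hG, rfl⟩ := exists_of_mem_C hc
  rcases IsMember.exists_expansion hk _ _ G.2 rfl hG with ⟨p, hs, hp⟩ | ⟨p, hs, hp⟩
  · left
    have hsum := hp.weights_top hs hG.1
    have h0 := hp.fiber_critical hs hG.1 0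
    have h1 := hp.fiber_critical hs hG.1 1
    simp only [Set.mem_iUnion]
    refine ⟨chiOn G.2 {v | p v = 0}, Finset.mem_Icc.2 ⟨h0.1, by omega⟩, G, p, rfl, hp, ?_⟩
    intro i
    fin_cases i
    · exact cls_mem_C ⟨h0.2, hG.2.induce _⟩
    · simp only [Fin.mk_one, Matrix.cons_val_one, Matrix.cons_val_fin_one]
      rw [show k + 1 - chiOn G.2 {v | p v = 0} = chiOn G.2 {v | p v = 1} by omega]
      exact cls_mem_C ⟨h1.2, hG.2.induce _⟩
  · right
    obtain ⟨p', hp', h⟩ := hD G p hp hs hG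
    exact ⟨G, p', rfl, hp', h⟩

theorem C_finite (k : ℕ) : (C k).Finite := by
  induction k using Nat.strong_induction_on with
  | _ k ih =>
  match k, ih with
  | 0, _ => exact C_zero.1
  | 1, _ => exact C_one.1
  | k + 2, ih =>
    -- For finiteness it is enough that all fibers have smaller chromatic number.
    let U : Set (Quotient isoSetoid) := ⋃ j ∈ Finset.range (k + 2), C j
    have hU : U.Finite := Set.Finite.biUnion (Finset.finite_toSet _) fun j hj =>
      ih j (Finset.mem_range.1 hj)
    refine Set.Finite.subset ?_ (C_subset (k := k + 1) (by omega) (D := {t | ∀ i, t i ∈ U})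
      fun G p hp hs hG => ⟨p, hp, fun i => ?_⟩)
    · refine Set.Finite.union (Set.Finite.biUnion (Finset.finite_toSet _) fun i hi => ?_)
        (expansionClasses_finite _ (tuples_finite fun _ => hU).1).1
      refine (expansionClasses_finite _ (tuples_finite fun j => ?_).1).1
      have := Finset.mem_Icc.1 hi
      fin_cases j
      · exact ih _ (by simp; omega)
      · exact ih _ (by simp; omega)
    · have hf := hp.fiber_critical hs hG.1
      have hw := (hp.weights_c5 hs hG.1).1 i
      have h1 := (hf i).1
      have h2 := (hf (i + 1)).1
      simp only [U, Set.mem_iUnion]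
      exact ⟨chiOn G.2 {v | p v = i}, Finset.mem_range.2 (by omega),
        cls_mem_C ⟨(hf i).2, hG.2.induce _⟩⟩

theorem box_finite {I : Type} [Fintype I] [DecidableEq I] (w : I → ℕ) :
    (box w).Finite ∧ (box w).ncard ≤ ∏ i, f (w i) :=
  tuples_finite fun i => C_finite (w i)

/-- The isomorphism classes that are expansions of `C₅`, bounded through a suitable choice of the
order of the fibers. -/
theorem f_succ_le {k : ℕ} (hk : 1 ≤ k) {D : Set (Fin 5 → Quotient isoSetoid)} (hfin : D.Finite)
    (hD : ∀ (G : FinGraph) (p : Fin G.1 → Fin 5), IsExpansion c5 G.2 p → Function.Surjective p →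
      IsMember (k + 1) G.2 → ∃ p' : Fin G.1 → Fin 5, IsExpansion c5 G.2 p' ∧
        (fun i => cls (G.2.induce {v | p' v = i})) ∈ D) :
    f (k + 1) ≤ ∑ i ∈ Finset.Icc 1 k, f i * f (k + 1 - i) + D.ncard := by
  have hb : ∀ i, (expansionClasses ⊤ (box ![i, k + 1 - i])).Finite := fun i =>
    (expansionClasses_finite _ (box_finite _).1).1
  refine (Set.ncard_le_ncard (C_subset hk hD) (Set.Finite.union (Set.Finite.biUnion
    (Finset.finite_toSet _) fun i _ => hb i) (expansionClasses_finite _ hfin).1)).trans ?_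
  refine (Set.ncard_union_le _ _).trans (Nat.add_le_add ?_ (expansionClasses_finite _ hfin).2)
  refine (Finset.set_ncard_biUnion_le _ _).trans (Finset.sum_le_sum fun i _ => ?_)
  refine ((expansionClasses_finite _ (box_finite _).1).2.trans (box_finite _).2).trans ?_
  simp [Fin.prod_univ_two]

end P5Graphs

/-! ### Construction of critical graphs and lower bounds for their number -/

namespace P5Graphs

open SimpleGraph

/-! ### Constructing expansions -/

/-- The graph obtained from `B` by substituting `H i` for the vertex `i`. -/
def expand {I : Type} (B : SimpleGraph I) (H : I → FinGraph) : SimpleGraph (Σ i, Fin (H i).1) where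
  Adj x y := B.Adj x.1 y.1 ∨ ∃ i a b, x = ⟨i, a⟩ ∧ y = ⟨i, b⟩ ∧ (H i).2.Adj a b
  symm := ⟨fun _ _ h => h.imp (fun h => h.symm) fun ⟨i, a, b, h1, h2, h3⟩ => ⟨i, b, a, h2, h1, h3.symm⟩⟩
  loopless := ⟨fun x h => h.elim (fun h => B.loopless.irrefl _ h) fun ⟨i, a, b, h1, h2, h3⟩ => by
    obtain rfl : a = b := by simpa using h1.symm.trans h2
    exact (H i).2.loopless.irrefl _ h3⟩

theorem isExpansion_expand {I : Type} (B : SimpleGraph I) (H : I → FinGraph) :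
    IsExpansion B (expand B H) Sigma.fst := by
  intro u v huv
  refine ⟨fun h => h.resolve_right ?_, .inl⟩
  rintro ⟨i, a, b, rfl, rfl, -⟩
  exact huv rfl

theorem expand_fiber {I : Type} (B : SimpleGraph I) (H : I → FinGraph) (i : I) :
    Nonempty ((H i).2 ≃g (expand B H).induce {v | v.1 = i}) := by
  refine ⟨⟨Equiv.ofBijective (fun a => ⟨⟨i, a⟩, rfl⟩) ⟨fun a b hab => ?_, ?_⟩, fun {a b} => ?_⟩⟩
  · simpa using hab
  · rintro ⟨⟨j, a⟩, h⟩
    obtain rfl : j = i := h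
    exact ⟨a, rfl⟩
  · simp only [comap_adj, Function.Embedding.subtype_apply]
    constructor
    · rintro (h | ⟨j, a', b', h1, h2, h3⟩)
      · exact absurd h (B.loopless.irrefl _)
      · cases h1; cases h2; exact h3
    · exact fun h => .inr ⟨i, a, b, rfl, rfl, h⟩

/-- Two vertices of a copy in one fiber generate a module of the pattern, which must be everything;
otherwise the copy projects to `B`. -/
theorem IsExpansion.isP5CoP5Free {V I : Type} {B : SimpleGraph I} {G : SimpleGraph V} {p : V → I}
    (hp : IsExpansion B G p) (hB : IsP5CoP5Free B)
    (hf : ∀ i, IsP5CoP5Free (G.induce {v | p v = i})) : IsP5CoP5Free G := by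
  classical
  simp only [isP5CoP5Free_iff] at hf hB ⊢
  rintro X hX ⟨g⟩
  have hpat : IsPattern X := by rcases hX with rfl | rfl; exacts [isPattern_p5, isPattern_p5_compl]
  by_cases h : ∃ i j, i ≠ j ∧ p (g i) = p (g j)
  · obtain ⟨i, j, hij, he⟩ := h
    have := hpat.2.2 (fun l => decide (p (g l) = p (g j))) (fun a b l ha hb hl => by
      simp only [decide_eq_true_eq, decide_eq_false_iff_not] at ha hb hl
      rw [← g.map_adj_iff, ← g.map_adj_iff, hp _ _ (by rwa [ha]), hp _ _ (by rwa [hb]), ha, hb])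
      i j (by simpa) (by simp) hij
    simp only [decide_eq_true_eq] at this
    exact hf (p (g j)) X hX (hpat.isIndContained (fun l => ⟨g l, this l⟩) fun a b => by simp)
  · push Not at h
    refine hB X hX (hpat.isIndContained (fun l => p (g l)) fun a b => ?_)
    by_cases hab : a = b
    · simp [hab]
    · rw [← hp _ _ (h a b hab), g.map_adj_iff]

/-- An embedding between graphs on five vertices is onto. The end `0` of the path has only one
neighbor, but every vertex of $C_5$ has two neighbors and two non-neighbors. -/
theorem isP5CoP5Free_c5 : IsP5CoP5Free c5 := by
  rw [isP5CoP5Free_iff]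
  have h5 : ∀ i : Fin 5, i + 1 ≠ i + 4 ∧ c5.Adj i (i + 1) ∧ c5.Adj i (i + 4) ∧ i + 2 ≠ i + 3 ∧
      i ≠ i + 2 ∧ i ≠ i + 3 ∧ ¬ c5.Adj i (i + 2) ∧ ¬ c5.Adj i (i + 3) := by decide
  have h0 : ∀ i j : Fin 5, p5.Adj 0 i → p5.Adj 0 j → i = j := by decide
  rintro X (rfl | rfl) ⟨g⟩
  · have hs := Finite.surjective_of_injective g.injective
    obtain ⟨a, ha⟩ := hs (g 0 + 1)
    obtain ⟨b, hb⟩ := hs (g 0 + 4)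
    obtain ⟨h1, h2, h3, -⟩ := h5 (g 0)
    rw [← ha, g.map_adj_iff] at h2
    rw [← hb, g.map_adj_iff] at h3
    rw [← ha, ← hb, h0 a b h2 h3] at h1
    exact h1 rfl
  · have hs := Finite.surjective_of_injective g.injective
    obtain ⟨a, ha⟩ := hs (g 0 + 2)
    obtain ⟨b, hb⟩ := hs (g 0 + 3)
    obtain ⟨-, -, -, h1, h2, h3, h4, h5⟩ := h5 (g 0)
    rw [← ha, g.map_adj_iff, compl_adj] at h4
    rw [← hb, g.map_adj_iff, compl_adj] at h5
    rw [← ha] at h2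
    rw [← hb] at h3
    have e1 : p5.Adj 0 a := by by_contra h; exact h4 ⟨fun e => h2 (by rw [← e]), h⟩
    have e2 : p5.Adj 0 b := by by_contra h; exact h5 ⟨fun e => h3 (by rw [← e]), h⟩
    rw [← ha, ← hb, h0 a b e1 e2] at h1
    exact h1 rfl

/-- The class obtained from `B` by substituting representatives of the classes `t i`. -/
noncomputable def expandCls {I : Type} [Finite I] (B : SimpleGraph I)
    (t : I → Quotient isoSetoid) : Quotient isoSetoid :=
  cls (expand B fun i => (t i).out)

theorem cls_expand_fiber {I : Type} [Finite I] (B : SimpleGraph I) (t : I → Quotient isoSetoid)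
    (i : I) : cls ((expand B fun i => (t i).out).induce {v | v.1 = i}) = t i := by
  obtain ⟨e⟩ := expand_fiber B (fun i => (t i).out) i
  rw [← cls_eq_iff.2 ⟨e⟩, cls_mk, Quotient.out_eq]

theorem isMember_of_cls_mem {V : Type} [Finite V] {G : SimpleGraph V} {k : ℕ} (h : cls G ∈ C k) :
    IsMember k G := by
  obtain ⟨H, hH, he⟩ := exists_of_mem_C h
  obtain ⟨e⟩ := cls_eq_iff.1 he
  exact hH.of_iso e

theorem expandCls_mem {I : Type} [Finite I] {B : SimpleGraph I} (hB : IsP5CoP5Free B) {k : ℕ}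
    {w : I → ℕ} {t : I → Quotient isoSetoid} (ht : ∀ i, 0 < w i ∧ t i ∈ C (w i))
    (h : ¬ HasColorSets B k w)
    (h' : ∀ i, ∀ w' : I → ℕ, w' i < w i → (∀ j, w' j ≤ w j) → HasColorSets B k w') :
    expandCls B t ∈ C (k + 1) := by
  have hm : ∀ i, IsMember (w i) ((expand B fun i => (t i).out).induce {v | v.1 = i}) := fun i =>
    isMember_of_cls_mem (by rw [cls_expand_fiber]; exact (ht i).2)
  have hp := isExpansion_expand B fun i => (t i).out
  exact cls_mem_C ⟨hp.isCritical (fun i => ⟨(ht i).1, (hm i).1⟩) h h',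
    hp.isP5CoP5Free hB fun i => (hm i).2⟩

theorem fst_surjective_of_mem_C {I : Type} {w : I → ℕ} {t : I → Quotient isoSetoid}
    (ht : ∀ i, 0 < w i ∧ t i ∈ C (w i)) :
    Function.Surjective (Sigma.fst : (Σ i, Fin (t i).out.1) → I) := by
  intro i
  have hm : IsMember (w i) (t i).out.2 :=
    isMember_of_cls_mem (by rw [cls_mk, Quotient.out_eq]; exact (ht i).2)
  by_contra hc
  have : IsEmpty (Fin (t i).out.1) := ⟨fun a => hc ⟨⟨i, a⟩, rfl⟩⟩
  have h0 := hm.1.1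
  rw [chromaticNumber_eq_zero_iff.2 this] at h0
  have := (ht i).1
  have h1 : w i = 0 := by exact_mod_cast h0.symm
  omega

theorem isMember_top (a : ℕ) : IsMember a (⊤ : SimpleGraph (Fin a)) := by
  refine ⟨?_, isP5CoP5Free_of_forall_adj fun u v h => h⟩
  cases a with
  | zero =>
    refine ⟨by simp, fun s hs => ?_⟩
    exact absurd (Subsingleton.elim _ _) hs
  | succ n =>
    rw [isCritical_succ_iff]
    refine ⟨fun h => by have := not_colorable_top h; omega, fun v => ?_⟩
    have := colorable_of_fintype ((⊤ : SimpleGraph (Fin (n + 1))).induce {v}ᶜ)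
    refine this.mono ?_
    rw [Fintype.card_compl_set]
    simp

theorem induce_iso_of_iso {V W : Type*} {G : SimpleGraph V} {H : SimpleGraph W} (e : G ≃g H)
    {s : Set V} {t : Set W} (h : ∀ x, x ∈ s ↔ e x ∈ t) : Nonempty (G.induce s ≃g H.induce t) :=
  ⟨⟨e.toEquiv.subtypeEquiv h, e.map_adj_iff⟩⟩

/-- Swapping two universal vertices is an automorphism. -/
theorem induce_compl_iso_of_universal {V : Type*} {G : SimpleGraph V} {u u' : V}
    (hu : ∀ v, v ≠ u → G.Adj u v) (hu' : ∀ v, v ≠ u' → G.Adj u' v) :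
    Nonempty (G.induce {u}ᶜ ≃g G.induce {u'}ᶜ) := by
  classical
  have hsw : ∀ x y, G.Adj (Equiv.swap u u' x) (Equiv.swap u u' y) ↔ G.Adj x y := by
    intro x y
    have a1 : ∀ v, v ≠ u → G.Adj v u := fun v h => (hu v h).symm
    have a2 : ∀ v, v ≠ u' → G.Adj v u' := fun v h => (hu' v h).symm
    simp only [Equiv.swap_apply_def]
    split_ifs <;> subst_vars <;> simp_all
  refine induce_iso_of_iso (e := ⟨Equiv.swap u u', fun {x y} => hsw x y⟩) fun x => ?_
  simp only [Set.mem_compl_iff, Set.mem_singleton_iff, RelIso.coe_fn_mk]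
  rw [Equiv.swap_apply_eq_iff, Equiv.swap_apply_right]

/-- The fibers of an expansion of `C₅` are determined up to a permutation. -/
theorem IsExpansion.c5_unique {V : Type*} {G : SimpleGraph V} {p r : V → Fin 5}
    (hp : IsExpansion c5 G p) (hr : IsExpansion c5 G r) (hps : Function.Surjective p)
    (hrs : Function.Surjective r) : ∃ τ : Equiv.Perm (Fin 5), ∀ v, r v = τ (p v) := by
  classical
  -- A transversal of `p` induces $C_5$, and the fibers of `r` cut modules out of it. As $C_5$ is
  -- prime, `r` is constant or injective on it.
  have key : ∀ c : Fin 5 → V, (∀ i, p (c i) = i) → (∀ i j, r (c i) = r (c j)) ∨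
      Function.Injective fun i => r (c i) := by
    intro c hc
    by_cases h : ∃ i j, i ≠ j ∧ r (c i) = r (c j)
    · left
      obtain ⟨i, j, hij, he⟩ := h
      have hadj : ∀ a b, G.Adj (c a) (c b) ↔ c5.Adj a b := by
        intro a b
        by_cases hab : a = b
        · simp [hab]
        · rw [hp _ _ (by rwa [hc, hc]), hc, hc]
      have := isPattern_c5.2.2 (fun l => decide (r (c l) = r (c j))) (fun a b l ha hb hl => by
        simp only [decide_eq_true_eq, decide_eq_false_iff_not] at ha hb hl
        rw [← hadj, ← hadj, hr _ _ (by rwa [ha]), hr _ _ (by rwa [hb]), ha, hb])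
        i j (by simpa) (by simp) hij
      simp only [decide_eq_true_eq] at this
      intro a b
      rw [this a, this b]
    · right
      push Not at h
      intro i j hij
      by_contra hne
      exact h i j hne hij
  have hupd : ∀ (c : Fin 5 → V) (v : V), (∀ i, p (c i) = i) →
      ∀ i, p (Function.update c (p v) v i) = i := by
    intro c v hc i
    by_cases hi : i = p v
    · subst hi; simp
    · simp [hi, hc]
  choose c hc using hps
  have hinj : Function.Injective fun i => r (c i) := by
    refine (key c hc).resolve_left fun hconst => ?_
    have hall : ∀ v, r v = r (c 0) := by
      intro v
      have e2 : ∀ i : Fin 5, ∃ a b, a ≠ i ∧ b ≠ i ∧ a ≠ b := by decide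
      obtain ⟨a, b, ha, hb, hab⟩ := e2 (p v)
      rcases key _ (hupd c v hc) with h | h
      · have := h (p v) a
        simp only [Function.update_self, Function.update_of_ne ha] at this
        rw [this, hconst a 0]
      · exact absurd (@h a b (by simp [Function.update_of_ne ha, Function.update_of_ne hb, hconst a b]))
          hab
    obtain ⟨v, hv⟩ := hrs (r (c 0) + 1)
    rw [hall v] at hv
    have : ∀ i : Fin 5, i ≠ i + 1 := by decide
    exact this _ hv
  refine ⟨Equiv.ofBijective _ (Finite.injective_iff_bijective.1 hinj), fun v => ?_⟩
  simp only [Equiv.ofBijective_apply]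
  -- Exchanging `v` into the transversal leaves four distinct values of `r`, so `r` stays injective
  -- and `v` receives the one remaining value.
  have hinj' : Function.Injective fun i => r (Function.update c (p v) v i) := by
    refine (key _ (hupd c v hc)).resolve_left fun hconst => ?_
    have e2 : ∀ i : Fin 5, ∃ a b, a ≠ i ∧ b ≠ i ∧ a ≠ b := by decide
    obtain ⟨a, b, ha, hb, hab⟩ := e2 (p v)
    have := hconst a b
    rw [Function.update_of_ne ha, Function.update_of_ne hb] at this
    exact hab (hinj this)
  obtain ⟨i, hi⟩ := (Finite.injective_iff_surjective.1 hinj) (r v)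
  simp only at hi
  by_cases h : i = p v
  · rw [← hi, h]
  · have := @hinj' i (p v) (by simp [Function.update_of_ne h, hi])
    exact absurd this h

theorem expandCls_c5_inj {w w' : Fin 5 → ℕ} {t t' : Fin 5 → Quotient isoSetoid}
    (ht : ∀ i, 0 < w i ∧ t i ∈ C (w i)) (ht' : ∀ i, 0 < w' i ∧ t' i ∈ C (w' i))
    (h : expandCls c5 t = expandCls c5 t') : ∃ τ : Equiv.Perm (Fin 5), ∀ i, t i = t' (τ i) := by
  obtain ⟨e⟩ := cls_eq_iff.1 h
  have hr : IsExpansion c5 (expand c5 fun i => (t i).out) fun v => (e v).1 := fun u v huv => by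
    rw [← e.map_adj_iff, isExpansion_expand c5 _ _ _ huv]
  obtain ⟨τ, hτ⟩ := (isExpansion_expand c5 fun i => (t i).out).c5_unique hr
    (fst_surjective_of_mem_C ht) ((fst_surjective_of_mem_C ht').comp e.surjective)
  refine ⟨τ, fun i => ?_⟩
  rw [← cls_expand_fiber c5 t i, ← cls_expand_fiber c5 t' (τ i)]
  refine cls_eq_iff.2 (induce_iso_of_iso e fun x => ?_)
  simp only [Set.mem_ofPred_eq]
  rw [hτ, τ.apply_eq_iff_eq]

theorem exists_universal_expandCls_top {t : Fin 2 → Quotient isoSetoid}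
    (h : t 1 = cls (⊤ : SimpleGraph (Fin 1))) :
    ∃ u, (∀ v, v ≠ u → (expand ⊤ fun i => (t i).out).Adj u v) ∧
      cls ((expand ⊤ fun i => (t i).out).induce {u}ᶜ) = t 0 := by
  have h1 := cls_expand_fiber ⊤ t 1
  rw [h] at h1
  obtain ⟨e⟩ := cls_eq_iff.1 h1
  have hu : ∀ v : (Σ i, Fin (t i).out.1), v.1 = 1 ↔ v = (e.symm 0).1 := by
    intro v
    constructor
    · intro hv
      have : e ⟨v, hv⟩ = 0 := Subsingleton.elim _ _
      rw [← this, e.symm_apply_apply]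
    · rintro rfl
      exact (e.symm 0).2
  refine ⟨(e.symm 0).1, fun v hv => ?_, ?_⟩
  · have e1 : ((e.symm 0).1).1 = 1 := (e.symm 0).2
    rw [isExpansion_expand ⊤ _ _ _ (by rw [e1]; exact fun h => hv ((hu v).1 h.symm)), e1, top_adj]
    exact fun h => hv ((hu v).1 h.symm)
  · rw [show ({(e.symm 0).1}ᶜ : Set (Σ i, Fin (t i).out.1)) = {v | v.1 = 0} by
      ext v
      simp only [Set.mem_compl_iff, Set.mem_singleton_iff, Set.mem_ofPred_eq]
      rw [← hu]
      omega]
    exact cls_expand_fiber ⊤ t 0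

/-- Two injections with disjoint images: `φ` adds a universal vertex, and `ψ` expands $C_5$ with
weights $(j+1,1,1,j+1,1)$, whose sum is $2(j+2)+1$. The argument is recovered by deleting a
universal vertex, or from the multiset of fibers. An expansion of $C_5$ with nonempty fibers has no
universal vertex. -/
theorem f_add_le (j : ℕ) : f (j + 2) + f (j + 1) ≤ f (j + 3) := by
  have one : cls (⊤ : SimpleGraph (Fin 1)) ∈ C 1 := cls_mem_C (isMember_top 1)
  have big : cls (⊤ : SimpleGraph (Fin (j + 1))) ∈ C (j + 1) := cls_mem_C (isMember_top _)
  let φ : Quotient isoSetoid → Quotient isoSetoid := fun c =>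
    expandCls (⊤ : SimpleGraph (Fin 2)) ![c, cls (⊤ : SimpleGraph (Fin 1))]
  let ψ : Quotient isoSetoid → Quotient isoSetoid := fun c =>
    expandCls c5 ![c, cls (⊤ : SimpleGraph (Fin 1)), cls (⊤ : SimpleGraph (Fin 1)),
      cls (⊤ : SimpleGraph (Fin (j + 1))), cls (⊤ : SimpleGraph (Fin 1))]
  have hw : ∀ c ∈ C (j + 1), ∀ i, 0 < (![j + 1, 1, 1, j + 1, 1] : Fin 5 → ℕ) i ∧
      (![c, cls (⊤ : SimpleGraph (Fin 1)), cls (⊤ : SimpleGraph (Fin 1)),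
      cls (⊤ : SimpleGraph (Fin (j + 1))), cls (⊤ : SimpleGraph (Fin 1))] :
        Fin 5 → Quotient isoSetoid) i ∈ C ((![j + 1, 1, 1, j + 1, 1] : Fin 5 → ℕ) i) := by
    intro c hc i
    fin_cases i
    exacts [⟨by simp, hc⟩, ⟨by simp, one⟩, ⟨by simp, one⟩, ⟨by simp, big⟩, ⟨by simp, one⟩]
  have hφ : Set.MapsTo φ (C (j + 2)) (C (j + 3)) := by
    intro c hc
    refine expandCls_mem (k := j + 2) (w := ![j + 2, 1]) (isP5CoP5Free_of_forall_adj fun u v h => h)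
      ?_ ?_ ?_
    · intro i
      fin_cases i
      exacts [⟨by simp, hc⟩, ⟨by simp, one⟩]
    · rw [hasColorSets_top_iff]
      simp
    · intro i w' hi hj
      rw [hasColorSets_top_iff]
      have h0 := hj 0
      have h1 := hj 1
      fin_cases i <;> simp at hi h0 h1 <;> omega
  have hψ : Set.MapsTo ψ (C (j + 1)) (C (j + 3)) := by
    intro c hc
    refine expandCls_mem (k := j + 2) isP5CoP5Free_c5 (hw c hc) ?_ ?_
    · rw [hasColorSets_c5_iff]
      simp [Fin.sum_univ_five]
      intros
      omega
    · intro i w' hi hj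
      rw [hasColorSets_c5_iff]
      have h0 := hj 0
      have h1 := hj 1
      have h2 := hj 2
      have h3 := hj 3
      have h4 := hj 4
      simp at h0 h1 h2 h3 h4
      constructor
      · intro i
        fin_cases i <;> simp <;> omega
      · rw [Fin.sum_univ_five]
        fin_cases i <;> simp at hi <;> omega
  have hφi : Set.InjOn φ (C (j + 2)) := by
    intro c _ c' _ h
    obtain ⟨u, h1, h2⟩ := exists_universal_expandCls_top
      (t := ![c, cls (⊤ : SimpleGraph (Fin 1))]) rfl
    obtain ⟨u', h1', h2'⟩ := exists_universal_expandCls_top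
      (t := ![c', cls (⊤ : SimpleGraph (Fin 1))]) rfl
    obtain ⟨e⟩ := cls_eq_iff.1 h
    change _ = c at h2
    change _ = c' at h2'
    rw [← h2, ← h2', cls_eq_iff]
    obtain ⟨e1⟩ := induce_iso_of_iso e (s := {u}ᶜ) (t := {e u}ᶜ) (by simp)
    obtain ⟨e2⟩ := induce_compl_iso_of_universal (u := e u) (u' := u') (fun v hv => by
      rw [← e.apply_symm_apply v, e.map_adj_iff]
      exact h1 _ (by rintro rfl; simp at hv)) h1'
    exact ⟨e1.trans e2⟩
  have hψi : Set.InjOn ψ (C (j + 1)) := by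
    intro c hc c' hc' h
    obtain ⟨τ, hτ⟩ := expandCls_c5_inj (hw c hc) (hw c' hc') h
    have := Finset.sum_equiv τ (s := Finset.univ) (t := Finset.univ) (by simp)
      (f := fun i => ({_} : Multiset (Quotient isoSetoid))) (g := fun i => {_})
      (fun i _ => congrArg (fun x => ({x} : Multiset (Quotient isoSetoid))) (hτ i))
    simp only [Fin.sum_univ_five] at this
    simpa using this
  have hd : Disjoint (φ '' C (j + 2)) (ψ '' C (j + 1)) := by
    rw [Set.disjoint_left]
    rintro _ ⟨c, hc, rfl⟩ ⟨c', hc', h⟩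
    obtain ⟨e⟩ := cls_eq_iff.1 h.symm
    obtain ⟨u, h1, -⟩ := exists_universal_expandCls_top
      (t := ![c, cls (⊤ : SimpleGraph (Fin 1))]) rfl
    obtain ⟨v, hv⟩ := fst_surjective_of_mem_C (hw c' hc') ((e u).1 + 2)
    have e5 : ∀ i : Fin 5, i ≠ i + 2 ∧ ¬ c5.Adj i (i + 2) := by decide
    have hne : (e u).1 ≠ v.1 := by rw [hv]; exact (e5 _).1
    have hadj : (expand c5 _).Adj (e u) v := by
      rw [← e.apply_symm_apply v, e.map_adj_iff]
      exact h1 _ (by rintro h; apply hne; rw [← h, e.apply_symm_apply])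
    rw [isExpansion_expand c5 _ _ _ hne, hv] at hadj
    exact (e5 _).2 hadj
  rw [f, f, ← hφi.ncard_image, ← hψi.ncard_image,
    ← Set.ncard_union_eq hd ((C_finite _).image _) ((C_finite _).image _)]
  exact Set.ncard_le_ncard (Set.union_subset hφ.image_subset hψ.image_subset) (C_finite _)

theorem f_one : f 1 = 1 :=
  le_antisymm C_one.2 ((Set.ncard_pos (C_finite 1)).2 ⟨_, cls_mem_C (isMember_top 1)⟩)

theorem f_pos (k : ℕ) : 0 < f k :=
  (Set.ncard_pos (C_finite k)).2 ⟨_, cls_mem_C (isMember_top k)⟩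

end P5Graphs

/-! ### The recursive bound and the tower bound -/

namespace P5Graphs

open SimpleGraph

/-! ### Counting the expansions of `C₅` -/

/-- The weights of an expansion of $C_5$ would be five positive numbers with sum 3. -/
theorem f_two : f 2 = 1 := by
  refine le_antisymm ?_ (f_pos 2)
  refine (f_succ_le le_rfl (D := ∅) Set.finite_empty fun G p hp hs hG => ?_).trans ?_
  · have h1 := (hp.weights_c5 hs hG.1).2
    have h2 := fun i => (hp.fiber_critical hs hG.1 i).1
    rw [Fin.sum_univ_five] at h1
    have := h2 0; have := h2 1; have := h2 2; have := h2 3; have := h2 4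
    omega
  · simp [f_one]

theorem f_mono {a b : ℕ} (ha : 1 ≤ a) (hab : a ≤ b) : f a ≤ f b := by
  induction b, hab using Nat.le_induction with
  | base => rfl
  | succ b hb ih =>
    refine ih.trans ?_
    match b, ha.trans hb with
    | 1, _ => rw [f_one, f_two]
    | b + 2, _ => exact (Nat.le_add_right _ _).trans (f_add_le b)

/-- The telescoped form of `f_add_le`, as for Fibonacci numbers. -/
theorem sum_f_lt (n : ℕ) : ∑ j ∈ Finset.Icc 1 n, f j + 1 ≤ f (n + 2) := by
  induction n with
  | zero => simp [f_two]
  | succ n ih =>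
    rw [Finset.sum_Icc_succ_top (by omega)]
    have := f_add_le n
    simp only [Nat.add_assoc, Nat.reduceAdd] at this ih ⊢
    omega

/-- The weights that occur in a normalized critical expansion of `C₅`. -/
def IsNormalWeight (m : ℕ) (w : Fin 5 → ℕ) : Prop :=
  (2 ≤ m ∧ ∀ i, 1 ≤ w i ∧ w i ≤ m - 1) ∨
  (∃ j ∈ Finset.Icc 1 (m / 2 + 1), w = ![m + 1, 1, j, m + 2 - j, 1]) ∨
  (2 ≤ m ∧ ∃ j ∈ Finset.Icc 2 m, w = ![m, 1, j, m + 2 - j, 2]) ∨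
  (2 ≤ m ∧ ∃ j ∈ Finset.Icc 1 m, w = ![m, 2, j, m + 1 - j, 2])

/-- The chromatic number is `m + 3`. If the largest weight is `m + 1`, its neighbors have weight 1;
if it is `m`, they have weights 1 or 2, and not both 1 because the opposite edge would become too
heavy. Reflection orders the remaining weights. -/
theorem isNormalWeight_of_max {m : ℕ} {w : Fin 5 → ℕ} (h1 : ∀ i, 1 ≤ w i)
    (h2 : ∀ i, w i + w (i + 1) ≤ m + 2) (h3 : ∑ i, w i = 2 * m + 5) (h0 : ∀ i, w i ≤ w 0) :
    IsNormalWeight m w ∨ IsNormalWeight m fun i => w (-i) := by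
  have ext5 : ∀ {v v' : Fin 5 → ℕ}, v 0 = v' 0 → v 1 = v' 1 → v 2 = v' 2 → v 3 = v' 3 →
      v 4 = v' 4 → v = v' := by
    intro v v' _ _ _ _ _
    ext i
    fin_cases i <;> assumption
  have n1 : (-1 : Fin 5) = 4 := rfl
  have n2 : (-2 : Fin 5) = 3 := rfl
  have n3 : (-3 : Fin 5) = 2 := rfl
  have n4 : (-4 : Fin 5) = 1 := rfl
  have a0 := h1 0; have a1 := h1 1; have a2 := h1 2; have a3 := h1 3; have a4 := h1 4
  have b0 : w 0 + w 1 ≤ m + 2 := h2 0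
  have b1 : w 1 + w 2 ≤ m + 2 := h2 1
  have b2 : w 2 + w 3 ≤ m + 2 := h2 2
  have b3 : w 3 + w 4 ≤ m + 2 := h2 3
  have b4 : w 4 + w 0 ≤ m + 2 := h2 4
  have c1 := h0 1; have c2 := h0 2; have c3 := h0 3; have c4 := h0 4
  rw [Fin.sum_univ_five] at h3
  by_cases hA : w 0 ≤ m - 1
  · exact .inl (.inl ⟨by omega, fun i => ⟨h1 i, (h0 i).trans hA⟩⟩)
  by_cases hB : w 0 = m + 1
  · rcases le_total (w 2) (w 3) with h | h
    · left; right; left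
      exact ⟨w 2, Finset.mem_Icc.2 (by omega), ext5 hB (by simp; omega) (by simp) (by simp; omega)
        (by simp; omega)⟩
    · right; right; left
      exact ⟨w 3, Finset.mem_Icc.2 (by omega), ext5 (by simpa using hB) (by simp [n1]; omega)
        (by simp [n2]) (by simp [n3]; omega) (by simp [n4]; omega)⟩
  have hC : w 0 = m := by omega
  by_cases hD : w 1 = 2 ∧ w 4 = 2
  · left; right; right; right
    exact ⟨by omega, w 2, Finset.mem_Icc.2 (by omega), ext5 hC (by simp; omega) (by simp)
      (by simp; omega) (by simp; omega)⟩
  by_cases hE : w 1 = 1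
  · left; right; right; left
    exact ⟨by omega, w 2, Finset.mem_Icc.2 (by omega), ext5 hC (by simp; omega) (by simp)
      (by simp; omega) (by simp; omega)⟩
  · right; right; right; left
    exact ⟨by omega, w 3, Finset.mem_Icc.2 (by omega), ext5 (by simpa using hC)
      (by simp [n1]; omega) (by simp [n2]) (by simp [n3]; omega) (by simp [n4]; omega)⟩

/-- A rotation moves the largest weight to the index 0; a reflection may follow. -/
theorem exists_normalWeight {m : ℕ} {w : Fin 5 → ℕ} (h1 : ∀ i, 1 ≤ w i)
    (h2 : ∀ i, w i + w (i + 1) ≤ m + 2) (h3 : ∑ i, w i = 2 * m + 5) :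
    ∃ τ : Equiv.Perm (Fin 5), (∀ i j, c5.Adj (τ i) (τ j) ↔ c5.Adj i j) ∧
      IsNormalWeight m fun i => w (τ i) := by
  obtain ⟨a, ha⟩ := Finite.exists_max w
  have hs : ∑ i, w (a + i) = ∑ i, w i := Equiv.sum_comp (Equiv.addLeft a) w
  rcases isNormalWeight_of_max (w := fun i => w (a + i)) (fun i => h1 _)
    (fun i => by rw [← add_assoc]; exact h2 _) (hs.trans h3) (fun i => by simpa using ha _) with h | h
  · refine ⟨Equiv.addLeft a, ?_, h⟩
    simp only [Equiv.coe_addLeft]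
    clear h hs ha
    decide +revert
  · refine ⟨(Equiv.neg _).trans (Equiv.addLeft a), ?_, h⟩
    simp only [Equiv.trans_apply, Equiv.neg_apply, Equiv.coe_addLeft]
    clear h hs ha
    decide +revert

/-- The tuples of classes that suffice to describe the expansions of `C₅`. -/
def normalTuples (m : ℕ) : Set (Fin 5 → Quotient isoSetoid) :=
  {t | ∃ w, IsNormalWeight m w ∧ t ∈ box w}

theorem biUnion_box_finite {ι : Type} (s : Finset ι) (w : ι → Fin 5 → ℕ) :
    (⋃ j ∈ s, box (w j)).Finite ∧ (⋃ j ∈ s, box (w j)).ncard ≤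
      ∑ j ∈ s, f (w j 0) * f (w j 1) * f (w j 2) * f (w j 3) * f (w j 4) := by
  refine ⟨Set.Finite.biUnion (Finset.finite_toSet _) fun j _ => (box_finite _).1, ?_⟩
  refine (Finset.set_ncard_biUnion_le _ _).trans (Finset.sum_le_sum fun j _ => ?_)
  refine (box_finite _).2.trans (le_of_eq ?_)
  rw [Fin.prod_univ_five]

/-- With `F = a + 1`, the four kinds of weights contribute at most $a^5$, $F^3$, $2a^3$ and $2a^3$
tuples, and $a^5+(a+1)^3+4a^3\le(a+1)^5$. The kinds with small weights are estimated through sums of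
`f`, not by the number of weights times a maximum. -/
theorem normalTuples_finite (m : ℕ) :
    (normalTuples m).Finite ∧ (normalTuples m).ncard ≤ f (m + 1) ^ 5 := by
  set F := f (m + 1) with hF
  have hFpos : 0 < F := f_pos _
  obtain ⟨fB, cB⟩ := biUnion_box_finite (Finset.Icc 1 (m / 2 + 1)) fun j => ![m + 1, 1, j, m + 2 - j, 1]
  have cB' : (⋃ j ∈ Finset.Icc 1 (m / 2 + 1), box ![m + 1, 1, j, m + 2 - j, 1]).ncard ≤ F ^ 3 := by
    have hS : ∑ j ∈ Finset.Icc 1 (m / 2 + 1), f j ≤ F := by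
      rcases Nat.lt_or_ge m 2 with hm | hm
      · rw [show m / 2 + 1 = 1 by omega]
        simpa [f_one, Nat.one_le_iff_ne_zero] using hFpos.ne'
      · rcases Nat.lt_or_ge m 3 with hm' | hm'
        · obtain rfl : m = 2 := by omega
          have := f_add_le 0
          rw [show (Finset.Icc 1 (2 / 2 + 1)) = {1, 2} by decide]
          simp only [Finset.sum_insert (show (1 : ℕ) ∉ ({2} : Finset ℕ) by decide),
            Finset.sum_singleton]
          simp only [Nat.zero_add, Nat.reduceAdd] at this hF ⊢
          omega
        · have h1 := sum_f_lt (m / 2 + 1)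
          have h2 := f_mono (a := m / 2 + 1 + 2) (b := m + 1) (by omega) (by omega)
          omega
    refine cB.trans ?_
    calc _ ≤ ∑ j ∈ Finset.Icc 1 (m / 2 + 1), F * F * f j := by
          refine Finset.sum_le_sum fun j hj => ?_
          have hj := Finset.mem_Icc.1 hj
          have h1 : f (m + 2 - j) ≤ F := f_mono (by omega) (by omega)
          simp only [Matrix.cons_val_zero, Matrix.cons_val_one, Matrix.cons_val, f_one, ← hF]
          nlinarith [Nat.mul_le_mul_left (F * f j) h1]
      _ ≤ F ^ 3 := by
          rw [← Finset.mul_sum]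
          nlinarith [Nat.mul_le_mul_left (F * F) hS]
  rcases Nat.lt_or_ge m 2 with hm | hm
  · have hsub : normalTuples m ⊆ ⋃ j ∈ Finset.Icc 1 (m / 2 + 1), box ![m + 1, 1, j, m + 2 - j, 1] := by
      rintro t ⟨w, h | ⟨j, hj, rfl⟩ | h | h, ht⟩
      · omega
      · simp only [Set.mem_iUnion]; exact ⟨j, hj, ht⟩
      · omega
      · omega
    exact ⟨fB.subset hsub, (Set.ncard_le_ncard hsub fB).trans (cB'.trans
      (Nat.pow_le_pow_right hFpos (by norm_num)))⟩
  obtain ⟨a, ha⟩ : ∃ a, F = a + 1 := ⟨F - 1, by omega⟩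
  -- From here on `m + 2` is the original parameter, so `F` is `f (m + 3)`.
  obtain ⟨m, rfl⟩ := Nat.exists_eq_add_of_le' hm
  have hlow := f_add_le m
  have hfp := f_pos (m + 1)
  have hle : ∀ j, 1 ≤ j → j ≤ m + 2 → f j ≤ a := fun j h1 h2 => by
    have := f_mono h1 h2
    simp only [show m + 2 + 1 = m + 3 by omega] at hF
    omega
  have hS1 : ∑ j ∈ Finset.Icc 1 (m + 1), f j ≤ a := by
    have := sum_f_lt (m + 1)
    simp only [show m + 1 + 2 = m + 2 + 1 by omega] at this
    omega
  have hS2 : ∑ j ∈ Finset.Icc 1 (m + 2), f j ≤ 2 * a := by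
    rw [Finset.sum_Icc_succ_top (by omega)]
    exact (Nat.add_le_add hS1 (hle (m + 2) (by omega) le_rfl)).trans (by omega)
  have hS3 : ∑ j ∈ Finset.Icc 2 (m + 2), f j ≤ 2 * a :=
    (Finset.sum_le_sum_of_subset (Finset.Icc_subset_Icc_left (by omega))).trans hS2
  obtain ⟨fC, cC⟩ := biUnion_box_finite (Finset.Icc 2 (m + 2))
    fun j => ![m + 2, 1, j, m + 2 + 2 - j, 2]
  obtain ⟨fD, cD⟩ := biUnion_box_finite (Finset.Icc 1 (m + 2))
    fun j => ![m + 2, 2, j, m + 2 + 1 - j, 2]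
  have hm2 := hle (m + 2) (by omega) le_rfl
  have cC' := cC.trans (b := _) (c := 2 * a ^ 3) <| by
    calc _ ≤ ∑ j ∈ Finset.Icc 2 (m + 2), a * a * f j := by
          refine Finset.sum_le_sum fun j hj => ?_
          have hj := Finset.mem_Icc.1 hj
          have h1 := hle (m + 2 + 2 - j) (by omega) (by omega)
          simp only [Matrix.cons_val_zero, Matrix.cons_val_one, Matrix.cons_val, f_one, f_two]
          nlinarith [Nat.mul_le_mul_right (f j) (Nat.mul_le_mul hm2 h1)]
      _ ≤ 2 * a ^ 3 := by
          rw [← Finset.mul_sum]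
          nlinarith [Nat.mul_le_mul_left (a * a) hS3]
  have cD' := cD.trans (b := _) (c := 2 * a ^ 3) <| by
    calc _ ≤ ∑ j ∈ Finset.Icc 1 (m + 2), a * a * f j := by
          refine Finset.sum_le_sum fun j hj => ?_
          have hj := Finset.mem_Icc.1 hj
          have h1 := hle (m + 2 + 1 - j) (by omega) (by omega)
          simp only [Matrix.cons_val_zero, Matrix.cons_val_one, Matrix.cons_val, f_two]
          nlinarith [Nat.mul_le_mul_right (f j) (Nat.mul_le_mul hm2 h1)]
      _ ≤ 2 * a ^ 3 := by
          rw [← Finset.mul_sum]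
          nlinarith [Nat.mul_le_mul_left (a * a) hS2]
  -- For the first kind all weights are small; the fibers are counted together, whatever their
  -- weights, giving the power $a^5$.
  let U : Set (Quotient isoSetoid) := ⋃ j ∈ Finset.Icc 1 (m + 1), C j
  have fU : U.Finite := Set.Finite.biUnion (Finset.finite_toSet _) fun j _ => C_finite j
  have cU : U.ncard ≤ a := (Finset.set_ncard_biUnion_le _ _).trans hS1
  obtain ⟨fA, cA⟩ := tuples_finite (I := Fin 5) (A := fun _ => U) fun _ => fU
  have cA' : {t : Fin 5 → Quotient isoSetoid | ∀ i, t i ∈ U}.ncard ≤ a ^ 5 := by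
    refine cA.trans ?_
    simp only [Finset.prod_const, Finset.card_univ, Fintype.card_fin]
    exact Nat.pow_le_pow_left cU 5
  have hsub : normalTuples (m + 2) ⊆ {t : Fin 5 → Quotient isoSetoid | ∀ i, t i ∈ U} ∪
      (⋃ j ∈ Finset.Icc 1 ((m + 2) / 2 + 1), box ![m + 2 + 1, 1, j, m + 2 + 2 - j, 1]) ∪
      (⋃ j ∈ Finset.Icc 2 (m + 2), box ![m + 2, 1, j, m + 2 + 2 - j, 2]) ∪
      (⋃ j ∈ Finset.Icc 1 (m + 2), box ![m + 2, 2, j, m + 2 + 1 - j, 2]) := by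
    rintro t ⟨w, ⟨-, h⟩ | ⟨j, hj, rfl⟩ | ⟨-, j, hj, rfl⟩ | ⟨-, j, hj, rfl⟩, ht⟩
    · refine .inl (.inl (.inl fun i => ?_))
      simp only [U, Set.mem_iUnion]
      exact ⟨w i, Finset.mem_Icc.2 ⟨(h i).1, (h i).2⟩, ht i⟩
    · refine .inl (.inl (.inr ?_))
      simp only [Set.mem_iUnion]; exact ⟨j, hj, ht⟩
    · refine .inl (.inr ?_)
      simp only [Set.mem_iUnion]; exact ⟨j, hj, ht⟩
    · refine .inr ?_
      simp only [Set.mem_iUnion]; exact ⟨j, hj, ht⟩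
  have fin := ((fA.union fB).union fC).union fD
  refine ⟨fin.subset hsub, (Set.ncard_le_ncard hsub fin).trans ?_⟩
  refine (Set.ncard_union_le _ _).trans ?_
  refine (Nat.add_le_add_right (Set.ncard_union_le _ _) _).trans ?_
  refine (Nat.add_le_add_right (Nat.add_le_add_right (Set.ncard_union_le _ _) _) _).trans ?_
  refine (Nat.add_le_add (Nat.add_le_add (Nat.add_le_add cA' cB') cC') cD').trans ?_
  have ha1 : 1 ≤ a := (f_pos (m + 2)).trans_le hm2
  rw [ha]
  nlinarith [Nat.zero_le (a ^ 2), Nat.zero_le (a ^ 3), Nat.zero_le (a ^ 4)]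

theorem f_le {k : ℕ} (hk : 2 ≤ k) :
    f k ≤ (∑ i ∈ Finset.Icc 1 (k - 1), f i * f (k - i)) + f (k - 2) ^ 5 := by
  obtain ⟨k, rfl⟩ := Nat.exists_eq_add_of_le' hk
  cases k with
  | zero => simp [f_one, f_two]
  | succ m =>
    refine (f_succ_le (k := m + 2) (by omega) (normalTuples_finite m).1
      fun G p hp hs hG => ?_).trans (Nat.add_le_add_left (normalTuples_finite m).2 _)
    have hf := hp.fiber_critical hs hG.1
    obtain ⟨h1, h2⟩ := hp.weights_c5 hs hG.1
    obtain ⟨τ, hτ, hw⟩ := exists_normalWeight (m := m) (fun i => (hf i).1) h1 (by omega)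
    refine ⟨fun v => τ.symm (p v), fun u v huv => ?_, _, hw, fun i => ?_⟩
    · beta_reduce
      rw [hp _ _ (fun h => huv (by beta_reduce; rw [h])), ← hτ (τ.symm _), τ.apply_symm_apply, τ.apply_symm_apply]
    · have : {v | τ.symm (p v) = i} = {v | p v = τ i} := by
        ext v
        exact τ.symm_apply_eq
      beta_reduce
      rw [this]
      exact cls_mem_C ⟨(hf (τ i)).2, hG.2.induce _⟩

/-- If $y=5\uparrow\uparrow(k+1)$, the recursion for `k + 3` gives at most $2\cdot 5^{5y}\le
5^{5y+1}\le 5^{5^y}$, because the `k + 2` summands of the convolution total at most $(5^y)^3$. -/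
theorem f_le_tower (k : ℕ) : f k ≤ hyperoperation 4 5 k := by
  have hT : ∀ n, hyperoperation 4 5 (n + 1) = 5 ^ hyperoperation 4 5 n := fun n => by
    rw [hyperoperation_recursion, hyperoperation_three]
  have h0 : hyperoperation 4 5 0 = 1 := hyperoperation_ge_three_eq_one 1 5
  have hle : ∀ n, n + 1 ≤ hyperoperation 4 5 n := by
    intro n
    induction n with
    | zero => rw [h0]
    | succ n ih =>
      rw [hT]
      exact (Nat.succ_le_succ ih).trans (Nat.lt_pow_self (by norm_num))
  have hexp : ∀ y, 2 ≤ y → 5 * y + 1 ≤ 5 ^ y := by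
    intro y hy
    induction y, hy using Nat.le_induction with
    | base => norm_num
    | succ y hy ih => rw [pow_succ]; omega
  induction k using Nat.strong_induction_on with
  | _ k ih =>
  match k, ih with
  | 0, _ => rw [h0]; exact C_zero.2
  | 1, _ => rw [f_one]; exact (by omega : 1 ≤ 1 + 1).trans (hle 1)
  | 2, _ => rw [f_two]; exact (by omega : 1 ≤ 2 + 1).trans (hle 2)
  | k + 3, ih =>
    refine (f_le (by omega)).trans ?_
    simp only [show k + 3 - 1 = k + 2 by omega, show k + 3 - 2 = k + 1 by omega]
    set y := hyperoperation 4 5 (k + 1) with hy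
    have hx : hyperoperation 4 5 (k + 2) = 5 ^ y := hT (k + 1)
    have h2 : f (k + 2) ≤ 5 ^ y := hx ▸ ih (k + 2) (by omega)
    have h1 : f (k + 1) ≤ 5 ^ y := (f_mono (by omega) (by omega)).trans h2
    have h3 : k + 2 ≤ 5 ^ y := by
      have := hle (k + 2)
      omega
    have hsum : ∑ i ∈ Finset.Icc 1 (k + 2), f i * f (k + 3 - i) ≤ (5 ^ y) ^ 3 := by
      refine (Finset.sum_le_card_nsmul _ _ (5 ^ y * 5 ^ y) fun i hi => ?_).trans ?_
      · have := Finset.mem_Icc.1 hi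
        exact Nat.mul_le_mul ((f_mono (by omega) (by omega)).trans h2)
          ((f_mono (by omega) (by omega)).trans h2)
      · simp only [Nat.card_Icc, Nat.add_sub_cancel, smul_eq_mul]
        calc (k + 2) * (5 ^ y * 5 ^ y) ≤ 5 ^ y * (5 ^ y * 5 ^ y) := Nat.mul_le_mul_right _ h3
          _ = (5 ^ y) ^ 3 := by ring
    have hy2 : 2 ≤ y := by
      have := hle (k + 1)
      omega
    calc _ ≤ (5 ^ y) ^ 5 + (5 ^ y) ^ 5 := Nat.add_le_add
          (hsum.trans (Nat.pow_le_pow_right (by positivity) (by norm_num)))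
          (Nat.pow_le_pow_left h1 5)
      _ ≤ 5 ^ (5 * y + 1) := by
          rw [← pow_mul, pow_succ, mul_comm y 5]
          have := Nat.zero_le (5 ^ (5 * y))
          omega
      _ ≤ 5 ^ 5 ^ y := Nat.pow_le_pow_right (by norm_num) (hexp y hy2)
      _ = hyperoperation 4 5 (k + 3) := by rw [← hx, ← hT]

end P5Graphs

/-! ### Merging stable sets and reducing colorable graphs to cliques -/

namespace P5Graphs

open SimpleGraph

/-! ### Merging a stable set into one vertex -/

section Merge

variable {V : Type*} {A : SimpleGraph V} {S W : Set V} {z : V}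

open Classical in
/-- The map that sends `S` to `z` and fixes the other vertices. -/
noncomputable def rep (S : Set V) (z u : V) : V := if u ∈ S then z else u

theorem rep_of_mem {u : V} (h : u ∈ S) : rep S z u = z := if_pos h

theorem rep_of_notMem {u : V} (h : u ∉ S) : rep S z u = u := if_neg h

theorem rep_eq_iff {u v : V} : rep S z u = v ↔ u ∈ S ∧ z = v ∨ u ∉ S ∧ u = v := by
  by_cases h : u ∈ S <;> simp [rep, h]

/-- The graph that arises from `A` when all edges at `S` are moved to `z`. -/
def merge (A : SimpleGraph V) (S : Set V) (z : V) : SimpleGraph V where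
  Adj u v := u ≠ v ∧ ∃ s t, rep S z s = u ∧ rep S z t = v ∧ A.Adj s t
  symm := ⟨fun _ _ ⟨h, s, t, hs, ht, hst⟩ => ⟨h.symm, t, s, ht, hs, hst.symm⟩⟩
  loopless := ⟨fun _ h => h.1 rfl⟩

theorem merge_empty : merge A ∅ z = A := by
  ext u v
  simp only [merge, rep_of_notMem (Set.notMem_empty _)]
  constructor
  · rintro ⟨-, s, t, rfl, rfl, h⟩
    exact h
  · exact fun h => ⟨h.ne, u, v, rfl, rfl, h⟩

theorem merge_adj_rep (hS : ∀ u ∈ S, ∀ v ∈ S, ¬ A.Adj u v) (hz : S.Nonempty → z ∈ S) {u v : V}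
    (h : A.Adj u v) : (merge A S z).Adj (rep S z u) (rep S z v) := by
  refine ⟨fun he => ?_, u, v, rfl, rfl, h⟩
  by_cases hu : u ∈ S <;> by_cases hv : v ∈ S
  · exact hS u hu v hv h
  · rw [rep_of_mem hu, rep_of_notMem hv] at he
    exact hv (he ▸ hz ⟨u, hu⟩)
  · rw [rep_of_notMem hu, rep_of_mem hv] at he
    exact hu (he ▸ hz ⟨v, hv⟩)
  · rw [rep_of_notMem hu, rep_of_notMem hv] at he
    exact h.ne he

theorem merge_colorable_iff (hS : ∀ u ∈ S, ∀ v ∈ S, ¬ A.Adj u v) (hz : z ∈ S) {k : ℕ} :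
    (merge A S z).Colorable k ↔ ∃ f : A.Coloring (Fin k), ∀ u ∈ S, ∀ v ∈ S, f u = f v := by
  constructor
  · rintro ⟨f⟩
    refine ⟨Coloring.mk (fun u => f (rep S z u)) fun {u v} h => f.valid (merge_adj_rep hS (fun _ => hz) h),
      fun u hu v hv => ?_⟩
    change f _ = f _
    rw [rep_of_mem hu, rep_of_mem hv]
  · rintro ⟨f, hf⟩
    have hr : ∀ s, f (rep S z s) = f s := fun s => by
      by_cases hs : s ∈ S
      · rw [rep_of_mem hs]
        exact hf z hz s hs
      · rw [rep_of_notMem hs]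
    refine ⟨Coloring.mk f ?_⟩
    rintro _ _ ⟨-, s, t, rfl, rfl, h⟩
    rw [hr, hr]
    exact f.valid h

theorem merge_adj_of_notMem {u v : V} (hz : z ∈ S) (hu : u ∉ S) (hv : v ∉ S) :
    (merge A S z).Adj u v ↔ A.Adj u v := by
  constructor
  · rintro ⟨-, s, t, hs, ht, h⟩
    rw [rep_eq_iff] at hs ht
    rcases hs with ⟨-, rfl⟩ | ⟨-, rfl⟩
    · exact absurd hz hu
    rcases ht with ⟨-, rfl⟩ | ⟨-, rfl⟩
    · exact absurd hz hv
    exact h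
  · exact fun h => ⟨h.ne, u, v, rep_of_notMem hu, rep_of_notMem hv, h⟩

theorem merge_adj_rep_left {v : V} (hz : z ∈ S) (hv : v ∉ S) :
    (merge A S z).Adj z v ↔ ∃ s ∈ S, A.Adj s v := by
  constructor
  · rintro ⟨-, s, t, hs, ht, h⟩
    rw [rep_eq_iff] at hs ht
    rcases ht with ⟨-, rfl⟩ | ⟨-, rfl⟩
    · exact absurd hz hv
    rcases hs with ⟨hs, -⟩ | ⟨hs, rfl⟩
    · exact ⟨s, hs, h⟩
    · exact absurd hz hs
  · rintro ⟨s, hs, h⟩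
    exact ⟨by rintro rfl; exact hv hz, s, v, rep_of_mem hs, rep_of_notMem hv, h⟩

theorem not_merge_adj {u v : V} (hu : u ∈ S) (huz : u ≠ z) : ¬ (merge A S z).Adj u v := by
  rintro ⟨-, s, t, hs, -, -⟩
  rw [rep_eq_iff] at hs
  rcases hs with ⟨-, rfl⟩ | ⟨hs, rfl⟩
  exacts [huz rfl, hs hu]

/-- Merging a maximal stable set of a homogeneous set creates no new patterns. -/
theorem merge_free (hA : IsP5CoP5Free A) (hz : z ∈ S) (hSW : S ⊆ W)
    (hW : ∀ u ∈ W, ∀ u' ∈ W, ∀ v ∉ W, A.Adj v u ↔ A.Adj v u')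
    (hmax : ∀ v ∈ W, v ∉ S → ∃ s ∈ S, A.Adj s v) : IsP5CoP5Free (merge A S z) := by
  classical
  rw [isP5CoP5Free_iff]
  rintro X hX ⟨g⟩
  have hpat : IsPattern X := by rcases hX with rfl | rfl; exacts [isPattern_p5, isPattern_p5_compl]
  -- The other vertices of `S` have become isolated, and patterns have no isolated vertices.
  have hg : ∀ i, g i ∈ S → g i = z := by
    intro i hi
    by_contra hne
    obtain ⟨j, hj⟩ := (hpat.2.1 i).1
    exact not_merge_adj hi hne (g.map_adj_iff.2 hj)
  let R : Set V := {v | v ∈ S → v = z}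
  have hX' : X.IsIndContained ((merge A S z).induce R) :=
    hpat.isIndContained (fun i => ⟨g i, hg i⟩) fun i j => by simp
  -- As `W` stays homogeneous, the merged graph is a substitution into `A`: the copy lies in `W` or
  -- gives one in `A`.
  have hsub := fun h => hpat.of_substitution (G := A) {x : R | x.1 ∈ W}
    (fun x => if x.1 ∈ W then z else x.1) z (fun y hy => if_pos hy) h hX'
  refine (hsub ?_).elim (fun ⟨g'⟩ => ?_) (isP5CoP5Free_iff.1 hA X hX)
  rotate_left
  -- By maximality of `S`, the vertex `z` is now adjacent to all remaining vertices of `W`. Patterns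
  -- have no universal vertex, so the copy avoids `z` and already lies in `A`.
  · have hz' : ∀ i, (g' i).1.1 ∉ S := by
      intro i hi
      obtain ⟨j, hj, hadj⟩ := (hpat.2.1 i).2
      have e : (g' i).1.1 = z := (g' i).1.2 hi
      have hjS : (g' j).1.1 ∉ S := fun h => hj (g'.injective
        (Subtype.ext (Subtype.ext (((g' j).1.2 h).trans e.symm))))
      refine hadj (g'.map_adj_iff.1 ?_)
      change (merge A S z).Adj (g' i).1.1 (g' j).1.1
      rw [e, merge_adj_rep_left hz hjS]
      exact hmax _ (g' j).2 hjS
    refine isP5CoP5Free_iff.1 hA X hX (hpat.isIndContained (fun i => (g' i).1.1) fun i j => ?_)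
    rw [← g'.map_adj_iff, ← merge_adj_of_notMem hz (hz' i) (hz' j)]
    rfl
  · have key : ∀ x y : R, x.1 ∈ W → y.1 ∉ W → ((merge A S z).Adj x.1 y.1 ↔ A.Adj z y.1) := by
      intro x y hx hy
      have hyS : y.1 ∉ S := fun h => hy (hSW h)
      by_cases hxS : x.1 ∈ S
      · rw [x.2 hxS, merge_adj_rep_left hz hyS]
        refine ⟨fun ⟨s, hs, h⟩ => ?_, fun h => ⟨z, hz, h⟩⟩
        rw [A.adj_comm] at h ⊢
        exact (hW s (hSW hs) z (hSW hz) _ hy).1 h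
      · rw [merge_adj_of_notMem hz hxS hyS, A.adj_comm, A.adj_comm z]
        exact hW _ hx z (hSW hz) _ hy
    intro x y hxy hN
    change (merge A S z).Adj x.1 y.1 ↔ _
    by_cases hx : x.1 ∈ W <;> by_cases hy : y.1 ∈ W
    · exact absurd ⟨hx, hy⟩ hN
    · simp only [hx, hy, if_true, if_false]
      exact key x y hx hy
    · simp only [hx, hy, if_true, if_false]
      rw [SimpleGraph.adj_comm, key y x hy hx, A.adj_comm]
    · simp only [hx, hy, if_false]
      exact merge_adj_of_notMem hz (fun h => hx (hSW h)) fun h => hy (hSW h)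

/-- The vertices with at least one neighbor. -/
def alive (A : SimpleGraph V) : Set V := {v | ∃ u, A.Adj v u}

/-- The vertex set never changes; the number of non-isolated vertices measures progress. -/
theorem alive_merge_ssubset (hz : z ∈ S) (hS : S ⊆ alive A) (h2 : ∃ u ∈ S, u ≠ z) :
    alive (merge A S z) ⊂ alive A := by
  obtain ⟨u, hu, huz⟩ := h2
  refine ⟨?_, fun h => ?_⟩
  · rintro x ⟨y, -, s, t, hs, -, h⟩
    rw [rep_eq_iff] at hs
    rcases hs with ⟨-, rfl⟩ | ⟨-, rfl⟩
    exacts [hS hz, ⟨t, h⟩]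
  · obtain ⟨v, hv⟩ := h (hS hu)
    exact not_merge_adj hu huz hv

/-- The vertices of `B` with a non-neighbor in `B`. -/
def deficient (A : SimpleGraph V) (B : Set V) : Set V := {v | v ∈ B ∧ ∃ w ∈ B, w ≠ v ∧ ¬ A.Adj v w}

theorem deficient_homogeneous {B : Set V}
    (hB : ∀ u ∈ B, ∀ u' ∈ B, ∀ v ∉ B, A.Adj v u ↔ A.Adj v u') :
    ∀ u ∈ deficient A B, ∀ u' ∈ deficient A B, ∀ v ∉ deficient A B, A.Adj v u ↔ A.Adj v u' := by
  intro u hu u' hu' v hv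
  by_cases hvB : v ∈ B
  · have : ∀ w ∈ deficient A B, A.Adj v w := by
      intro w hw
      by_contra h
      exact hv ⟨hvB, w, hw.1, by rintro rfl; exact hv hw, h⟩
    exact ⟨fun _ => this _ hu', fun _ => this _ hu⟩
  · exact hB u hu.1 u' hu'.1 v hvB

end Merge

section Kernel

variable {V : Type*} [Fintype V] [LinearOrder V] {A : SimpleGraph V} {S B : Set V} {z : V}

theorem IsKernel.maximal {W : Set V} (h : IsKernel A W S) : ∀ v ∈ W, v ∉ S → ∃ s ∈ S, A.Adj s v :=
  fun _ hv hS => by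
    obtain ⟨s, hs, hadj, -⟩ := h.exists_adj hv hS
    exact ⟨s, hs, hadj⟩

/-- The reason for restricting to deficient vertices: a kernel there is never a single vertex, so
merging it makes progress. -/
theorem IsKernel.exists_ne (h : IsKernel A (deficient A B) S) (hz : z ∈ S) : ∃ u ∈ S, u ≠ z := by
  by_contra hc
  push Not at hc
  obtain ⟨hzB, w, hw, hwz, hadj⟩ := h.subset hz
  obtain ⟨s, hs, hsw⟩ := h.maximal w ⟨hw, z, hzB, hwz.symm, fun h => hadj h.symm⟩
    fun hwS => hwz (hc w hwS)
  rw [hc s hs] at hsw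
  exact hadj hsw

theorem IsKernel.eq_empty_or_nonempty {W : Set V} (h : IsKernel A W S) : W = ∅ ∨ S.Nonempty := by
  rcases W.eq_empty_or_nonempty with hW | ⟨w, hw⟩
  · exact .inl hW
  · right
    by_cases hwS : w ∈ S
    · exact ⟨w, hwS⟩
    · obtain ⟨s, hs, -⟩ := h.maximal w hw hwS
      exact ⟨s, hs⟩

/-- If `W` needs `r + 1` colors, its cliques have at most `r + 1` vertices, so without the kernel it
is `r`-colorable by perfection. The merged vertex takes one further color, and `colorable_swap`
extends this to the whole graph. -/
theorem IsKernel.merge_colorable {W : Set V} (hA : IsP5CoP5Free A) {k : ℕ} (hk : A.Colorable k)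
    (hW : ∀ u ∈ W, ∀ u' ∈ W, ∀ v ∉ W, A.Adj v u ↔ A.Adj v u') (h5 : NoC5 A W)
    (h : IsKernel A W S) (hz : z ∈ S) : (merge A S z).Colorable k := by
  refine colorable_swap hk W W id ?_ ?_ ?_
  · intro x hx y hy hxy
    exact (merge_adj_of_notMem hz (fun h' => hx (h.subset h')) fun h' => hy (h.subset h')).1 hxy
  · rintro x hx y hy ⟨-, s, t, hs, ht, hst⟩ m hm
    rw [rep_eq_iff] at hs ht
    rcases hs with ⟨-, rfl⟩ | ⟨-, rfl⟩
    · exact absurd (h.subset hz) hx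
    have htW : t ∈ W := by
      rcases ht with ⟨ht, -⟩ | ⟨-, rfl⟩
      exacts [h.subset ht, hy]
    exact (hW t htW m hm _ hx).1 hst
  · rintro r hr
    cases r with
    | zero =>
      have := colorable_zero_iff.1 hr
      exact (this.false ⟨z, h.subset hz⟩).elim
    | succ r =>
      have hcl : CliquesLE A W (r + 1) := by
        intro Q hQ hcl
        refine not_colorable_top (n := r + 1) (q := Q.card) (colorable_of_embedding hr
          ⟨⟨fun i => ⟨(Q.equivFin.symm i).1, hQ (Q.equivFin.symm i).2⟩, fun i j hij => ?_⟩,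
            fun {i j} => ?_⟩)
        · exact Q.equivFin.symm.injective (Subtype.ext (congrArg Subtype.val hij :))
        · change A.Adj (Q.equivFin.symm i).1 (Q.equivFin.symm j).1 ↔ i ≠ j
          refine ⟨by rintro h' rfl; exact h'.ne rfl, fun hij => ?_⟩
          exact hcl (Q.equivFin.symm i).2 (Q.equivFin.symm j).2 fun he =>
            hij (Q.equivFin.symm.injective (Subtype.ext he))
      obtain ⟨f⟩ := (h5.mono Set.sdiff_subset).colorable hA (h.cliquesLE hA h5 hcl)
      refine colorable_succ_of_stable (S := S) (fun u hu v hv huv => ?_)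
        ⟨Coloring.mk f fun {u v} huv => ?_⟩
      · by_cases huz : u = z
        · exact not_merge_adj hv (fun hvz => huv.ne (huz.trans hvz.symm)) huv.symm
        · exact not_merge_adj hu huz huv
      · exact f.valid ((merge_adj_of_notMem hz u.2.2 v.2.2).1 huv)

end Kernel

/-! ### Reducible five-cycles -/

section Reducible

variable {V : Type*} {A : SimpleGraph V}

theorem IsC5.hull_homogeneous (hA : IsP5CoP5Free A) {c : Fin 5 → V} (hc : IsC5 A c) :
    ∀ u ∈ hull A c, ∀ u' ∈ hull A c, ∀ v ∉ hull A c, A.Adj v u ↔ A.Adj v u' :=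
  fun u hu u' hu' v hv => by rw [hc.adj_outside hA hv hu, hc.adj_outside hA hv hu']

/-- The first part of the cycle `c` is free of five-cycles and not a clique. -/
def HasLoosePart (A : SimpleGraph V) (c : Fin 5 → V) : Prop :=
  IsC5 A c ∧ NoC5 A (part A c 0) ∧ (deficient A (part A c 0)).Nonempty

/-- All parts of the cycle `c` are cliques. -/
def HasTightParts (A : SimpleGraph V) (c : Fin 5 → V) : Prop :=
  IsC5 A c ∧ ∀ i, deficient A (part A c i) = ∅

theorem adj_of_deficient_eq_empty {B : Set V} (h : deficient A B = ∅) {u v : V} (hu : u ∈ B)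
    (hv : v ∈ B) (huv : u ≠ v) : A.Adj u v := by
  by_contra hadj
  exact (Set.ext_iff.1 h u).1 ⟨hu, v, hv, huv.symm, hadj⟩

theorem HasTightParts.maximal (hA : IsP5CoP5Free A) {c : Fin 5 → V} (h : HasTightParts A c) :
    ∀ v ∈ hull A c, v ∉ ({c 0, c 2} : Set V) → ∃ s ∈ ({c 0, c 2} : Set V), A.Adj s v := by
  rintro v ⟨i, hi⟩ hv
  simp only [Set.mem_insert_iff, Set.mem_singleton_iff, not_or] at hv
  simp only [Set.mem_insert_iff, Set.mem_singleton_iff, exists_eq_or_imp, exists_eq_left]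
  by_cases h0 : i = 0
  · subst h0
    exact .inl (adj_of_deficient_eq_empty (h.2 0) (h.1.mem_part 0) hi fun e => hv.1 e.symm)
  by_cases h2 : i = 2
  · subst h2
    exact .inr (adj_of_deficient_eq_empty (h.2 2) (h.1.mem_part 2) hi fun e => hv.2 e.symm)
  rw [h.1.adj_parts hA (h.1.mem_part 0) hi (Ne.symm h0),
    h.1.adj_parts hA (h.1.mem_part 2) hi (Ne.symm h2)]
  clear hi
  decide +revert

theorem HasTightParts.merge_free (hA : IsP5CoP5Free A) {c : Fin 5 → V} (h : HasTightParts A c)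
    {z : V} (hz : z ∈ ({c 0, c 2} : Set V)) : IsP5CoP5Free (merge A {c 0, c 2} z) :=
  P5Graphs.merge_free hA hz (W := hull A c)
    (by rintro x (rfl | rfl); exacts [⟨0, h.1.mem_part 0⟩, ⟨2, h.1.mem_part 2⟩])
    (h.1.hull_homogeneous hA) (h.maximal hA)

theorem IsC5.not_adj_zero_two {c : Fin 5 → V} (h : IsC5 A c) :
    ∀ u ∈ ({c 0, c 2} : Set V), ∀ v ∈ ({c 0, c 2} : Set V), ¬ A.Adj u v := by
  have h02 : ¬ A.Adj (c 0) (c 2) := by rw [h]; decide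
  rintro u (rfl | rfl) v (rfl | rfl)
  exacts [A.loopless.irrefl _, h02, fun h => h02 h.symm, A.loopless.irrefl _]

theorem IsC5.rotate {c : Fin 5 → V} (h : IsC5 A c) (i : Fin 5) : IsC5 A fun l => c (l + i) := by
  intro a b
  rw [h]
  revert a b i
  decide

theorem part_rotate (c : Fin 5 → V) (i l : Fin 5) :
    part A (fun l => c (l + i)) l = part A c (l + i) := by
  simp only [part, show ∀ a : Fin 5, l + a + i = l + i + a from fun a => add_right_comm _ _ _]

/-- Two vertices of the hull with the same color lie in parts at distance two and can be exchanged
into the cycle as `d 0` and `d 2`; a coloring constant on these survives the merging. -/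
theorem HasTightParts.exists_merge_colorable (hA : IsP5CoP5Free A) {c : Fin 5 → V}
    (h : HasTightParts A c) {k : ℕ} (hk : A.Colorable k) :
    ∃ d : Fin 5 → V, HasTightParts A d ∧ (merge A {d 0, d 2} (d 0)).Colorable k := by
  classical
  have key : ∀ (f : A.Coloring (Fin k)) (i : Fin 5) (x y : V), x ∈ part A c i → y ∈ part A c (i + 2) →
      f x = f y → ∃ d : Fin 5 → V, HasTightParts A d ∧ (merge A {d 0, d 2} (d 0)).Colorable k := by
    intro f i x y hx hy hxy
    let d : Fin 5 → V := ![x, c (1 + i), y, c (3 + i), c (4 + i)]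
    have hd : ∀ l, d l ∈ part A (fun l => c (l + i)) l := by
      intro l
      rw [part_rotate]
      fin_cases l
      · simpa [d] using hx
      · exact h.1.mem_part _
      · rw [add_comm]; exact hy
      · exact h.1.mem_part _
      · exact h.1.mem_part _
    have hd5 : IsC5 A d := (h.1.rotate i).of_mem_parts hA hd
    refine ⟨d, ⟨hd5, fun l => ?_⟩, ?_⟩
    · rw [(h.1.rotate i).part_eq_of_mem_parts hA hd, part_rotate]
      exact h.2 _
    · rw [merge_colorable_iff hd5.not_adj_zero_two (by simp)]
      refine ⟨f, ?_⟩
      rintro u (rfl | rfl) v (rfl | rfl)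
      exacts [rfl, hxy, hxy.symm, rfl]
  obtain ⟨f⟩ := hk
  by_cases hf : ∃ x ∈ hull A c, ∃ y ∈ hull A c, x ≠ y ∧ f x = f y
  · obtain ⟨x, ⟨i, hi⟩, y, ⟨j, hj⟩, hne, he⟩ := hf
    have hadj : ¬ A.Adj x y := fun hadj => f.valid hadj he
    have hij : i ≠ j := by
      rintro rfl
      exact hadj (adj_of_deficient_eq_empty (h.2 i) hi hj hne)
    rw [h.1.adj_parts hA hi hj hij] at hadj
    have : ∀ i j : Fin 5, i ≠ j → ¬ c5.Adj i j → j = i + 2 ∨ i = j + 2 := by decide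
    rcases this i j hij hadj with rfl | rfl
    · exact key f i x y hi hj he
    · exact key f j y x hj hi he.symm
  -- If no color repeats on the hull, `c 2` can be recolored with the color of `c 0`: its neighbors
  -- outside the hull are also adjacent to `c 0`, and those in the hull have other colors.
  · push Not at hf
    have hne : c 0 ≠ c 2 := fun e => absurd
      (part_disjoint (h.1.mem_part 0) (e ▸ h.1.mem_part 2 : c 0 ∈ part A c 2)) (by decide)
    have hrec : ∀ v, A.Adj (c 2) v → f (c 0) ≠ f v := by
      intro v hv he
      by_cases hvh : v ∈ hull A c
      · by_cases hv0 : c 0 = v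
        · subst hv0
          exact absurd ((h.1 2 0).1 hv) (by decide)
        · exact hf _ ⟨0, h.1.mem_part 0⟩ v hvh hv0 he
      · have h1 := (h.1.adj_outside hA hvh ⟨2, h.1.mem_part 2⟩).1 hv.symm
        exact f.valid h1.symm he
    let g : A.Coloring (Fin k) := Coloring.mk (fun v => if v = c 2 then f (c 0) else f v) (by
      intro u v huv
      by_cases hu : u = c 2 <;> by_cases hv : v = c 2
      · exact absurd (hu.trans hv.symm) huv.ne
      · simp only [hu, hv, if_true, if_false]
        exact hrec v (hu ▸ huv)
      · simp only [hu, hv, if_true, if_false]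
        exact (hrec u (hv ▸ huv.symm)).symm
      · simp only [hu, hv, if_false]
        exact f.valid huv)
    refine key g 0 (c 0) (c 2) (h.1.mem_part 0) (by simpa using h.1.mem_part 2) ?_
    change (if c 0 = c 2 then _ else _) = if c 2 = c 2 then _ else _
    rw [if_neg hne, if_pos rfl]

/-- A graph with a five-cycle has one that can be simplified. -/
theorem IsC5.exists_reducible [Finite V] (hA : IsP5CoP5Free A) {c : Fin 5 → V} (hc : IsC5 A c) :
    ∃ d, HasLoosePart A d ∨ HasTightParts A d := by
  -- A five-cycle with smallest hull has no five-cycle inside a part.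
  obtain ⟨c, hc, hmin⟩ := Set.Finite.exists_minimalFor (fun c => (hull A c).ncard)
    {c | IsC5 A c} (Set.toFinite _) ⟨c, hc⟩
  have hno : ∀ i, NoC5 A (part A c i) := by
    intro i d hd
    by_contra hcon
    push Not at hcon
    -- A vertex outside a part does not distinguish its elements, so it cannot belong to the hull of
    -- a five-cycle within the part.
    have hsub : hull A d ⊆ part A c i := by
      rintro v ⟨j, hv1, -, hv2, -⟩
      by_contra hv
      exact hv2 ((hc.part_module hA (hcon _) (hcon _) hv).1 hv1)
    have hlt : (hull A d).ncard < (hull A c).ncard := by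
      refine Set.ncard_lt_ncard ⟨hsub.trans (part_subset_hull c i), fun h => ?_⟩
      have h1 := part_disjoint (hsub (h ⟨i + 1, hc.mem_part (i + 1)⟩)) (hc.mem_part (i + 1))
      have h2 : ∀ i : Fin 5, i ≠ i + 1 := by decide
      exact h2 i h1
    exact absurd (hmin hd hlt.le) (not_le.2 hlt)
  by_cases h : ∃ i, (deficient A (part A c i)).Nonempty
  · obtain ⟨i, hi⟩ := h
    refine ⟨fun l => c (l + i), .inl ⟨hc.rotate i, ?_, ?_⟩⟩ <;> rw [part_rotate, zero_add]
    exacts [hno i, hi]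
  · push Not at h
    exact ⟨c, .inr ⟨hc, h⟩⟩

end Reducible

/-! ### Reduction steps -/

section Reduction

variable {V : Type*} {A : SimpleGraph V}

/-- No induced subgraph of `A` is a `(k + 1)`-critical graph of the class. -/
def NoMember (k : ℕ) (A : SimpleGraph V) : Prop := ∀ s : Set V, ¬ IsMember (k + 1) (A.induce s)

/-- Replaces the test for colorability by a search for critical subgraphs. -/
theorem noMember_iff [Finite V] (hA : IsP5CoP5Free A) {k : ℕ} : NoMember k A ↔ A.Colorable k := by
  constructor
  · intro h
    by_contra hc
    obtain ⟨s, hs⟩ := exists_isCritical hc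
    exact h s ⟨hs, hA.induce s⟩
  · intro h s hs
    exact (isCritical_succ_iff.1 hs.1).1 (colorable_of_embedding h (Embedding.induce s))

/-- Merging `S` into `z` preserves the class and `k`-colorability and leads towards a clique. -/
structure IsReduction (k : ℕ) (A : SimpleGraph V) (S : Set V) (z : V) : Prop where
  stable : ∀ u ∈ S, ∀ v ∈ S, ¬ A.Adj u v
  mem : S.Nonempty → z ∈ S
  free : IsP5CoP5Free (merge A S z)
  colorable : (merge A S z).Colorable k
  progress : alive (merge A S z) ⊂ alive A ∨ deficient A (alive A) = ∅ ∧ S = ∅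

/-- The stable sets that are merged. -/
def IsMergeable [Fintype V] [LinearOrder V] (k : ℕ) (A : SimpleGraph V) (S : Set V) : Prop :=
  (∃ c, HasLoosePart A c ∧ IsKernel A (deficient A (part A c 0)) S) ∨
  (∃ c, HasTightParts A c ∧ NoMember k (merge A {c 0, c 2} (c 0)) ∧ S = {c 0, c 2}) ∨
  (¬ ∃ c, HasLoosePart A c) ∧ (¬ ∃ c, HasTightParts A c ∧ NoMember k (merge A {c 0, c 2} (c 0))) ∧
    IsKernel A (deficient A (alive A)) S

theorem IsKernel.isReduction [Fintype V] [LinearOrder V] (hA : IsP5CoP5Free A) {k : ℕ}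
    (hk : A.Colorable k) {B S : Set V} (hB : ∀ u ∈ B, ∀ u' ∈ B, ∀ v ∉ B, A.Adj v u ↔ A.Adj v u')
    (h5 : NoC5 A B) (hBA : B ⊆ alive A) (h : IsKernel A (deficient A B) S) {z : V} (hz : z ∈ S) :
    IsReduction k A S z where
  stable _ hu _ hv := h.stable hu hv
  mem _ := hz
  free := merge_free hA hz h.subset (deficient_homogeneous hB) h.maximal
  colorable := h.merge_colorable hA hk (deficient_homogeneous hB) (h5.mono fun _ hx => hx.1) hz
  progress := .inl (alive_merge_ssubset hz (fun _ hx => hBA (h.subset hx).1) (h.exists_ne hz))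

theorem IsMergeable.isReduction [Fintype V] [LinearOrder V] {k : ℕ} {S : Set V}
    (h : IsMergeable k A S) (hA : IsP5CoP5Free A) (hk : A.Colorable k) {z : V}
    (hz : S.Nonempty → z ∈ S) : IsReduction k A S z := by
  rcases h with ⟨c, hc, hS⟩ | ⟨c, hc, hm, rfl⟩ | ⟨h1, h2, hS⟩
  · have hne := hS.eq_empty_or_nonempty.resolve_left hc.2.2.ne_empty
    exact hS.isReduction hA hk (fun u hu u' hu' v hv => hc.1.part_module hA hu hu' hv) hc.2.1
      (fun v hv => ⟨_, hv.1⟩) (hz hne)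
  · have hz := hz ⟨c 0, by simp⟩
    have hmem : c 0 ∈ ({c 0, c 2} : Set V) := by simp
    have hst := hc.1.not_adj_zero_two
    refine ⟨hst, fun _ => hz, hc.merge_free hA hz, ?_, .inl (alive_merge_ssubset hz ?_ ?_)⟩
    · rw [merge_colorable_iff hst hz, ← merge_colorable_iff hst hmem]
      exact (noMember_iff (hc.merge_free hA hmem)).1 hm
    · rintro x (rfl | rfl)
      exacts [⟨_, (hc.1.mem_part 0).1⟩, ⟨_, (hc.1.mem_part 2).1⟩]
    · have hne : c 0 ≠ c 2 := fun e => absurd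
        (part_disjoint (hc.1.mem_part 0) (e ▸ hc.1.mem_part 2 : c 0 ∈ part A c 2)) (by decide)
      rcases hz with rfl | rfl
      exacts [⟨c 2, by simp, hne.symm⟩, ⟨c 0, by simp, hne⟩]
  -- A five-cycle would yield a reducible one. A loose part is excluded, and for tight parts a
  -- suitable merging would keep the graph `k`-colorable.
  · have h5 : ∀ c, ¬ IsC5 A c := by
      intro c hc
      obtain ⟨d, hd | hd⟩ := hc.exists_reducible hA
      · exact h1 ⟨d, hd⟩
      · obtain ⟨e, he, hek⟩ := hd.exists_merge_colorable hA hk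
        exact h2 ⟨e, he, (noMember_iff (he.merge_free hA (by simp))).2 hek⟩
    rcases S.eq_empty_or_nonempty with rfl | hne
    · refine ⟨by simp, hz, by rwa [merge_empty], by rwa [merge_empty], .inr ⟨?_, rfl⟩⟩
      exact hS.eq_empty_or_nonempty.resolve_right (by simp)
    -- The non-isolated vertices are trivially homogeneous, as the other vertices have no neighbors.
    · refine hS.isReduction hA hk (fun u hu u' hu' v hv => ?_) (fun c hc => (h5 c hc).elim)
        le_rfl (hz hne)
      exact ⟨fun h => absurd ⟨u, h⟩ hv, fun h => absurd ⟨u', h⟩ hv⟩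

open Classical in
theorem card_lt_of_deficient_eq_empty [Fintype V] [LinearOrder V] {k : ℕ} (hk : A.Colorable k)
    (h : deficient A (alive A) = ∅) {v : V} (hv : v ∈ alive A) :
    (Finset.univ.filter fun u => u ∈ alive A ∧ u < v).card < k := by
  have hcl : A.IsClique (↑(insert v (Finset.univ.filter fun u => u ∈ alive A ∧ u < v)) : Set V) := by
    have : ∀ u ∈ (↑(insert v (Finset.univ.filter fun u => u ∈ alive A ∧ u < v)) : Set V),
        u ∈ alive A := by
      intro u hu
      simp only [Finset.coe_insert, Finset.coe_filter, Finset.mem_univ, true_and,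
        Set.mem_insert_iff, Set.mem_ofPred_eq] at hu
      rcases hu with rfl | hu
      exacts [hv, hu.1]
    exact fun x hx y hy hxy => adj_of_deficient_eq_empty h (this x hx) (this y hy) hxy
  have := hcl.card_le_of_colorable hk
  rwa [Finset.card_insert_of_notMem (by simp)] at this

end Reduction

end P5Graphs

/-! ### Definability of vertex properties and specifications of programs -/

namespace P5Graphs

open SimpleGraph

/-! ### Programs that act on a finite vertex set -/

/-- The part of a store that concerns the vertices `0, …, m`: the entries of the arrays, and the
variables as names of vertices. -/
@[ext] structure St (m : ℕ) where
  dat : ℕ → Fin (m + 1) → Fin (m + 1) → ℕ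
  env : ℕ → Fin (m + 1)

/-- The assignment of the vertex `v` to the variable `x`. -/
def St.set {m : ℕ} (s : St m) (x : ℕ) (v : Fin (m + 1)) : St m :=
  ⟨s.dat, fun y => if y = x then v else s.env y⟩

/-- The replacement of the array `a`. -/
def St.put {m : ℕ} (s : St m) (a : ℕ) (g : Fin (m + 1) → Fin (m + 1) → ℕ) : St m :=
  ⟨fun b => if b = a then g else s.dat b, s.env⟩

/-- The assignment of a tuple of vertices to the variables from `b` on. -/
def St.setFrom {m L : ℕ} (s : St m) (b : ℕ) (t : Fin L → Fin (m + 1)) : St m :=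
  ⟨s.dat, fun x => if h : b ≤ x ∧ x < b + L then t ⟨x - b, by omega⟩ else s.env x⟩

/-- The tuple of vertices in the variables from `b` on. -/
def tup {m : ℕ} (s : St m) (b L : ℕ) : Fin L → Fin (m + 1) := fun i => s.env (b + i)

section St

variable {m L : ℕ} (s : St m)

@[simp] theorem set_dat (x : ℕ) (v : Fin (m + 1)) : (s.set x v).dat = s.dat := rfl

@[simp] theorem set_env (x y : ℕ) (v : Fin (m + 1)) :
    (s.set x v).env y = if y = x then v else s.env y := rfl

@[simp] theorem put_env (a : ℕ) (g : Fin (m + 1) → Fin (m + 1) → ℕ) : (s.put a g).env = s.env := rfl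

@[simp] theorem put_dat (a b : ℕ) (g : Fin (m + 1) → Fin (m + 1) → ℕ) :
    (s.put a g).dat b = if b = a then g else s.dat b := rfl

@[simp] theorem setFrom_dat (b : ℕ) (t : Fin L → Fin (m + 1)) : (s.setFrom b t).dat = s.dat := rfl

theorem setFrom_env_of_lt {b x : ℕ} (t : Fin L → Fin (m + 1)) (h : x < b) :
    (s.setFrom b t).env x = s.env x :=
  dif_neg (by omega)

@[simp] theorem tup_setFrom (b : ℕ) (t : Fin L → Fin (m + 1)) : tup (s.setFrom b t) b L = t := by
  funext i
  simp [tup, St.setFrom]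

theorem tup_set {b x : ℕ} (v : Fin (m + 1)) (h : b + L ≤ x) : tup (s.set x v) b L = tup s b L := by
  funext i
  simp only [tup, set_env]
  rw [if_neg (by omega)]

theorem tup_setFrom_of_le {b b' L' : ℕ} (t : Fin L' → Fin (m + 1)) (h : b + L ≤ b') :
    tup (s.setFrom b' t) b L = tup s b L := by
  funext i
  exact setFrom_env_of_lt s t (by omega)

theorem setFrom_cons (b : ℕ) (v : Fin (m + 1)) (t : Fin L → Fin (m + 1)) :
    (s.set b v).setFrom (b + 1) t = s.setFrom b (Fin.cons v t : Fin (L + 1) → Fin (m + 1)) := by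
  ext1
  · rfl
  funext x
  simp only [St.setFrom, set_env]
  by_cases h0 : x = b
  · subst h0
    rw [dif_neg (by omega), dif_pos (by omega), if_pos rfl]
    simp
  by_cases h1 : b + 1 ≤ x ∧ x < b + 1 + L
  · rw [dif_pos h1, dif_pos (by omega)]
    have : (⟨x - b, by omega⟩ : Fin (L + 1)) = Fin.succ ⟨x - (b + 1), by omega⟩ := by
      ext; simp; omega
    rw [this, Fin.cons_succ]
  · rw [dif_neg h1, dif_neg (by omega), if_neg h0]

theorem setFrom_zero (b : ℕ) (t : Fin 0 → Fin (m + 1)) : s.setFrom b t = s := by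
  ext1
  · rfl
  funext x
  exact dif_neg (by omega)

end St

/-- The part of a store that concerns the vertices. -/
def view (m : ℕ) (σ : Store) : St m where
  dat a u v := σ.arr a u v
  env x := if h : σ.var x < m + 1 then ⟨σ.var x, h⟩ else 0

theorem view_setVar {m : ℕ} {σ : Store} (x : ℕ) {i : ℕ} (hi : i < m + 1) :
    view m (σ.setVar x i) = (view m σ).set x ⟨i, hi⟩ := by
  ext1
  · rfl
  funext y
  simp only [view, St.set, setVar_var]
  split_ifs <;> simp_all

/-- Properties of vertices that can be decided in polynomial time. -/
def Def (Φ : ∀ m, St m → Prop) : Prop :=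
  ∃ φ, Testable true φ ∧ ∀ m σ, σ.var 0 = m + 1 → (φ σ ↔ Φ m (view m σ))

/-- Functions of vertices that can be computed in polynomial time. -/
def DefNum (f : ∀ m, St m → ℕ) : Prop :=
  ∃ g, Evaluable true g ∧ ∀ m σ, σ.var 0 = m + 1 → g σ = f m (view m σ)

theorem Def.congr {Φ Ψ : ∀ m, St m → Prop} (h : Def Φ) (e : ∀ m s, Ψ m s ↔ Φ m s) : Def Ψ := by
  rwa [show Ψ = Φ from funext fun m => funext fun s => propext (e m s)]

theorem DefNum.congr {f g : ∀ m, St m → ℕ} (h : DefNum f) (e : ∀ m s, g m s = f m s) : DefNum g := by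
  rwa [show g = f from funext fun m => funext fun s => e m s]

theorem Def.table {ι : Type} [Finite ι] {Φ : ι → ∀ m, St m → Prop} (h : ∀ i, Def (Φ i))
    (P : (ι → Prop) → Prop) : Def fun m s => P fun i => Φ i m s := by
  choose φ hφ e using h
  refine ⟨_, Testable.table hφ P, fun m σ hσ => ?_⟩
  rw [show (fun i => φ i σ) = fun i => Φ i m (view m σ) from funext fun i => propext (e i m σ hσ)]

theorem Def.not {Φ : ∀ m, St m → Prop} (h : Def Φ) : Def fun m s => ¬ Φ m s :=
  let ⟨_, hφ, e⟩ := h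
  ⟨_, hφ.not, fun m σ hσ => not_congr (e m σ hσ)⟩

theorem Def.and {Φ Ψ : ∀ m, St m → Prop} (h : Def Φ) (h' : Def Ψ) : Def fun m s => Φ m s ∧ Ψ m s :=
  let ⟨_, hφ, e⟩ := h
  let ⟨_, hψ, e'⟩ := h'
  ⟨_, hφ.and hψ, fun m σ hσ => and_congr (e m σ hσ) (e' m σ hσ)⟩

theorem Def.or {Φ Ψ : ∀ m, St m → Prop} (h : Def Φ) (h' : Def Ψ) : Def fun m s => Φ m s ∨ Ψ m s :=
  let ⟨_, hφ, e⟩ := h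
  let ⟨_, hψ, e'⟩ := h'
  ⟨_, hφ.or hψ, fun m σ hσ => or_congr (e m σ hσ) (e' m σ hσ)⟩

theorem Def.imp {Φ Ψ : ∀ m, St m → Prop} (h : Def Φ) (h' : Def Ψ) : Def fun m s => Φ m s → Ψ m s :=
  let ⟨_, hφ, e⟩ := h
  let ⟨_, hψ, e'⟩ := h'
  ⟨_, hφ.imp hψ, fun m σ hσ => imp_congr (e m σ hσ) (e' m σ hσ)⟩

theorem Def.lt {f g : ∀ m, St m → ℕ} (h : DefNum f) (h' : DefNum g) : Def fun m s => f m s < g m s :=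
  let ⟨_, hφ, e⟩ := h
  let ⟨_, hψ, e'⟩ := h'
  ⟨_, Testable.lt hφ hψ, fun m σ hσ => by rw [e m σ hσ, e' m σ hσ]⟩

theorem Def.eq {f g : ∀ m, St m → ℕ} (h : DefNum f) (h' : DefNum g) : Def fun m s => f m s = g m s :=
  let ⟨_, hφ, e⟩ := h
  let ⟨_, hψ, e'⟩ := h'
  ⟨_, Testable.eq hφ hψ, fun m σ hσ => by rw [e m σ hσ, e' m σ hσ]⟩

/-- Variable `0` holds the number `m + 1` of vertices, so a quantifier over vertices is a bounded
search. -/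
theorem Def.ex {Φ : ∀ m, St m → Prop} (h : Def Φ) (x : ℕ) (hx : x ≠ 0) :
    Def fun m s => ∃ v, Φ m (s.set x v) := by
  obtain ⟨φ, hφ, e⟩ := h
  refine ⟨_, Testable.ex x hx hφ, fun m σ hσ => ?_⟩
  rw [hσ]
  constructor
  · rintro ⟨i, hi, h⟩
    rw [e m _ (by rw [setVar_var_ne _ hx.symm, hσ]), view_setVar x hi] at h
    exact ⟨_, h⟩
  · rintro ⟨v, h⟩
    refine ⟨v, v.2, ?_⟩
    rw [e m _ (by rw [setVar_var_ne _ hx.symm, hσ]), view_setVar x v.2]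
    exact h

theorem Def.all {Φ : ∀ m, St m → Prop} (h : Def Φ) (x : ℕ) (hx : x ≠ 0) :
    Def fun m s => ∀ v, Φ m (s.set x v) :=
  (h.not.ex x hx).not.congr fun m s => by simp

/-- The length `L` is fixed, so `L` nested loops remain polynomial. -/
theorem Def.exTuple {Φ : ∀ m, St m → Prop} (h : Def Φ) {b : ℕ} (hb : b ≠ 0) (L : ℕ) :
    Def fun m s => ∃ t : Fin L → Fin (m + 1), Φ m (s.setFrom b t) := by
  induction L generalizing b with
  | zero => exact h.congr fun m s => by simp [setFrom_zero]
  | succ L ih =>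
    refine ((ih (b := b + 1) (by omega)).ex b hb).congr fun m s => ?_
    simp only [setFrom_cons]
    exact ⟨fun ⟨t, ht⟩ => ⟨t 0, Fin.tail t, by rwa [Fin.cons_self_tail]⟩, fun ⟨v, t, h⟩ => ⟨_, h⟩⟩

theorem DefNum.lit (c : ℕ) : DefNum fun _ _ => c := ⟨_, Evaluable.lit true c, fun _ _ _ => rfl⟩

theorem DefNum.idx (x : ℕ) : DefNum fun _ s => (s.env x).val := by
  refine ⟨_, Evaluable.ite (Testable.lt (.var true x) (.var true 0)) (.var true x) (.lit true 0),
    fun m σ hσ => ?_⟩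
  simp only [view, hσ]
  split_ifs <;> rfl

theorem DefNum.get (a x y : ℕ) : DefNum fun _ s => s.dat a (s.env x) (s.env y) := by
  obtain ⟨g, hg, e⟩ := DefNum.idx x
  obtain ⟨g', hg', e'⟩ := DefNum.idx y
  refine ⟨_, Evaluable.get a hg hg', fun m σ hσ => ?_⟩
  rw [e m σ hσ, e' m σ hσ]
  rfl

theorem DefNum.cases {Φ : ∀ m, St m → Prop} {f g : ∀ m, St m → ℕ} (h : Def Φ) (hf : DefNum f)
    (hg : DefNum g) : ∃ e, DefNum e ∧ (∀ m s, Φ m s → e m s = f m s) ∧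
      ∀ m s, ¬ Φ m s → e m s = g m s := by
  classical
  obtain ⟨φ, hφ, e⟩ := h
  obtain ⟨f', hf', e'⟩ := hf
  obtain ⟨g', hg', e''⟩ := hg
  refine ⟨fun m s => if Φ m s then f m s else g m s, ⟨_, Evaluable.ite hφ hf' hg', fun m σ hσ => ?_⟩,
    fun m s h => if_pos h, fun m s h => if_neg h⟩
  simp only [e m σ hσ, e' m σ hσ, e'' m σ hσ]

open Classical in
theorem DefNum.count {Φ : ∀ m, St m → Prop} (h : Def Φ) (x : ℕ) (hx : x ≠ 0) :
    DefNum fun m s => (Finset.univ.filter fun v => Φ m (s.set x v)).card := by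
  obtain ⟨φ, hφ, e⟩ := h
  refine ⟨_, Evaluable.count hφ hx, fun m σ hσ => ?_⟩
  rw [hσ]
  symm
  refine Finset.card_bij (fun v _ => v.val) (fun v hv => ?_) (fun v _ w _ h => Fin.ext h) fun i hi => ?_
  · simp only [Finset.mem_filter, Finset.mem_univ, true_and, Finset.mem_range] at hv ⊢
    refine ⟨v.2, ?_⟩
    rw [e m _ (by rw [setVar_var_ne _ hx.symm, hσ]), view_setVar x v.2]
    exact hv
  · simp only [Finset.mem_filter, Finset.mem_range] at hi
    rw [e m _ (by rw [setVar_var_ne _ hx.symm, hσ]), view_setVar x hi.1] at hi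
    exact ⟨⟨i, hi.1⟩, by simpa using hi.2, rfl⟩

theorem Def.vertex_eq (x y : ℕ) : Def fun _ s => s.env x = s.env y :=
  (Def.eq (.idx x) (.idx y)).congr fun _ _ => Fin.ext_iff

theorem Def.vertex_lt (x y : ℕ) : Def fun _ s => s.env x < s.env y := Def.lt (.idx x) (.idx y)

/-! ### Specifications of programs -/

/-- Some polynomial-time program acts on the vertices according to `R`. -/
def Prg (R : ∀ m, St m → St m → Prop) : Prop :=
  ∃ F, Doable true F ∧ ∀ m σ, σ.var 0 = m + 1 → R m (view m σ) (view m (F σ))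

theorem Doable.var_zero {q : Bool} {F : Store → Store} (h : Doable q F) (σ : Store) :
    (F σ).var 0 = σ.var 0 := by
  obtain ⟨_, _, _, h, _⟩ := h
  exact h σ

theorem Prg.mono {R R' : ∀ m, St m → St m → Prop} (h : Prg R) (e : ∀ m s s', R m s s' → R' m s s') :
    Prg R' :=
  let ⟨F, hF, hR⟩ := h
  ⟨F, hF, fun m σ hσ => e _ _ _ (hR m σ hσ)⟩

theorem Prg.skip : Prg fun _ s s' => s' = s := ⟨_, Doable.id true, fun _ _ _ => rfl⟩

theorem Prg.comp {R R' : ∀ m, St m → St m → Prop} (h : Prg R) (h' : Prg R') :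
    Prg fun m s s' => ∃ r, R m s r ∧ R' m r s' := by
  obtain ⟨F, hF, hR⟩ := h
  obtain ⟨F', hF', hR'⟩ := h'
  exact ⟨_, hF'.comp hF, fun m σ hσ => ⟨_, hR m σ hσ, hR' m _ (by rw [hF.var_zero, hσ])⟩⟩

theorem Prg.ite {Φ : ∀ m, St m → Prop} {R R' : ∀ m, St m → St m → Prop} (hΦ : Def Φ) (h : Prg R)
    (h' : Prg R') : Prg fun m s s' => Φ m s ∧ R m s s' ∨ ¬ Φ m s ∧ R' m s s' := by
  classical
  obtain ⟨φ, hφ, e⟩ := hΦ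
  obtain ⟨F, hF, hR⟩ := h
  obtain ⟨F', hF', hR'⟩ := h'
  refine ⟨_, Doable.ite hφ hF hF', fun m σ hσ => ?_⟩
  by_cases hs : φ σ
  · rw [if_pos hs]
    exact .inl ⟨(e m σ hσ).1 hs, hR m σ hσ⟩
  · rw [if_neg hs]
    exact .inr ⟨fun h => hs ((e m σ hσ).2 h), hR' m σ hσ⟩

theorem Prg.fill {f : ∀ m, St m → ℕ} (hf : DefNum f) (a x y : ℕ) (hx : x ≠ 0) (hy : y ≠ 0)
    (hxy : x ≠ y) : Prg fun m s s' => s' = s.put a fun u v => f m ((s.set x u).set y v) := by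
  obtain ⟨g, hg, e⟩ := hf
  refine ⟨_, Doable.fill hg a x y hx hy hxy, fun m σ hσ => ?_⟩
  ext1
  · funext b u v
    simp only [view, fill_arr, put_dat, hσ, u.2, v.2, and_true]
    split_ifs with h
    · rw [e m _ (by rw [setVar_var_ne _ hy.symm, setVar_var_ne _ hx.symm, hσ]), view_setVar y v.2,
        view_setVar x u.2]
      rfl
    · rfl
  · rfl

theorem Prg.fillSet {Φ : ∀ m, St m → Prop} (h : Def Φ) (a x y : ℕ) (hx : x ≠ 0) (hy : y ≠ 0)
    (hxy : x ≠ y) : Prg fun m s s' =>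
      ∃ g, s' = s.put a g ∧ ∀ u v, g u v ≠ 0 ↔ Φ m ((s.set x u).set y v) := by
  obtain ⟨f, hf, h1, h2⟩ := DefNum.cases h (.lit 1) (.lit 0)
  refine (Prg.fill hf a x y hx hy hxy).mono fun m s s' e => ⟨_, e, fun u v => ?_⟩
  by_cases hΦ : Φ m ((s.set x u).set y v)
  · simp [h1 _ _ hΦ, hΦ]
  · simp [h2 _ _ hΦ, hΦ]

theorem Prg.choose {Φ : ∀ m, St m → Prop} (h : Def Φ) (x : ℕ) (hx : x ≠ 0) :
    Prg fun m s s' => ∃ v, s' = s.set x v ∧ ((∃ u, Φ m (s.set x u)) → Φ m s') := by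
  obtain ⟨φ, hφ, e⟩ := h
  refine ⟨_, Doable.setVar x hx (Evaluable.fold hφ hx (fun i _ => i) (fun u _ => .var u)
    fun _ _ _ => rfl), fun m σ hσ => ?_⟩
  set w := foldWhere (fun i _ => i) (fun i => φ (σ.setVar x i)) (σ.var 0) with hw
  by_cases hex : ∃ i < σ.var 0, φ (σ.setVar x i)
  · obtain ⟨h1, h2⟩ := foldWhere_last hex
    rw [← hw] at h1 h2
    rw [hσ] at h1
    refine ⟨_, view_setVar x h1, fun _ => ?_⟩
    exact (e m _ (by rw [setVar_var_ne _ hx.symm, hσ])).1 h2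
  -- A failed search returns 0, which is a legitimate vertex because there are `m + 1` of them.
  · have h0 : w = 0 := by
      have : ∀ n ≤ σ.var 0, foldWhere (fun i _ => i) (fun i => φ (σ.setVar x i)) n = 0 := by
        intro n
        induction n with
        | zero => intro; rfl
        | succ n ih =>
          intro hn
          rw [foldWhere, if_neg fun h => hex ⟨n, by omega, h⟩, ih (by omega)]
      exact this _ le_rfl
    rw [h0]
    refine ⟨_, view_setVar x (by omega), ?_⟩
    rintro ⟨u, hu⟩
    refine (hex ⟨u, by rw [hσ]; exact u.2, ?_⟩).elim
    rw [e m _ (by rw [setVar_var_ne _ hx.symm, hσ]), view_setVar x u.2]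
    exact hu

/-- The first coordinate is chosen so that it can be completed, and then the others are chosen. -/
theorem Prg.chooseTuple {Φ : ∀ m, St m → Prop} (h : Def Φ) {b : ℕ} (hb : b ≠ 0) (L : ℕ) :
    Prg fun m s s' => ∃ t : Fin L → Fin (m + 1), s' = s.setFrom b t ∧
      ((∃ t : Fin L → Fin (m + 1), Φ m (s.setFrom b t)) → Φ m s') := by
  induction L generalizing b with
  | zero => exact Prg.skip.mono fun m s s' e => ⟨Fin.elim0, by simp [e, setFrom_zero]⟩
  | succ L ih =>
    refine ((Prg.choose (h.exTuple (b := b + 1) (by omega) L) b hb).comp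
      (ih (b := b + 1) (by omega))).mono ?_
    rintro m s s' ⟨r, ⟨v, rfl, hv⟩, t, rfl, ht⟩
    refine ⟨Fin.cons v t, by rw [setFrom_cons], ?_⟩
    rintro ⟨t', h'⟩
    refine ht (hv ⟨t' 0, Fin.tail t', ?_⟩)
    rwa [setFrom_cons, Fin.cons_self_tail]

/-- The number of rounds is the number `m + 1` of vertices. -/
theorem Prg.iterate {R : ∀ m, St m → St m → Prop} (h : Prg R) :
    Prg fun m s s' => ∃ q : ℕ → St m, q 0 = s ∧ q (m + 1) = s' ∧ ∀ i, R m (q i) (q (i + 1)) := by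
  obtain ⟨F, hF, hR⟩ := h
  refine ⟨_, Doable.iterate hF, fun m σ hσ => ⟨fun i => view m (F^[i] σ), rfl, ?_, fun i => ?_⟩⟩
  · simp only [hσ]
  · simp only [Function.iterate_succ_apply']
    refine hR m _ ?_
    induction i with
    | zero => exact hσ
    | succ i ih => rw [Function.iterate_succ_apply', hF.var_zero, ih]

end P5Graphs

/-! ### Polynomial-time tests for graph properties -/

namespace P5Graphs

open SimpleGraph

/-! ### Decidable graph properties -/

/-- The graph given by a matrix. -/
def gr {m : ℕ} (M : Fin (m + 1) → Fin (m + 1) → ℕ) : SimpleGraph (Fin (m + 1)) where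
  Adj u v := u ≠ v ∧ (M u v ≠ 0 ∨ M v u ≠ 0)
  symm := ⟨fun _ _ h => ⟨h.1.symm, h.2.symm⟩⟩
  loopless := ⟨fun _ h => h.1 rfl⟩

theorem gr_eq {m : ℕ} {M : Fin (m + 1) → Fin (m + 1) → ℕ} {G : SimpleGraph (Fin (m + 1))}
    (h : ∀ u v, M u v ≠ 0 ↔ G.Adj u v) : gr M = G := by
  ext u v
  simp only [gr, h, G.adj_comm v u, or_self, and_iff_right_iff_imp]
  exact fun h => h.ne

/-- The set of vertices given by the diagonal of a matrix. -/
def diag {m : ℕ} (M : Fin (m + 1) → Fin (m + 1) → ℕ) : Set (Fin (m + 1)) := {v | M v v ≠ 0}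

theorem Def.adj (a x y : ℕ) : Def fun _ s => (gr (s.dat a)).Adj (s.env x) (s.env y) :=
  (Def.vertex_eq x y).not.and
    ((Def.eq (.get a x y) (.lit 0)).not.or (Def.eq (.get a y x) (.lit 0)).not)

theorem Def.mem_diag (a x : ℕ) : Def fun _ s => s.env x ∈ diag (s.dat a) :=
  (Def.eq (.get a x x) (.lit 0)).not

theorem Def.isC5 (a b : ℕ) : Def fun _ s => IsC5 (gr (s.dat a)) (tup s b 5) :=
  Def.table (ι := Fin 5 × Fin 5) (fun i => Def.adj a (b + i.1) (b + i.2))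
    (fun f => ∀ i j, f (i, j) ↔ c5.Adj i j)

theorem Def.mem_part (a b x : ℕ) (i : Fin 5) :
    Def fun _ s => s.env x ∈ part (gr (s.dat a)) (tup s b 5) i :=
  (Def.adj a x (b + (i + 1 : Fin 5))).and ((Def.adj a x (b + (i + 4 : Fin 5))).and
    ((Def.adj a x (b + (i + 2 : Fin 5))).not.and (Def.adj a x (b + (i + 3 : Fin 5))).not))

theorem Def.mem_alive (a x : ℕ) : Def fun _ s => s.env x ∈ alive (gr (s.dat a)) :=
  ((Def.adj a x (x + 1)).ex (x + 1) (by omega)).congr fun m s => by simp [alive]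

/-- A family of vertex sets that depends only on the variables below `b`. -/
structure DefSet (b : ℕ) (B : ∀ m, St m → Set (Fin (m + 1))) : Prop where
  def_mem : ∀ x, b ≤ x → Def fun m s => s.env x ∈ B m s
  set_eq : ∀ m (s : St m) x v, b ≤ x → B m (s.set x v) = B m s

theorem DefSet.deficient {b : ℕ} {B : ∀ m, St m → Set (Fin (m + 1))} (h : DefSet b B) (a : ℕ) :
    DefSet b fun m s => deficient (gr (s.dat a)) (B m s) where
  def_mem x hx := ((h.def_mem x hx).and (((h.def_mem (x + 1) (by omega)).and
    ((Def.vertex_eq (x + 1) x).not.and (Def.adj a x (x + 1)).not)).ex (x + 1) (by omega))).congr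
      fun m s => by simp [P5Graphs.deficient, h.set_eq m s (x + 1) _ (by omega)]
  set_eq m s x v hx := by simp [h.set_eq m s x v hx]

theorem DefSet.nonempty {b : ℕ} {B : ∀ m, St m → Set (Fin (m + 1))} (h : DefSet b B) (hb : 0 < b) :
    Def fun m s => (B m s).Nonempty :=
  ((h.def_mem b le_rfl).ex b (by omega)).congr fun m s => by
    simp [Set.Nonempty, h.set_eq m s b _ le_rfl]

theorem DefSet.part (a : ℕ) {b b' : ℕ} (i : Fin 5) (hb : b + 5 ≤ b') :
    DefSet b' fun _ s => part (gr (s.dat a)) (tup s b 5) i where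
  def_mem x _ := Def.mem_part a b x i
  set_eq m s x v hx := by simp only [set_dat, tup_set s v (show b + 5 ≤ x by omega)]

theorem DefSet.diag (a b : ℕ) : DefSet b fun _ s => diag (s.dat a) where
  def_mem x _ := Def.mem_diag a x
  set_eq _ _ _ _ _ := rfl

theorem Def.hasLoosePart (a b : ℕ) (hb : 0 < b) :
    Def fun _ s => HasLoosePart (gr (s.dat a)) (tup s b 5) := by
  refine (Def.isC5 a b).and (Def.and ?_ (((DefSet.part a 0 le_rfl).deficient a).nonempty (by omega)))
  refine (Def.exTuple (b := b + 5) ((Def.isC5 a (b + 5)).and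
    (Def.table (ι := Fin 5) (fun i => Def.mem_part a b (b + 5 + i) 0) (fun f => ∀ i, f i)))
    (by omega) 5).not.congr fun m s => ?_
  simp only [setFrom_dat, tup_setFrom, tup_setFrom_of_le s _ (le_refl (b + 5)), NoC5]
  rw [not_exists]
  refine forall_congr' fun c => ?_
  rw [not_and, not_forall]
  refine imp_congr Iff.rfl (exists_congr fun i => not_congr ?_)
  rw [show (s.setFrom (b + 5) c).env (b + 5 + i) = c i from congrFun (tup_setFrom s (b + 5) c) i]

theorem Def.hasTightParts (a b : ℕ) :
    Def fun _ s => HasTightParts (gr (s.dat a)) (tup s b 5) := by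
  refine (Def.isC5 a b).and ((Def.table (ι := Fin 5) (fun i =>
    (((DefSet.part a i le_rfl).deficient a).nonempty (b := b + 5) (by omega)).not)
      (fun f => ∀ i, f i)).congr fun m s => ?_)
  simp only [Set.not_nonempty_iff_eq_empty]

/-- A family of graphs that depends only on the variables below `b`. -/
structure DefGraph (b : ℕ) (H : ∀ m, St m → SimpleGraph (Fin (m + 1))) : Prop where
  def_adj : ∀ x y, b ≤ x → b ≤ y → Def fun m s => (H m s).Adj (s.env x) (s.env y)
  setFrom_eq : ∀ m (s : St m) L (t : Fin L → Fin (m + 1)), H m (s.setFrom b t) = H m s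

theorem DefGraph.gr (a b : ℕ) : DefGraph b fun _ s => gr (s.dat a) where
  def_adj x y _ _ := Def.adj a x y
  setFrom_eq _ _ _ _ := rfl

theorem Def.merge_adj {b : ℕ} {S : ∀ m, St m → Set (Fin (m + 1))} (hS : DefSet b S) (a : ℕ) {z : ℕ}
    (hz : z < b) {x y : ℕ} (hx : b ≤ x) :
    Def fun m s => (merge (P5Graphs.gr (s.dat a)) (S m s) (s.env z)).Adj (s.env x) (s.env y) := by
  have hrep : ∀ u v, b ≤ u → Def fun m s => rep (S m s) (s.env z) (s.env u) = s.env v := fun u v hu =>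
    (((hS.def_mem u hu).and (Def.vertex_eq z v)).or
      ((hS.def_mem u hu).not.and (Def.vertex_eq u v))).congr fun m s => rep_eq_iff
  -- The bound variables `x + y + 1` and `x + y + 2` differ from `x`, `y` and `z` and are at least
  -- `b`, so they do not affect `S`.
  have h1 : x + y + 1 ≠ x + y + 2 := by omega
  refine ((Def.vertex_eq x y).not.and ((((hrep (x + y + 1) x (by omega)).and
    ((hrep (x + y + 2) y (by omega)).and (Def.adj a (x + y + 1) (x + y + 2)))).ex (x + y + 2)
      (by omega)).ex (x + y + 1) (by omega))).congr fun m s => ?_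
  have e1 : ∀ u v, S m ((s.set (x + y + 1) u).set (x + y + 2) v) = S m s := fun u v => by
    rw [hS.set_eq m _ _ _ (by omega), hS.set_eq m _ _ _ (by omega)]
  simp only [merge, e1, set_env, set_dat, if_neg (show z ≠ x + y + 1 by omega),
    if_neg (show z ≠ x + y + 2 by omega), if_neg (show x ≠ x + y + 1 by omega),
    if_neg (show x ≠ x + y + 2 by omega), if_neg (show y ≠ x + y + 1 by omega),
    if_neg (show y ≠ x + y + 2 by omega), if_neg h1, if_true]

/-! ### Searching for critical subgraphs -/

/-- Here finiteness of the family enters the algorithm. -/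
theorem exists_card_bound (k : ℕ) : ∃ N, ∀ n (X : SimpleGraph (Fin n)), IsMember k X → n ≤ N := by
  obtain ⟨N, hN⟩ := ((C_finite k).image fun c => c.out.1).bddAbove
  refine ⟨N, fun n X hX => ?_⟩
  obtain ⟨e⟩ := cls_eq_iff.1 ((cls_mk (cls X).out).trans (Quotient.out_eq _))
  have hc : (cls X).out.1 = n := by simpa using Fintype.card_congr e.toEquiv
  rw [← hc]
  exact hN ⟨_, cls_mem_C hX, rfl⟩

/-- The vertices `t i` are distinct and induce a `k`-critical graph of the class. -/
def IsMemberTuple {V : Type*} (k : ℕ) (H : SimpleGraph V) {L : ℕ} (t : Fin L → V) : Prop :=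
  Function.Injective t ∧ IsMember k (H.comap t)

theorem IsMemberTuple.isMember_induce {V : Type*} {k : ℕ} {H : SimpleGraph V} {L : ℕ}
    {t : Fin L → V} (h : IsMemberTuple k H t) : IsMember k (H.induce (Set.range t)) :=
  h.2.of_iso ⟨Equiv.ofInjective t h.1, fun {_ _} => Iff.rfl⟩

theorem isMemberTuple_iff {V : Type*} {k : ℕ} {H : SimpleGraph V} {L : ℕ} {t : Fin L → V} :
    IsMemberTuple k H t ↔ Function.Injective t ∧ IsMember k (H.induce (Set.range t)) :=
  ⟨fun h => ⟨h.1, h.isMember_induce⟩, fun h => ⟨h.1, h.2.of_iso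
    (Iso.symm ⟨Equiv.ofInjective t h.1, fun {_ _} => Iff.rfl⟩)⟩⟩

theorem noMember_iff_tuple {V : Type*} [Finite V] {k N : ℕ} {H : SimpleGraph V}
    (hN : ∀ n (X : SimpleGraph (Fin n)), IsMember (k + 1) X → n ≤ N) :
    NoMember k H ↔ ¬ ∃ L : Fin (N + 1), ∃ t : Fin L → V, IsMemberTuple (k + 1) H t := by
  rw [NoMember, ← not_exists, not_iff_not]
  constructor
  · rintro ⟨s, hs⟩
    have e := Finite.equivFin s
    have hm : IsMemberTuple (k + 1) H (fun i => (e.symm i).1) :=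
      ⟨fun i j hij => e.symm.injective (Subtype.ext hij),
        hs.of_iso (Iso.symm ⟨e.symm, fun {_ _} => Iff.rfl⟩)⟩
    exact ⟨⟨Nat.card s, Nat.lt_succ_of_le (hN _ _ hm.2)⟩, _, hm⟩
  · rintro ⟨L, t, h⟩
    exact ⟨_, h.isMember_induce⟩

/-- Whether a graph on `L` vertices is a member is a property of its adjacencies. -/
theorem isMemberTuple_iff_table {V : Type*} {k : ℕ} {H : SimpleGraph V} {L : ℕ} {t : Fin L → V} :
    IsMemberTuple k H t ↔ (∀ i j, t i = t j → i = j) ∧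
      ∃ X : SimpleGraph (Fin L), (∀ i j, X.Adj i j ↔ H.Adj (t i) (t j)) ∧ IsMember k X := by
  refine and_congr Iff.rfl ⟨fun h => ⟨_, fun i j => Iff.rfl, h⟩, fun ⟨X, hX, h⟩ => ?_⟩
  rwa [show H.comap t = X by ext i j; exact (hX i j).symm]

/-- Membership depends only on the equalities and adjacencies among `L` vertices, so it is a fixed
table; criticality is never computed. -/
theorem DefGraph.isMemberTuple {b : ℕ} {H : ∀ m, St m → SimpleGraph (Fin (m + 1))}
    (h : DefGraph b H) (k L : ℕ) : Def fun m s => IsMemberTuple k (H m s) (tup s b L) := by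
  refine (Def.table (ι := (Fin L × Fin L) ⊕ (Fin L × Fin L))
    (Φ := Sum.elim (fun i m s => (H m s).Adj (s.env (b + i.1)) (s.env (b + i.2)))
      (fun i _ s => s.env (b + i.1) = s.env (b + i.2))) ?_
    (fun f => (∀ i j, f (.inr (i, j)) → i = j) ∧
      ∃ X : SimpleGraph (Fin L), (∀ i j, X.Adj i j ↔ f (.inl (i, j))) ∧ IsMember k X)).congr
    fun m s => isMemberTuple_iff_table
  rintro (i | i)
  · exact h.def_adj _ _ (by omega) (by omega)
  · exact Def.vertex_eq _ _

theorem DefGraph.exists_isMemberTuple {b : ℕ} (hb : b ≠ 0)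
    {H : ∀ m, St m → SimpleGraph (Fin (m + 1))} (h : DefGraph b H) (k L : ℕ) :
    Def fun m s => ∃ t : Fin L → Fin (m + 1), IsMemberTuple k (H m s) t :=
  ((h.isMemberTuple k L).exTuple hb L).congr fun m s => by
    simp only [tup_setFrom, h.setFrom_eq]

theorem DefGraph.noMember {b : ℕ} (hb : b ≠ 0) {H : ∀ m, St m → SimpleGraph (Fin (m + 1))}
    (h : DefGraph b H) (k : ℕ) : Def fun m s => NoMember k (H m s) := by
  obtain ⟨N, hN⟩ := exists_card_bound (k + 1)
  exact (Def.table (ι := Fin (N + 1)) (fun L => h.exists_isMemberTuple hb (k + 1) L)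
    (fun f => ¬ ∃ L, f L)).congr fun m s => noMember_iff_tuple hN

theorem DefSet.pair {b : ℕ} (x y : ℕ) (hx : x < b) (hy : y < b) :
    DefSet b fun _ s => ({s.env x, s.env y} : Set _) where
  def_mem w _ := (Def.vertex_eq w x).or (Def.vertex_eq w y)
  set_eq m s w v hw := by
    simp only [set_env, if_neg (show x ≠ w by omega), if_neg (show y ≠ w by omega)]

end P5Graphs

/-! ### A program that computes a coloring -/

namespace P5Graphs

open SimpleGraph

/-! ### Computing colorings -/

/-- Storage used below: array 0 is the input, 1 the coloring, 2 the current graph, 3 the map from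
the input graph to it, 4 the set searched and 5 the stable set. Variables 10 to 14 hold a
five-cycle, 15 the vertex `z`, and 16 to 19 are loop or bound variables. Sets are read off
diagonals. -/
theorem Prg.storeSet {B : ∀ m, St m → Set (Fin (m + 1))} (h : DefSet 16 B) (a : ℕ) :
    Prg fun m s s' => ∃ g, s' = s.put a g ∧ diag g = B m s :=
  (Prg.fillSet (h.def_mem 16 le_rfl) a 16 17 (by norm_num) (by norm_num) (by norm_num)).mono
    fun m s s' ⟨g, e, hg⟩ => ⟨g, e, by
      ext v
      simp [diag, hg, h.set_eq m _ 17 _ (by norm_num), h.set_eq m _ 16 _ le_rfl]⟩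

theorem Prg.storeGraph {H : ∀ m, St m → SimpleGraph (Fin (m + 1))}
    (h : Def fun m s => (H m s).Adj (s.env 16) (s.env 17))
    (hH : ∀ m (s : St m) u v, H m ((s.set 16 u).set 17 v) = H m s) (a : ℕ) :
    Prg fun m s s' => ∃ g, s' = s.put a g ∧ gr g = H m s :=
  (Prg.fillSet h a 16 17 (by norm_num) (by norm_num) (by norm_num)).mono fun m s s' ⟨g, e, hg⟩ => ⟨g, e,
    gr_eq fun u v => by simp [hg, hH]⟩

theorem DefNum.degIn {b : ℕ} {W : ∀ m, St m → Set (Fin (m + 1))} (hW : DefSet b W) (a x y : ℕ)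
    (hy : b ≤ y) (hy0 : y ≠ 0) (hxy : x ≠ y) :
    DefNum fun m s => degIn (gr (s.dat a)) (W m s) (s.env x) :=
  (DefNum.count ((hW.def_mem y hy).and (Def.adj a x y)) y hy0).congr fun m s => by
    unfold P5Graphs.degIn
    congr
    funext v
    simp [hW.set_eq m s y _ hy, hxy]

theorem DefSet.kernelStep {b : ℕ} {W S : ∀ m, St m → Set (Fin (m + 1))} (hW : DefSet b W)
    (hS : DefSet b S) (a : ℕ) : DefSet b fun m s => kernelStep (gr (s.dat a)) (W m s) (S m s) where
  def_mem x hx := by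
    have d1 := DefNum.degIn hW a x (x + 2) (by omega) (by omega) (by omega)
    have d2 := DefNum.degIn hW a (x + 1) (x + 2) (by omega) (by omega) (by omega)
    refine ((hW.def_mem x hx).and (((hS.def_mem (x + 1) (by omega)).imp ((Def.adj a (x + 1) x).imp
      ((Def.lt d1 d2).or ((Def.eq d2 d1).and (Def.vertex_lt (x + 1) x))).not)).all (x + 1)
        (by omega))).congr fun m s => ?_
    simp [P5Graphs.kernelStep, Prec, hW.set_eq m s (x + 1) _ (by omega),
      hS.set_eq m s (x + 1) _ (by omega)]
  set_eq m s x v hx := by simp [hW.set_eq m s x v hx, hS.set_eq m s x v hx]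

theorem put_put {m : ℕ} (s : St m) (a : ℕ) (g g' : Fin (m + 1) → Fin (m + 1) → ℕ) :
    (s.put a g).put a g' = s.put a g' := by
  ext1
  · funext b
    simp only [put_dat]
    split_ifs <;> rfl
  · rfl

theorem put_self {m : ℕ} (s : St m) (a : ℕ) : s.put a (s.dat a) = s := by
  ext1
  · funext b
    simp only [put_dat]
    split_ifs with h
    · rw [h]
    · rfl
  · rfl

theorem Prg.kernel : Prg fun _ s s' => ∃ g, s' = s.put 5 g ∧
    IsKernel (gr (s.dat 2)) (diag (s.dat 4)) (diag g) := by
  refine (Prg.storeSet ((DefSet.diag 4 16).kernelStep (DefSet.diag 5 16) 2) 5).iterate.mono ?_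
  rintro m s s' ⟨q, rfl, rfl, hq⟩
  have key : ∀ i, ∃ g, q i = (q 0).put 5 g ∧ diag g =
      (kernelStep (gr ((q 0).dat 2)) (diag ((q 0).dat 4)))^[i] (diag ((q 0).dat 5)) := by
    intro i
    induction i with
    | zero => exact ⟨_, (put_self _ 5).symm, rfl⟩
    | succ i ih =>
      obtain ⟨g, hg, e⟩ := ih
      obtain ⟨g', hg', e'⟩ := hq i
      refine ⟨g', by rw [hg', hg, put_put], ?_⟩
      rw [Function.iterate_succ_apply', e', hg, ← e]
      simp
  obtain ⟨g, hg, e⟩ := key (m + 1)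
  refine ⟨g, hg, ?_⟩
  rw [e]
  have := isKernel_iterate (G := gr ((q 0).dat 2)) (diag ((q 0).dat 4)) (diag ((q 0).dat 5))
  rwa [Fintype.card_fin] at this

/-- The set that is searched for a stable set. -/
def searchSet (m : ℕ) (s : St m) : Set (Fin (m + 1)) :=
  {v | (HasLoosePart (gr (s.dat 2)) (tup s 10 5) → v ∈ part (gr (s.dat 2)) (tup s 10 5) 0) ∧
    (¬ HasLoosePart (gr (s.dat 2)) (tup s 10 5) → v ∈ alive (gr (s.dat 2)))}

theorem defSet_searchSet : DefSet 16 searchSet where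
  def_mem x _ := ((Def.hasLoosePart 2 10 (by norm_num)).imp (Def.mem_part 2 10 x 0)).and
    ((Def.hasLoosePart 2 10 (by norm_num)).not.imp (Def.mem_alive 2 x))
  set_eq m s x v hx := by
    simp only [searchSet, set_dat, tup_set s v (show 10 + 5 ≤ x by omega)]

/-- The cycle in the variables from `10` on can be simplified by merging two vertices. -/
def IsTightChoice (k m : ℕ) (s : St m) : Prop :=
  HasTightParts (gr (s.dat 2)) (tup s 10 5) ∧
    NoMember k (merge (gr (s.dat 2)) {s.env 10, s.env 12} (s.env 10))

theorem def_isTightChoice (k : ℕ) : Def fun m s => IsTightChoice k m s := by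
  refine (Def.hasTightParts 2 10).and (DefGraph.noMember (b := 16) (by norm_num) ⟨fun x y hx _ =>
    Def.merge_adj (DefSet.pair 10 12 (by norm_num) (by norm_num)) 2 (by norm_num) hx,
    fun m s L t => ?_⟩ k)
  simp only [setFrom_dat, setFrom_env_of_lt s t (show 10 < 16 by norm_num),
    setFrom_env_of_lt s t (show 12 < 16 by norm_num)]

/-- One kernel computation serves two cases of `IsMergeable`, depending on whether a loose part was
found. It is overwritten by a pair `{c 0, c 2}` if there is no loose part but a suitable tight
five-cycle. -/
theorem Prg.mergeable (k : ℕ) : Prg fun _ s s' => s'.dat 2 = s.dat 2 ∧ s'.dat 3 = s.dat 3 ∧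
    IsMergeable k (gr (s.dat 2)) (diag (s'.dat 5)) := by
  refine (((Prg.chooseTuple (Def.hasLoosePart 2 10 (by norm_num)) (b := 10) (by norm_num) 5).comp
    (Prg.storeSet (defSet_searchSet.deficient 2) 4)).comp (Prg.kernel.comp (Prg.ite
      ((Def.hasLoosePart 2 10 (by norm_num)).not.and
        ((def_isTightChoice k).exTuple (b := 10) (by norm_num) 5))
      ((Prg.chooseTuple (def_isTightChoice k) (b := 10) (by norm_num) 5).comp
        (Prg.storeSet (DefSet.pair 10 12 (by norm_num) (by norm_num)) 5)) Prg.skip))).mono ?_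
  rintro m s s' ⟨_, ⟨_, ⟨t, rfl, ht⟩, g, rfl, hg⟩, _, ⟨g', rfl, hg'⟩, h⟩
  simp only [put_dat, setFrom_dat, tup_setFrom] at hg ht hg'
  simp only [Nat.reduceEqDiff, if_false, if_true, hg] at hg'
  have ht2 : tup (((s.setFrom 10 t).put 4 g).put 5 g') 10 5 = t := tup_setFrom s 10 t
  by_cases hl : HasLoosePart (gr (s.dat 2)) t
  · rcases h with ⟨h, -⟩ | ⟨-, rfl⟩
    · refine absurd hl ?_
      simpa [ht2] using h.1
    · refine ⟨by simp, by simp, .inl ⟨t, hl, ?_⟩⟩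
      have : searchSet m (s.setFrom 10 t) = part (gr (s.dat 2)) t 0 := by
        ext v; simp [searchSet, hl]
      rw [this] at hg'
      simpa using hg'
  · have hno : ¬ ∃ c, HasLoosePart (gr (s.dat 2)) c := fun h => hl (ht h)
    have : searchSet m (s.setFrom 10 t) = alive (gr (s.dat 2)) := by
      ext v; simp [searchSet, hl]
    rw [this] at hg'
    rcases h with ⟨h, _, ⟨t', rfl, ht'⟩, g'', rfl, hg''⟩ | ⟨h, rfl⟩
    · have h2 := ht' h.2
      refine ⟨by simp, by simp, .inr (.inl ⟨t', ?_⟩)⟩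
      unfold IsTightChoice at h2
      simp only [tup_setFrom, setFrom_dat, put_dat, Nat.reduceEqDiff, if_false, if_true] at h2 hg'' ⊢
      exact ⟨h2.1, h2.2, hg''⟩
    · refine ⟨by simp, by simp, .inr (.inr ⟨hno, ?_, by simpa using hg'⟩)⟩
      rintro ⟨c, hc⟩
      refine h ⟨by simpa [ht2] using hl, c, ?_⟩
      unfold IsTightChoice
      simp only [tup_setFrom, setFrom_dat, put_dat, Nat.reduceEqDiff, if_false]
      exact hc

/-- Array 3 is updated first: entries in the stable set become `z`. Then array 2 is replaced by the
merged graph. -/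
theorem Prg.reduce (k : ℕ) : Prg fun m s s' => ∃ S z, IsMergeable k (gr (s.dat 2)) S ∧
    (S.Nonempty → z ∈ S) ∧ gr (s'.dat 2) = merge (gr (s.dat 2)) S z ∧
    ∀ v w : Fin (m + 1), s.dat 3 v v = w → s'.dat 3 v v = rep S z w := by
  classical
  obtain ⟨f, hf, f1, f2⟩ := DefNum.cases (((Def.eq (.get 3 16 16) (.idx 18)).and
    (Def.mem_diag 5 18)).ex 18 (by norm_num)) (.idx 15) (.get 3 16 16)
  have hm : Def fun m s => (merge (gr (s.dat 2)) (diag (s.dat 5)) (s.env 15)).Adj (s.env 16)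
      (s.env 17) := Def.merge_adj (DefSet.diag 5 16) 2 (by norm_num) le_rfl
  refine (((Prg.mergeable k).comp (Prg.choose (Def.mem_diag 5 15) 15 (by norm_num))).comp
    ((Prg.fill hf 3 16 17 (by norm_num) (by norm_num) (by norm_num)).comp
      (Prg.storeGraph hm (fun m s u v => by simp) 2))).mono ?_
  rintro m s s' ⟨_, ⟨r, ⟨h2, h3, hr⟩, z, rfl, hz⟩, _, rfl, g, rfl, hg⟩
  simp only [set_dat, set_env, if_true] at hz
  refine ⟨_, z, hr, hz, ?_, fun v w hvw => ?_⟩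
  · simpa [h2] using hg
  · simp only [put_dat, Nat.reduceEqDiff, if_true, if_false]
    by_cases hw : w ∈ diag (r.dat 5)
    · rw [rep_of_mem hw, f1 _ _ ⟨w, by simp [h3, hvw, hw]⟩]
      simp
    · rw [rep_of_notMem hw, f2 _ _ (by
        rintro ⟨w', e, hw'⟩
        simp only [set_dat, set_env, Nat.reduceEqDiff, if_true, if_false, h3, hvw] at e hw'
        rw [← Fin.ext e] at hw'
        exact hw hw')]
      simp [h3, hvw]

/-- The array `2` holds a `k`-colorable homomorphic image of `G` in the class, and the array `3`
the homomorphism. -/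
def IsImage {m : ℕ} (k : ℕ) (G : SimpleGraph (Fin (m + 1))) (s : St m) : Prop :=
  IsP5CoP5Free (gr (s.dat 2)) ∧ (gr (s.dat 2)).Colorable k ∧
    ∃ h : G →g gr (s.dat 2), ∀ v, s.dat 3 v v = h v

theorem deficient_merge_eq_empty {V : Type*} {A : SimpleGraph V} {S : Set V} {z : V}
    (h : deficient A (alive A) = ∅) (hsub : alive (merge A S z) ⊆ alive A) :
    deficient (merge A S z) (alive (merge A S z)) = ∅ := by
  have hrep : ∀ u ∈ alive (merge A S z), rep S z u = u := by
    rintro u ⟨v, huv⟩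
    by_cases hu : u ∈ S
    · rw [rep_of_mem hu]
      by_contra hne
      exact not_merge_adj hu (Ne.symm hne) huv
    · exact rep_of_notMem hu
  rw [Set.eq_empty_iff_forall_notMem]
  rintro u ⟨hu, v, hv, hvu, hadj⟩
  exact hadj ⟨hvu.symm, u, v, hrep u hu, hrep v hv,
    adj_of_deficient_eq_empty h (hsub hu) (hsub hv) hvu.symm⟩

theorem Prg.reduceAll (k : ℕ) : Prg fun m s s' => ∀ G : SimpleGraph (Fin (m + 1)), IsImage k G s →
    IsImage k G s' ∧ deficient (gr (s'.dat 2)) (alive (gr (s'.dat 2))) = ∅ := by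
  refine (Prg.reduce k).iterate.mono ?_
  rintro m s s' ⟨q, rfl, rfl, hq⟩ G h0
  -- Until the non-isolated vertices form a clique, each round isolates a vertex; afterwards they
  -- remain a clique. So one round per vertex suffices.
  have key : ∀ i, IsImage k G (q i) ∧ ((alive (gr ((q i).dat 2))).ncard + i ≤ m + 1 ∨
      deficient (gr ((q i).dat 2)) (alive (gr ((q i).dat 2))) = ∅) := by
    intro i
    induction i with
    | zero =>
      refine ⟨h0, .inl ?_⟩
      simpa using Set.ncard_le_card (alive (gr ((q 0).dat 2)))
    | succ i ih =>
      obtain ⟨⟨hfree, hcol, f, hf⟩, hprog⟩ := ih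
      obtain ⟨S, z, hS, hz, hgr, hrep⟩ := hq i
      have hred := hS.isReduction hfree hcol hz
      refine ⟨⟨hgr ▸ hred.free, hgr ▸ hred.colorable, ⟨fun v => rep S z (f v), fun {u v} huv => ?_⟩,
        fun v => ?_⟩, ?_⟩
      · rw [hgr]
        exact merge_adj_rep hred.stable hz (f.map_adj huv)
      · exact hrep v (f v) (hf v)
      · rw [hgr]
        rcases hred.progress with h | ⟨h, rfl⟩
        · have hlt := Set.ncard_lt_ncard h
          rcases hprog with hp | hp
          · left; omega
          · right; exact deficient_merge_eq_empty hp h.subset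
        · right
          rwa [merge_empty]
  obtain ⟨h1, h2 | h2⟩ := key (m + 1)
  · refine ⟨h1, ?_⟩
    have : alive (gr ((q (m + 1)).dat 2)) = ∅ := (Set.ncard_eq_zero).1 (by omega)
    ext v
    simp [deficient, this]
  · exact ⟨h1, h2⟩

open Classical in
-- In the final graph a vertex receives as color the number of smaller non-isolated vertices, or 0
-- if it is isolated. Pulling this back along the homomorphism colors the input.
theorem Prg.coloring (k : ℕ) : Prg fun _ s s' => IsP5CoP5Free (gr (s.dat 0)) →
    (gr (s.dat 0)).Colorable k →
      ∃ f : (gr (s.dat 0)).Coloring (Fin k), ∀ v w, s'.dat 1 v w = (f v : ℕ) := by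
  have hc := DefNum.count ((Def.mem_alive 2 18).and ((Def.lt (.idx 18) (.get 3 16 16)).and
    (((Def.eq (.get 3 16 16) (.idx 19)).and (Def.mem_alive 2 19)).ex 19 (by norm_num)))) 18
    (by norm_num)
  refine (((Prg.storeGraph (Def.adj 0 16 17) (fun m s u v => rfl) 2).comp
    (Prg.fill (.idx 16) 3 16 17 (by norm_num) (by norm_num) (by norm_num))).comp
    ((Prg.reduceAll k).comp (Prg.fill hc 1 16 17 (by norm_num) (by norm_num) (by norm_num)))).mono ?_
  rintro m s s' ⟨_, ⟨_, ⟨g, rfl, hg⟩, rfl⟩, r, hr, rfl⟩ hfree hcol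
  obtain ⟨⟨-, hAk, h, hh⟩, hdef⟩ := hr (gr (s.dat 0)) ⟨by simpa [hg] using hfree,
    by simpa [hg] using hcol, ⟨fun v => v, fun {u v} huv => by simpa [hg] using huv⟩, fun v => by simp; rfl⟩
  let col : Fin (m + 1) → ℕ := fun w =>
    (Finset.univ.filter fun u => u ∈ alive (gr (r.dat 2)) ∧ u < w ∧ w ∈ alive (gr (r.dat 2))).card
  have hlt : ∀ w, col w < k := by
    intro w
    by_cases hw : w ∈ alive (gr (r.dat 2))
    · simpa [col, hw] using card_lt_of_deficient_eq_empty hAk hdef hw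
    -- Color 0 requires `0 < k`, which holds because some vertex has a color.
    · obtain ⟨f⟩ := hcol
      simpa [col, hw] using (f w).pos
  refine ⟨Coloring.mk (fun v => ⟨col (h v), hlt _⟩) fun {u v} huv => ?_, fun v w => ?_⟩
  · have key : ∀ a b, (gr (r.dat 2)).Adj a b → a < b → col a ≠ col b := by
      intro a b hab hlt
      have ha : a ∈ alive (gr (r.dat 2)) := ⟨b, hab⟩
      have hb : b ∈ alive (gr (r.dat 2)) := ⟨a, hab.symm⟩
      refine (Finset.card_lt_card (Finset.ssubset_iff_of_subset (fun u hu => ?_) |>.2 ⟨a, ?_, ?_⟩)).ne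
      · simp only [Finset.mem_filter, Finset.mem_univ, true_and] at hu ⊢
        exact ⟨hu.1, hu.2.1.trans hlt, hb⟩
      · simp [ha, hb, hlt]
      · simp
    have hadj := h.map_adj huv
    simp only [ne_eq, Fin.mk.injEq]
    rcases lt_or_gt_of_ne hadj.ne with hl | hl
    · exact key _ _ hadj hl
    · exact fun e => key _ _ hadj.symm hl e.symm
  · change _ = col (h v)
    simp only [put_dat, if_true, col]
    congr
    funext u
    simp [hh, Fin.val_inj]

end P5Graphs

/-! ### Producing and checking certificates -/

namespace P5Graphs

open SimpleGraph

/-! ### The certifying algorithm -/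

theorem adjEntry_ne_zero {n : ℕ} {G : SimpleGraph (Fin n)} {u v : Fin n} :
    adjEntry G u v ≠ 0 ↔ G.Adj u v := by
  unfold adjEntry
  constructor
  · intro h
    by_contra hc
    refine h (if_neg ?_)
    rintro ⟨a, b, ha, hb, hab⟩
    rw [Fin.ext ha, Fin.ext hb] at hab
    exact hc hab
  · intro h
    rw [if_pos ⟨u, v, rfl, rfl, h⟩]
    exact one_ne_zero

theorem gr_graphInput {m : ℕ} (G : SimpleGraph (Fin (m + 1))) :
    gr ((view m (graphInput G)).dat 0) = G :=
  gr_eq fun u v => by simpa [view, graphInput] using adjEntry_ne_zero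

/-- Writing the vertices in the variables from `20` on to the first column of the array `1`. -/
theorem exists_writeTuple (L : ℕ) : ∃ F, Doable true F ∧ ∀ m σ, σ.var 0 = m + 1 →
    (∀ x, x ≠ 9 → (F σ).var x = σ.var x) ∧
      ∀ i < L, (F σ).arr 1 i 0 = (view m σ).env (20 + i) := by
  induction L with
  | zero => exact ⟨_, Doable.id true, fun m σ _ => ⟨fun _ _ => rfl, by simp⟩⟩
  | succ L ih =>
    obtain ⟨F, hF, hF'⟩ := ih
    obtain ⟨g, hg, hg'⟩ := DefNum.idx (20 + L)
    -- The length is fixed, so the writes are unrolled to constant addresses, with variable 9 as a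
    -- buffer.
    refine ⟨_, (Doable.put 1 L 9).comp ((Doable.setVar 9 (by norm_num) hg).comp hF),
      fun m σ hσ => ⟨fun x hx => ?_, fun i hi => ?_⟩⟩
    · rw [setArr_var, setVar_var_ne _ hx, (hF' m σ hσ).1 x hx]
    · have h0 : (F σ).var 0 = m + 1 := by rw [hF.var_zero, hσ]
      have he : (view m (F σ)).env (20 + L) = (view m σ).env (20 + L) := by
        simp only [view, (hF' m σ hσ).1 (20 + L) (by omega)]
      rw [setArr_arr, setVar_var_self, hg' m _ h0, setVar_arr]
      beta_reduce
      rw [he]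
      split_ifs with h
      · rw [h.2.1]
      · exact (hF' m σ hσ).2 i (by omega)

/-- Searching for a critical subgraph with fewer than `N` vertices. -/
theorem exists_writeMember (k N : ℕ) : ∃ F, Doable true F ∧ ∀ m σ, σ.var 0 = m + 1 →
    (∃ L < N, ∃ t : Fin L → Fin (m + 1), IsMemberTuple k (gr ((view m σ).dat 0)) t) →
    ∃ (L : ℕ) (t : Fin L → Fin (m + 1)), IsMemberTuple k (gr ((view m σ).dat 0)) t ∧
      (F σ).var 1 = 0 ∧ (F σ).var 2 = L ∧ ∀ i : Fin L, (F σ).arr 1 i 0 = t i := by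
  classical
  induction N with
  | zero => exact ⟨_, Doable.id true, fun m σ _ h => by simp at h⟩
  | succ N ih =>
    obtain ⟨F, hF, hF'⟩ := ih
    -- The length `N` is tried before the shorter ones; these cases are unrolled in the program.
    obtain ⟨φ, hφ, hφ'⟩ := (DefGraph.gr 0 20).exists_isMemberTuple (by norm_num) k N
    obtain ⟨E, hE, hE'⟩ := Prg.chooseTuple ((DefGraph.gr 0 20).isMemberTuple k N) (b := 20)
      (by norm_num) N
    obtain ⟨W, hW, hW'⟩ := exists_writeTuple N
    refine ⟨_, Doable.ite hφ ((Doable.setVar 1 (by norm_num) (.lit true 0)).comp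
      ((Doable.setVar 2 (by norm_num) (.lit true N)).comp (hW.comp hE))) hF, fun m σ hσ h => ?_⟩
    by_cases hs : φ σ
    · rw [if_pos hs]
      obtain ⟨t, ht, ht'⟩ := hE' m σ hσ
      have hw := hW' m (E σ) (by rw [hE.var_zero, hσ])
      rw [hφ' m σ hσ] at hs
      simp only [tup_setFrom, setFrom_dat, ht] at ht'
      refine ⟨N, t, ht' hs, by simp, by simp [setVar_var], fun i => ?_⟩
      rw [setVar_arr, setVar_arr, hw.2 i i.2, ht]
      exact congrArg Fin.val (congrFun (tup_setFrom (view m σ) 20 t) i)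
    · rw [if_neg hs]
      refine hF' m σ hσ ?_
      obtain ⟨L, hL, t, ht⟩ := h
      rcases Nat.lt_succ_iff_lt_or_eq.1 hL with hL | rfl
      · exact ⟨L, hL, t, ht⟩
      · exact absurd ((hφ' m σ hσ).2 ⟨t, ht⟩) hs

theorem IsMemberTuple.isCertificate {n k L : ℕ} {G : SimpleGraph (Fin n)} {t : Fin L → Fin n}
    (h : IsMemberTuple (k + 1) G t) :
    IsCertificate G k false (List.ofFn fun i => (t i : ℕ)) := by
  refine ⟨List.ofFn t, List.nodup_ofFn.2 h.1, by rw [List.map_ofFn]; rfl, ?_⟩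
  rw [show {v | v ∈ List.ofFn t} = Set.range t by ext v; simp [List.mem_ofFn]]
  exact h.isMember_induce

theorem outputs_ofFn {σ : Store} {ans : Bool} {L : ℕ} {g : Fin L → ℕ} (h1 : σ.var 1 = ans.toNat)
    (h2 : σ.var 2 = L) (h3 : ∀ i : Fin L, σ.arr 1 i 0 = g i) : σ.Outputs ans (List.ofFn g) := by
  refine ⟨h1, by simpa using h2, fun i hi => ?_⟩
  rw [List.length_ofFn] at hi
  rw [h3 ⟨i, hi⟩]
  simp [List.getD, hi]

theorem exists_solver (k : ℕ) : ∃ F, Doable true F ∧ ∀ (n : ℕ) (G : SimpleGraph (Fin n)),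
    IsP5CoP5Free G → ∃ (ans : Bool) (cert : List ℕ), (F (graphInput G)).Outputs ans cert ∧
      (ans = true ↔ G.Colorable k) ∧ IsCertificate G k ans cert := by
  classical
  obtain ⟨N, hN⟩ := exists_card_bound (k + 1)
  obtain ⟨E, hE, hE'⟩ := exists_writeMember (k + 1) (N + 1)
  obtain ⟨Y, hY, hY'⟩ := Prg.coloring k
  obtain ⟨φ, hφ, hφ'⟩ := (DefGraph.gr 0 20).noMember (by norm_num) k
  refine ⟨_, Doable.ite (Testable.ne_zero (.var true 0)) (Doable.ite hφ
    ((Doable.setVar 1 (by norm_num) (.lit true 1)).comp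
      ((Doable.setVar 2 (by norm_num) (.var true 0)).comp hY)) hE)
    (Doable.setVar 1 (by norm_num) (.lit true 1)), fun n G hG => ?_⟩
  cases n with
  | zero =>
    -- The vertex calculus presupposes at least one vertex, so the empty graph is treated
    -- separately, with the empty list as coloring.
    rw [if_neg (by simp [graphInput])]
    have hc : G.Colorable k := .of_isEmpty k
    exact ⟨true, [], ⟨by simp, by simp [setVar_var, graphInput], by simp⟩, by simp [hc],
      ⟨hc.some, by simp⟩⟩
  | succ m =>
    have h0 : (graphInput G).var 0 = m + 1 := by simp [graphInput]
    rw [if_pos (by rw [h0]; omega)]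
    have hgr := gr_graphInput G
    by_cases hs : φ (graphInput G)
    · rw [if_pos hs]
      have := hY' m _ h0
      rw [hφ' m _ h0] at hs
      rw [hgr, noMember_iff hG] at hs
      rw [hgr] at this
      obtain ⟨f, hf⟩ := this hG hs
      refine ⟨true, List.ofFn fun v => (f v : ℕ), outputs_ofFn (by simp) ?_ fun i => ?_,
        by simp [hs], f, rfl⟩
      · rw [setVar_var_ne _ (by norm_num), setVar_var_self, hY.var_zero, h0]
      · rw [setVar_arr, setVar_arr]
        exact hf i 0
    · rw [if_neg hs]
      rw [hφ' m _ h0] at hs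
      beta_reduce at hs
      rw [hgr] at hs
      have hc : ¬ G.Colorable k := fun h => hs ((noMember_iff hG).2 h)
      rw [noMember_iff_tuple hN, not_not] at hs
      obtain ⟨L, t, ht⟩ := hs
      obtain ⟨L, t, ht, h1, h2, h3⟩ := hE' m _ h0 ⟨L, L.2, t, by rwa [hgr]⟩
      rw [hgr] at ht
      exact ⟨false, _, outputs_ofFn (by simpa using h1) h2 h3, by simp [hc], ht.isCertificate⟩

theorem exists_solvesWithCertificate (k : ℕ) : ∃ P, SolvesWithCertificate k P := by
  obtain ⟨F, hF, hF'⟩ := exists_solver k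
  obtain ⟨b, -, -, -, -, hb⟩ := hF
  -- The threshold protects the output variables 1 and 2 and the array 1 from scratch use.
  obtain ⟨P, p, -, hP⟩ := hb (max b 3) (by omega)
  refine ⟨P, p, fun n G hG => ?_⟩
  obtain ⟨τ, t, ex, ht, ha⟩ := hP (graphInput G)
  obtain ⟨ans, cert, ⟨o1, o2, o3⟩, h⟩ := hF' n G hG
  refine ⟨τ, t, ans, cert, ex, by simpa [graphInput] using ht, ⟨?_, ?_, ?_⟩, h⟩
  · rw [ha.1 1 (by omega), o1]
  · rw [ha.1 2 (by omega), o2]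
  · rw [ha.2 1 (by omega)]
    exact o3

/-! ### Checking certificates -/

section Check

variable {n : ℕ} (G : SimpleGraph (Fin n)) (k : ℕ) (ans : Bool) (cert : List ℕ)

theorem certifiedInput_arr_one (i : ℕ) : (certifiedInput G ans cert).arr 1 i 0 = cert.getD i 0 := by
  simp [certifiedInput]

theorem certifiedInput_arr_zero : (certifiedInput G ans cert).arr 0 = adjEntry G := by
  funext i j
  simp [certifiedInput]

theorem eq_ofFn_iff {L : ℕ} {g : Fin L → ℕ} : cert = List.ofFn g ↔
    cert.length = L ∧ ∀ i : Fin L, cert.getD i 0 = g i := by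
  constructor
  · rintro rfl
    refine ⟨by simp, fun i => by simp [List.getD]⟩
  · rintro ⟨rfl, h⟩
    refine List.ext_getElem (by simp) fun i h1 h2 => ?_
    rw [List.getElem_ofFn, ← h ⟨i, h1⟩]
    simp [List.getD, h1]

theorem isCertificate_true_iff : IsCertificate G k true cert ↔ cert.length = n ∧
    ∀ i < n, cert.getD i 0 < k ∧ ∀ j < n, adjEntry G i j ≠ 0 → cert.getD i 0 ≠ cert.getD j 0 := by
  simp only [IsCertificate, eq_ofFn_iff]
  constructor
  · rintro ⟨c, h1, h2⟩
    refine ⟨h1, fun i hi => ?_⟩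
    rw [h2 ⟨i, hi⟩]
    refine ⟨(c ⟨i, hi⟩).2, fun j hj hij => ?_⟩
    rw [h2 ⟨j, hj⟩]
    exact fun e => c.valid ((adjEntry_ne_zero (u := ⟨i, hi⟩) (v := ⟨j, hj⟩)).1 hij) (Fin.ext e)
  · rintro ⟨h1, h2⟩
    refine ⟨Coloring.mk (fun v => ⟨cert.getD v 0, (h2 v v.2).1⟩) fun {u v} huv e => ?_, h1,
      fun v => rfl⟩
    exact (h2 u u.2).2 v v.2 (adjEntry_ne_zero.2 huv) (by simpa using e)

/-- Any valid list has at most `N` entries, so the right-hand side inspects a bounded number of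
numbers and adjacencies, whatever the size of the graph. -/
theorem isCertificate_false_iff {N : ℕ}
    (hN : ∀ n (X : SimpleGraph (Fin n)), IsMember (k + 1) X → n ≤ N) :
    IsCertificate G k false cert ↔ ∃ L : Fin (N + 1), cert.length = L ∧
      ((∀ i : Fin L, cert.getD i 0 < n) ∧
      (∀ i j : Fin L, cert.getD i 0 = cert.getD j 0 → i = j) ∧
      ∃ X : SimpleGraph (Fin L), (∀ i j : Fin L, X.Adj i j ↔
        adjEntry G (cert.getD i 0) (cert.getD j 0) ≠ 0) ∧ IsMember (k + 1) X) := by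
  constructor
  · rintro ⟨l, hl, hc, hm⟩
    obtain ⟨L, t, rfl⟩ : ∃ (L : ℕ) (t : Fin L → Fin n), l = List.ofFn t :=
      ⟨_, l.get, (List.ofFn_get l).symm⟩
    rw [show {v | v ∈ List.ofFn t} = Set.range t by ext v; simp [List.mem_ofFn]] at hm
    have ht := isMemberTuple_iff.2 ⟨List.nodup_ofFn.1 hl, hm⟩
    rw [List.map_ofFn, eq_ofFn_iff] at hc
    obtain ⟨h1, h2⟩ := hc
    refine ⟨⟨L, Nat.lt_succ_of_le (hN _ _ ht.2)⟩, h1, fun i => ?_, fun i j hij => ?_, _,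
      fun i j => ?_, ht.2⟩
    · rw [h2 i]
      exact (t i).2
    · rw [h2 i, h2 j] at hij
      exact ht.1 (Fin.ext hij)
    · rw [h2 i, h2 j]
      exact (adjEntry_ne_zero (u := t i) (v := t j)).symm
  · rintro ⟨L, h1, h2, h3, X, hX, hm⟩
    have ht : IsMemberTuple (k + 1) G (fun i => (⟨cert.getD i 0, h2 i⟩ : Fin n)) :=
      isMemberTuple_iff_table.2 ⟨fun i j hij => h3 i j (congrArg Fin.val hij), X, fun i j => by
        rw [hX]
        exact adjEntry_ne_zero (u := ⟨_, h2 i⟩) (v := ⟨_, h2 j⟩), hm⟩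
    have := ht.isCertificate
    rwa [← (eq_ofFn_iff cert).2 ⟨h1, fun i => rfl⟩] at this

end Check

theorem testable_colorCertificate (k : ℕ) : Testable true fun σ => σ.var 2 = σ.var 0 ∧
    ∀ i < σ.var 0, σ.arr 1 i 0 < k ∧
      ∀ j < σ.var 0, σ.arr 0 i j ≠ 0 → σ.arr 1 i 0 ≠ σ.arr 1 j 0 := by
  have e := fun x => Evaluable.get (q := true) 1 (.var true x) (.lit true 0)
  exact (Testable.eq (.var true 2) (.var true 0)).and (Testable.all 10 (by norm_num)
    ((Testable.lt (e 10) (.lit true k)).and (Testable.all 11 (by norm_num)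
      ((Testable.ne_zero (Evaluable.get 0 (.var true 10) (.var true 11))).imp
        (Testable.eq (e 10) (e 11)).not))))

/-- No quantifier ranges over the vertices: all entries are read at constant positions and combined
in fixed tables, so constant time suffices. -/
theorem testable_memberCertificate (k N : ℕ) : Testable false fun σ => ∃ L : Fin (N + 1),
    σ.var 2 = L ∧ ((∀ i : Fin L, σ.arr 1 i 0 < σ.var 0) ∧
      (∀ i j : Fin L, σ.arr 1 i 0 = σ.arr 1 j 0 → i = j) ∧
      ∃ X : SimpleGraph (Fin L), (∀ i j : Fin L, X.Adj i j ↔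
        σ.arr 0 (σ.arr 1 i 0) (σ.arr 1 j 0) ≠ 0) ∧ IsMember (k + 1) X) := by
  have e := fun i => Evaluable.get (q := false) 1 (.lit false i) (.lit false 0)
  refine Testable.table (ι := Fin (N + 1)) (fun L => (Testable.eq (.var false 2) (.lit false L)).and ?_)
    (fun f => ∃ L, f L)
  refine (Testable.table (ι := Fin L) (fun i => Testable.lt (e i) (.var false 0)) (fun f => ∀ i, f i)).and
    ((Testable.table (ι := Fin L × Fin L) (fun i => Testable.eq (e i.1) (e i.2))
      (fun f => ∀ i j, f (i, j) → i = j)).and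
    (Testable.table (ι := Fin L × Fin L) (fun i => Testable.ne_zero (Evaluable.get 0 (e i.1) (e i.2)))
      (fun f => ∃ X : SimpleGraph (Fin L), (∀ i j : Fin L, X.Adj i j ↔ f (i, j)) ∧
        IsMember (k + 1) X)))

theorem exists_checksCertificates (k : ℕ) : ∃ Q, ChecksCertificates k Q := by
  classical
  obtain ⟨N, hN⟩ := exists_card_bound (k + 1)
  have hY := Doable.setVar 3 (by norm_num) (testable_colorCertificate k)
  have hE := Doable.setVar 3 (by norm_num) (testable_memberCertificate k N)
  obtain ⟨b, -, -, -, -, hb⟩ := hY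
  obtain ⟨P, p, -, hP⟩ := hb (max b 4) (by omega)
  obtain ⟨b', -, -, -, -, hb'⟩ := hE
  obtain ⟨P', p', hp', hP'⟩ := hb' (max b' 4) (by omega)
  -- The program for the answer no was compiled with `q = false`, so its time bound is a constant
  -- polynomial. The 2 extra steps pay for the initial branching on the answer.
  obtain ⟨c, rfl⟩ : ∃ c, p' = .C c := hp'.resolve_left (by simp)
  refine ⟨.cond (.var 1) P P', p + .C (c + 2), c + 2, fun n G _ ans cert => ?_⟩
  have h0 : (certifiedInput G ans cert).var 0 = n := by simp [certifiedInput]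
  have h1 : (certifiedInput G ans cert).var 1 = ans.toNat := by simp [certifiedInput]
  have h2 : (certifiedInput G ans cert).var 2 = cert.length := by simp [certifiedInput]
  cases ans with
  | true =>
    obtain ⟨τ, t, ex, ht, ha⟩ := hP (certifiedInput G true cert)
    have h3 := ha.1 3 (by omega)
    simp only [setVar_var_self, h0, h2, certifiedInput_arr_one, certifiedInput_arr_zero,
      ← isCertificate_true_iff] at h3
    refine ⟨τ, _, .cond_true (by simp [Expr.eval, h1]) ex, ?_, by simp, fun h => ?_, fun h => ?_⟩
    · rw [h0] at ht
      simp only [Expr.cost, Polynomial.eval_add, Polynomial.eval_C]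
      omega
    · rw [h3, if_pos h]
    · rw [h3, if_neg h]
  | false =>
    obtain ⟨τ, t, ex, ht, ha⟩ := hP' (certifiedInput G false cert)
    have h3 := ha.1 3 (by omega)
    simp only [setVar_var_self, h0, h2, certifiedInput_arr_one, certifiedInput_arr_zero,
      ← isCertificate_false_iff G k cert hN] at h3
    rw [Polynomial.eval_C] at ht
    refine ⟨τ, _, .cond_false (by simp [Expr.eval, h1]) ex, ?_, fun _ => ?_, fun h => ?_, fun h => ?_⟩
    · simp only [Expr.cost, Polynomial.eval_add, Polynomial.eval_C]
      omega
    · simp only [Expr.cost]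
      omega
    · rw [h3, if_pos h]
    · rw [h3, if_neg h]

theorem hasCertifyingAlgorithm (k : ℕ) : HasCertifyingAlgorithm k :=
  ⟨exists_solvesWithCertificate k, exists_checksCertificates k⟩

end P5Graphs

theorem mainTheorem2 (k : ℕ) :
    (P5Graphs.C k).Finite ∧
    (2 ≤ k → P5Graphs.f k ≤
      (∑ i ∈ Finset.Icc 1 (k - 1), P5Graphs.f i * P5Graphs.f (k - i)) + P5Graphs.f (k - 2) ^ 5) ∧
    P5Graphs.f k ≤ hyperoperation 4 5 k ∧
    P5Graphs.HasCertifyingAlgorithm k :=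
  ⟨P5Graphs.C_finite k, P5Graphs.f_le, P5Graphs.f_le_tower k, P5Graphs.hasCertifyingAlgorithm k⟩
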